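/- **Setting.** Consider the infinite one-dimensional unpinned chain of oscillators with configurations $\omega=(\mathbf r,\mathbf p)=(r_x,p_x)_{x\in\mathbb Z}$ ($r_x$ is the deformation $q_x-q_{x-1}$, $p_x$ the momentum of atom $x$). Let $\gamma>0$, $T>0$, $\tau\in\mathbb R$ and let $V\in C^2(\mathbb R)$ have bounded second derivative and satisfy $\int_{\mathbb R} e^{\ell r-V(r)/T}\,dr<\infty$ for all $\ell\in\mathbb R$ (for instance $0<c\le V''\le C$). Let $\mu=\mu_{\tau,T}$ be the Gibbs state, i.e. the product over $x\in\mathbb Z$ of the probability measures on $\mathbb R^2$ with density proportional to $\exp\{-T^{-1}(\tfrac{p_x^2}{2}+V(r_x)-\tau r_x)\}$. A function of $\omega$ is local if it depends on finitely many coordinates; $(\theta_x f)(\omega)=f(\theta_x\omega)$ with $(\theta_x\omega)_y=\omega_{y+x}$. Let $\mathbb H$ be the Hilbert space obtained by completing the bounded local measurable functions (equivalently, the local functions in $L^2(\mu)$) with respect to the semi-inner product $$\ll f,g\gg=\sum_{x\in\mathbb Z}\{\mu(f\,\theta_x g)-\mu(f)\mu(g)\},$$ and let $\mathbb H^a\subset\mathbb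 H$ be the closed subspace of functions antisymmetric in the momenta, i.e. the closure of the local $f\in L^2(\mu)$ with $f(\mathbf r,-\mathbf p)=-f(\mathbf r,\mathbf p)$. Let $\mathcal L=\mathcal A+\gamma\mathcal S$ be the generator of the chain with velocity-flip noise, $$\mathcal A f=\sum_{x}\big[(p_x-p_{x-1})\,\partial_{r_x}f+(V'(r_{x+1})-V'(r_x))\,\partial_{p_x}f\big],\qquad (\mathcal S f)(\mathbf r,\mathbf p)=\tfrac12\sum_x\,[f(\mathbf r,\mathbf p^x)-f(\mathbf r,\mathbf p)],$$ where $\mathbf p^x$ is $\mathbf p$ with the sign of $p_x$ changed; $\mathcal L$ is defined on the bounded local $C^1$ functions with bounded partial derivatives and then closed in $\mathbb H$. Let $j^e_{0,1}=-p_0V'(r_1)$ be the energy current. **Theorem.** For every $z>0$ the resolvent $(z-\mathcal L)^{-1}$ is a well-defined bounded operator on $\mathbb H$. For all $f,g\in\mathbb H^a$ the limit $$\sigma(f,g)=\lim_{z\to0,\;z>0}\ll f,(z-\mathcal L)^{-1}g\gg$$ exists (and is finite), and $\sigma(f,g)=\sigma(g,f)$. Moreover the limits as $z\to 0$, $z>0$,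 $$\kappa^e=\lim T^{-2}\ll j^e_{0,1}+\tau p_0,(z-\mathcal L)^{-1}(j^e_{0,1}+\tau p_0)\gg,\qquad \kappa^{e,r}=\lim T^{-1}\ll p_0,(z-\mathcal L)^{-1}(j^e_{0,1}+\tau p_0)\gg,$$ $$\kappa^{r}=\lim T^{-1}\ll p_0,(z-\mathcal L)^{-1}p_0\gg,\qquad \kappa^{r,e}=\lim T^{-2}\ll j^e_{0,1}+\tau p_0,(z-\mathcal L)^{-1}p_0\gg$$ exist and are finite, $\kappa^r=\gamma^{-1}$, and Onsager's relation $\kappa^{e,r}=\kappa^{r,e}=0$ holds. -/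

import Mathlib

open MeasureTheory Filter Topology

noncomputable section

/-- Configurations `ω = (r_x, p_x)_{x ∈ ℤ}` of the one-dimensional unpinned chain: `(ω x).1 = r_x` is
the deformation `q_x - q_{x-1}` and `(ω x).2 = p_x` is the momentum of the atom `x`. Only local
functions of `ω` (functions of finitely many coordinates) are used below. -/
abbrev Config : Type := ℤ → ℝ × ℝ

namespace Config

/-- The shift of configurations, `(shift x ω)_y = ω_{y + x}`; on functions, `θ_x f = f ∘ shift x`. -/
def shift (x : ℤ) (ω : Config) : Config := fun y => ω (y + x)

/-- `(r, p) ↦ (r, p^x)`: the sign of the momentum of atom `x` is flipped. -/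
def flipAt (x : ℤ) (ω : Config) : Config := Function.update ω x ((ω x).1, -(ω x).2)

/-- `(r, p) ↦ (r, -p)`: the signs of all the momenta are flipped. -/
def reverse (ω : Config) : Config := fun x => ((ω x).1, -(ω x).2)

/-- The partial derivative `∂_{r_x} f`. -/
def partialR (x : ℤ) (f : Config → ℝ) (ω : Config) : ℝ :=
  deriv (fun s : ℝ => f (Function.update ω x (s, (ω x).2))) (ω x).1

/-- The partial derivative `∂_{p_x} f`. -/
def partialP (x : ℤ) (f : Config → ℝ) (ω : Config) : ℝ :=
  deriv (fun s : ℝ => f (Function.update ω x ((ω x).1, s))) (ω x).2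

/-- `f` is local: it depends on finitely many coordinates only. -/
def IsLocal (f : Config → ℝ) : Prop := ∃ Λ : Finset ℤ, DependsOn f (Λ : Set ℤ)

/-- The class `C_0^1` of bounded local functions that are continuously differentiable with bounded
partial derivatives. -/
def IsC01 (f : Config → ℝ) : Prop :=
  ∃ (Λ : Finset ℤ) (F : (Λ → ℝ × ℝ) → ℝ), (∀ ω, f ω = F (fun x => ω x)) ∧ ContDiff ℝ 1 F ∧
    (∃ C, ∀ y, |F y| ≤ C) ∧ ∃ C, ∀ y, ‖fderiv ℝ F y‖ ≤ C

lemma measurable_shift (x : ℤ) : Measurable (shift x) := by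
  unfold shift; fun_prop

lemma dependsOn_shift {f : Config → ℝ} {Λ : Finset ℤ} (hf : DependsOn f (Λ : Set ℤ)) (x : ℤ) :
    DependsOn (fun ω => f (shift x ω)) ((Λ.image (· + x) : Finset ℤ) : Set ℤ) := by
  intro ω ω' h
  apply hf
  intro y hy
  exact h (y + x) (by simpa using hy)

end Config

open Config

/-- The data of an anharmonic chain with velocity-flip noise at equilibrium: an interaction potential
`V` of class `C²` with bounded second derivative, the noise intensity `γ > 0`, the temperature
`T > 0` and the tension `τ`. The partition functions of one site are assumed to be finite (for every
tension), so that the Gibbs states exist; this is automatic when `0 < c ≤ V''`. -/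
structure Chain where
  V : ℝ → ℝ
  γ : ℝ
  T : ℝ
  τ : ℝ
  contDiff_V : ContDiff ℝ 2 V
  bounded_V'' : ∃ C, ∀ r, |deriv (deriv V) r| ≤ C
  γ_pos : 0 < γ
  T_pos : 0 < T
  integrable_gibbs : ∀ l : ℝ, Integrable (fun r : ℝ => Real.exp (l * r - V r / T)) volume

namespace Chain

variable (M : Chain)

/-- The derivative `V'` of the interaction potential. -/
def V' : ℝ → ℝ := deriv M.V

/-- The law of `(r_x, p_x)` in the Gibbs state: the probability measure on `ℝ × ℝ` whose Lebesgue
density is proportional to `exp (-(p² / 2 + V r - τ r) / T)`. -/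
def siteMeasure : Measure (ℝ × ℝ) :=
  (volume : Measure (ℝ × ℝ)).tilted (fun y => -(y.2 ^ 2 / 2 + M.V y.1 - M.τ * y.1) / M.T)

/-- The infinite volume Gibbs state `μ_{τ,T}`, a product measure. -/
def gibbs : Measure Config := Measure.infinitePi (fun _ : ℤ => M.siteMeasure)

lemma integrable_site_weight_mul {a b : ℝ → ℝ}
    (ha : Integrable (fun r => Real.exp (M.τ / M.T * r - M.V r / M.T) * a r) volume)
    (hb : Integrable (fun p => Real.exp (-(1 / (2 * M.T)) * p ^ 2) * b p) volume) :
    Integrable (fun y : ℝ × ℝ =>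
      Real.exp (-(y.2 ^ 2 / 2 + M.V y.1 - M.τ * y.1) / M.T) * (a y.1 * b y.2)) volume := by
  have hT := M.T_pos.ne'
  have h := ha.mul_prod hb
  rw [← Measure.volume_eq_prod] at h
  refine h.congr (ae_of_all _ fun y => ?_)
  have : Real.exp (-(y.2 ^ 2 / 2 + M.V y.1 - M.τ * y.1) / M.T) =
      Real.exp (M.τ / M.T * y.1 - M.V y.1 / M.T) * Real.exp (-(1 / (2 * M.T)) * y.2 ^ 2) := by
    rw [← Real.exp_add]; congr 1; field_simp; ring
  simp only [this]; ring

lemma gauss_pos : 0 < 1 / (2 * M.T) := by have := M.T_pos; positivity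

instance : IsProbabilityMeasure M.siteMeasure := by
  apply isProbabilityMeasure_tilted
  have h := M.integrable_site_weight_mul (a := fun _ => 1) (b := fun _ => 1)
    (by simpa using M.integrable_gibbs (M.τ / M.T))
    (by simpa using integrable_exp_neg_mul_sq M.gauss_pos)
  simpa using h

instance : IsProbabilityMeasure M.gibbs := by unfold gibbs; infer_instance

lemma memLp_site_p : MemLp (fun y : ℝ × ℝ => y.2) 2 M.siteMeasure := by
  rw [memLp_two_iff_integrable_sq (by fun_prop)]
  unfold siteMeasure
  rw [integrable_tilted_iff]
  · have h := M.integrable_site_weight_mul (a := fun _ => 1) (b := fun p => p ^ 2)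
      (by simpa using M.integrable_gibbs (M.τ / M.T))
      (by
        have := integrable_rpow_mul_exp_neg_mul_sq M.gauss_pos (s := 2) (by norm_num)
        refine this.congr (ae_of_all _ fun p => ?_)
        simp [mul_comm])
    simpa using h
  · have h := M.integrable_site_weight_mul (a := fun _ => 1) (b := fun _ => 1)
      (by simpa using M.integrable_gibbs (M.τ / M.T))
      (by simpa using integrable_exp_neg_mul_sq M.gauss_pos)
    simpa using h

lemma continuous_V' : Continuous M.V' := M.contDiff_V.continuous_deriv (by norm_num)

lemma abs_V'_le : ∃ C, 0 ≤ C ∧ ∀ r, |M.V' r| ≤ C * (1 + |r|) := by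
  obtain ⟨C, hC⟩ := M.bounded_V''
  have hC0 : 0 ≤ C := (abs_nonneg _).trans (hC 0)
  have hd : Differentiable ℝ (deriv M.V) := by
    have h2 : ContDiff ℝ (1 + 1) M.V := by simpa [one_add_one_eq_two] using M.contDiff_V
    exact ((contDiff_succ_iff_deriv.1 h2).2.2).differentiable (by norm_num)
  refine ⟨C + |deriv M.V 0|, by positivity, fun r => ?_⟩
  have h := Convex.norm_image_sub_le_of_norm_deriv_le (f := deriv M.V) (s := Set.univ) (C := C)
    (x := 0) (y := r) (fun x _ => hd x) (fun x _ => hC x) convex_univ trivial trivial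
  simp only [Real.norm_eq_abs, sub_zero] at h
  have h3 : |deriv M.V r| ≤ |deriv M.V r - deriv M.V 0| + |deriv M.V 0| := by
    simpa using abs_add_le (deriv M.V r - deriv M.V 0) (deriv M.V 0)
  have : 0 ≤ |deriv M.V 0| * |r| := by positivity
  unfold V'
  nlinarith

lemma memLp_site_V' : MemLp (fun y : ℝ × ℝ => M.V' y.1) 2 M.siteMeasure := by
  have hm : Measurable (fun y : ℝ × ℝ => M.V' y.1) := M.continuous_V'.measurable.comp measurable_fst
  rw [memLp_two_iff_integrable_sq hm.aestronglyMeasurable]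
  unfold siteMeasure
  rw [integrable_tilted_iff]
  · have h := M.integrable_site_weight_mul (a := fun r => M.V' r ^ 2) (b := fun _ => 1)
      (by
        obtain ⟨C, hC0, hC⟩ := M.abs_V'_le
        have hI := ((M.integrable_gibbs (M.τ / M.T + 1)).add
          (M.integrable_gibbs (M.τ / M.T - 1))).const_mul (C ^ 2 * 4)
        refine hI.mono' ?_ (ae_of_all _ fun r => ?_)
        · have h1 := M.contDiff_V.continuous
          have h2 := M.continuous_V'
          exact (by fun_prop : Continuous fun r =>
            Real.exp (M.τ / M.T * r - M.V r / M.T) * M.V' r ^ 2).aestronglyMeasurable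
        · have e1 : Real.exp ((M.τ / M.T + 1) * r - M.V r / M.T) =
              Real.exp (M.τ / M.T * r - M.V r / M.T) * Real.exp r := by
            rw [← Real.exp_add]; congr 1; ring
          have e2 : Real.exp ((M.τ / M.T - 1) * r - M.V r / M.T) =
              Real.exp (M.τ / M.T * r - M.V r / M.T) * Real.exp (-r) := by
            rw [← Real.exp_add]; congr 1; ring
          have h1 : M.V' r ^ 2 ≤ C ^ 2 * (1 + |r|) ^ 2 := by
            rw [← mul_pow, ← sq_abs]
            exact pow_le_pow_left₀ (abs_nonneg _) (hC r) 2
          have h2 : (1 + |r|) ^ 2 ≤ 4 * Real.exp |r| := by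
            have := Real.quadratic_le_exp_of_nonneg (abs_nonneg r)
            have h4 := sq_nonneg (|r| - 1)
            nlinarith [abs_nonneg r]
          have h3 : Real.exp |r| ≤ Real.exp r + Real.exp (-r) := by
            rcases abs_choice r with h | h <;> rw [h] <;>
              linarith [Real.exp_pos r, Real.exp_pos (-r)]
          have hE := Real.exp_pos (M.τ / M.T * r - M.V r / M.T)
          rw [Real.norm_of_nonneg (by positivity)]
          simp only [Pi.add_apply, e1, e2]
          have h5 : M.V' r ^ 2 ≤ C ^ 2 * 4 * (Real.exp r + Real.exp (-r)) := by
            have : C ^ 2 * (1 + |r|) ^ 2 ≤ C ^ 2 * (4 * (Real.exp r + Real.exp (-r))) := by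
              gcongr; linarith
            linarith
          calc _ ≤ Real.exp (M.τ / M.T * r - M.V r / M.T) *
                (C ^ 2 * 4 * (Real.exp r + Real.exp (-r))) := by gcongr
            _ = _ := by ring)
      (by simpa using integrable_exp_neg_mul_sq M.gauss_pos)
    simpa using h
  · have h := M.integrable_site_weight_mul (a := fun _ => 1) (b := fun _ => 1)
      (by simpa using M.integrable_gibbs (M.τ / M.T))
      (by simpa using integrable_exp_neg_mul_sq M.gauss_pos)
    simpa using h


lemma iIndepFun_coord : ProbabilityTheory.iIndepFun (fun (x : ℤ) (ω : Config) => ω x) M.gibbs :=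
  ProbabilityTheory.iIndepFun_infinitePi (P := fun _ : ℤ => M.siteMeasure)
    (X := fun _ y => y) (fun _ => measurable_id)

lemma measurePreserving_coord (x : ℤ) :
    MeasurePreserving (fun ω : Config => ω x) M.gibbs M.siteMeasure :=
  measurePreserving_eval_infinitePi (fun _ : ℤ => M.siteMeasure) x

lemma measurePreserving_shift (x : ℤ) : MeasurePreserving (shift x) M.gibbs M.gibbs :=
  ⟨measurable_shift x, Measure.map_infinitePi_infinitePi_of_inj
    (P := fun _ : ℤ => M.siteMeasure) (add_left_injective x)⟩

/-- The local functions that are square integrable for the Gibbs state. -/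
def localL2 : Submodule ℝ (Config → ℝ) where
  carrier := {f | IsLocal f ∧ Measurable f ∧ MemLp f 2 M.gibbs}
  add_mem' := by
    rintro f g ⟨⟨Λ, hf⟩, hfm, hf2⟩ ⟨⟨Λ', hg⟩, hgm, hg2⟩
    refine ⟨⟨Λ ∪ Λ', fun ω ω' h => ?_⟩, hfm.add hgm, hf2.add hg2⟩
    simp only [Pi.add_apply]
    rw [hf fun i hi => h i (by simp_all), hg fun i hi => h i (by simp_all)]
  zero_mem' := ⟨⟨∅, fun _ _ _ => rfl⟩, measurable_const, MemLp.zero⟩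
  smul_mem' := by
    rintro c f ⟨⟨Λ, hf⟩, hfm, hf2⟩
    refine ⟨⟨Λ, fun ω ω' h => ?_⟩, hfm.const_smul c, hf2.const_smul c⟩
    simp only [Pi.smul_apply]
    rw [hf h]

/-- The type of local square integrable functions. -/
def LocalL2 : Type := M.localL2

instance : AddCommGroup M.LocalL2 := inferInstanceAs (AddCommGroup M.localL2)
instance : Module ℝ M.LocalL2 := inferInstanceAs (Module ℝ M.localL2)

/-- The function on configurations underlying an element of `LocalL2`. -/
def LocalL2.fn {M : Chain} (f : M.LocalL2) : Config → ℝ := Subtype.val (p := (· ∈ M.localL2)) f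

instance : CoeFun M.LocalL2 (fun _ => Config → ℝ) := ⟨LocalL2.fn⟩

/-- A local square integrable function as an element of `LocalL2`. -/
def LocalL2.mk {M : Chain} (f : Config → ℝ) (h₁ : IsLocal f) (h₂ : Measurable f)
    (h₃ : MemLp f 2 M.gibbs) : M.LocalL2 :=
  (⟨f, h₁, h₂, h₃⟩ : M.localL2)

lemma LocalL2.isLocal {M : Chain} (f : M.LocalL2) : IsLocal f := f.2.1
lemma LocalL2.measurable {M : Chain} (f : M.LocalL2) : Measurable f := f.2.2.1
lemma LocalL2.memLp {M : Chain} (f : M.LocalL2) : MemLp f 2 M.gibbs := f.2.2.2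

/-- The correlation `μ(f θ_x g) - μ(f) μ(g)`. -/
def corr (f g : Config → ℝ) (x : ℤ) : ℝ :=
  ∫ ω, f ω * g (shift x ω) ∂M.gibbs - (∫ ω, f ω ∂M.gibbs) * ∫ ω, g ω ∂M.gibbs

/-- The semi-inner product `≪f, g≫ = ∑_x (μ(f θ_x g) - μ(f) μ(g))`. -/
def semiInner (f g : Config → ℝ) : ℝ := ∑' x : ℤ, M.corr f g x

variable {M}

lemma integral_shift (x : ℤ) {f : Config → ℝ} (hf : Measurable f) :
    ∫ ω, f (shift x ω) ∂M.gibbs = ∫ ω, f ω ∂M.gibbs := by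
  have h := (M.measurePreserving_shift x).map_eq
  conv_rhs => rw [← h]
  rw [integral_map (measurable_shift x).aemeasurable hf.aestronglyMeasurable]

lemma memLp_shift (x : ℤ) {f : Config → ℝ} (hf : MemLp f 2 M.gibbs) :
    MemLp (fun ω => f (shift x ω)) 2 M.gibbs :=
  hf.comp_measurePreserving (M.measurePreserving_shift x)

lemma indepFun_of_disjoint {f g : Config → ℝ} (hfm : Measurable f) (hgm : Measurable g)
    {Λ Λ' : Finset ℤ} (hf : DependsOn f (Λ : Set ℤ)) (hg : DependsOn g (Λ' : Set ℤ))
    (hd : Disjoint Λ Λ') : ProbabilityTheory.IndepFun f g M.gibbs := by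
  classical
  have key : ∀ (h : Config → ℝ) (I : Finset ℤ), Measurable h → DependsOn h (I : Set ℤ) →
      ∃ F : (I → ℝ × ℝ) → ℝ, Measurable F ∧ h = F ∘ (fun ω (i : I) => ω i) := by
    intro h I hm hI
    refine ⟨fun y => h (fun i => if hi : i ∈ I then y ⟨i, hi⟩ else 0), ?_, ?_⟩
    · refine hm.comp (measurable_pi_lambda _ fun i => ?_)
      by_cases hi : i ∈ I
      · simp only [hi, dite_true]; fun_prop
      · simp only [hi, dite_false]; fun_prop
    · funext ω
      refine hI fun i hi => ?_
      have hi' : i ∈ I := hi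
      simp [hi']
  obtain ⟨F, hF, rfl⟩ := key f Λ hfm hf
  obtain ⟨G, hG, rfl⟩ := key g Λ' hgm hg
  exact (M.iIndepFun_coord.indepFun_finset Λ Λ' hd (fun i => measurable_pi_apply i)).comp hF hG

lemma corr_eq_zero {f g : Config → ℝ} (hfm : Measurable f) (hgm : Measurable g)
    {Λ Λ' : Finset ℤ} (hf : DependsOn f (Λ : Set ℤ)) (hg : DependsOn g (Λ' : Set ℤ))
    {x : ℤ} (hx : x ∉ Finset.image₂ (fun a b => a - b) Λ Λ') : M.corr f g x = 0 := by
  have hd : Disjoint Λ (Λ'.image (· + x)) := by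
    rw [Finset.disjoint_left]
    intro a ha hb
    obtain ⟨b, hb', rfl⟩ := Finset.mem_image.1 hb
    exact hx (Finset.mem_image₂.2 ⟨b + x, ha, b, hb', by ring⟩)
  have hgm' : Measurable (fun ω => g (shift x ω)) := hgm.comp (measurable_shift x)
  have hi := indepFun_of_disjoint (M := M) hfm hgm' hf (dependsOn_shift hg x) hd
  unfold corr
  rw [hi.integral_fun_mul_eq_mul_integral hfm.aestronglyMeasurable hgm'.aestronglyMeasurable,
    integral_shift x hgm, sub_self]

lemma summable_corr (f g : M.LocalL2) : Summable (M.corr f g) := by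
  obtain ⟨Λ, hf⟩ := f.isLocal
  obtain ⟨Λ', hg⟩ := g.isLocal
  exact summable_of_ne_finset_zero (s := Finset.image₂ (fun a b => a - b) Λ Λ')
    fun x hx => corr_eq_zero f.measurable g.measurable hf hg hx

lemma integrable_mul_shift (f g : M.LocalL2) (x : ℤ) :
    Integrable (fun ω => f ω * g (shift x ω)) M.gibbs :=
  MemLp.integrable_mul f.memLp (memLp_shift x g.memLp)

lemma integrable_coe (f : M.LocalL2) : Integrable f M.gibbs :=
  f.memLp.integrable (by norm_num)

lemma shift_shift (a b : ℤ) (ω : Config) : shift a (shift b ω) = shift (a + b) ω := by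
  funext y; simp only [shift]; congr 1; ring

lemma corr_symm (f g : M.LocalL2) (x : ℤ) : M.corr f g x = M.corr g f (-x) := by
  unfold corr
  have hm : Measurable (fun ω => f ω * g (shift x ω)) :=
    f.measurable.mul (g.measurable.comp (measurable_shift x))
  rw [← integral_shift (M := M) (-x) hm, mul_comm (∫ ω, f ω ∂M.gibbs)]
  congr 1
  refine integral_congr_ae (ae_of_all _ fun ω => ?_)
  have : shift x (shift (-x) ω) = ω := by
    rw [shift_shift]; funext y; simp [shift]
  simp only [this]; ring

lemma semiInner_symm (f g : M.LocalL2) : M.semiInner g f = M.semiInner f g := by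
  unfold semiInner
  rw [← (Equiv.neg ℤ).tsum_eq]
  exact tsum_congr fun x => (corr_symm f g x).symm

lemma corr_add_left (f g h : M.LocalL2) (x : ℤ) :
    M.corr (f + g : M.LocalL2) h x = M.corr f h x + M.corr g h x := by
  have e : ∀ ω, (f + g : M.LocalL2) ω = f ω + g ω := fun ω => rfl
  unfold corr
  simp only [e, add_mul]
  rw [integral_add (integrable_mul_shift f h x) (integrable_mul_shift g h x),
    integral_add (integrable_coe f) (integrable_coe g)]
  ring

lemma corr_smul_left (c : ℝ) (f g : M.LocalL2) (x : ℤ) :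
    M.corr (c • f : M.LocalL2) g x = c * M.corr f g x := by
  have e : ∀ ω, (c • f : M.LocalL2) ω = c * f ω := fun ω => rfl
  unfold corr
  simp only [e, mul_assoc]
  rw [integral_const_mul, integral_const_mul]
  ring

lemma tsum_nonneg_of_finset_sums {c : ℤ → ℝ} {s : Finset ℤ} (hs : ∀ x ∉ s, c x = 0)
    (h : ∀ n : ℕ, 0 ≤ ∑ j ∈ Finset.range n, ∑ k ∈ Finset.range n, c ((k : ℤ) - j)) :
    0 ≤ ∑' x, c x := by
  obtain ⟨R, hR⟩ : ∃ R : ℕ, ∀ x ∈ s, x.natAbs ≤ R := ⟨s.sup Int.natAbs, fun x hx =>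
    Finset.le_sup (f := Int.natAbs) hx⟩
  have hB : Summable fun x => |c x| :=
    summable_of_ne_finset_zero (s := s) fun x hx => by rw [hs x hx, abs_zero]
  have hsum : ∀ n j : ℕ, ∑ k ∈ Finset.range n, c ((k : ℤ) - j) =
      ∑ x ∈ (Finset.range n).image (fun k : ℕ => (k : ℤ) - j), c x := by
    intro n j
    rw [Finset.sum_image]
    intro a _ b _ hab
    simpa using hab
  have hrow : ∀ n j : ℕ, ∑ k ∈ Finset.range n, c ((k : ℤ) - j) ≤ ∑' x, |c x| := by
    intro n j
    rw [hsum]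
    exact (Finset.sum_le_sum fun x _ => le_abs_self _).trans
      (hB.sum_le_tsum _ fun x _ => abs_nonneg _)
  have hmid : ∀ n j : ℕ, R ≤ j → j + R < n →
      ∑ k ∈ Finset.range n, c ((k : ℤ) - j) = ∑' x, c x := by
    intro n j h1 h2
    rw [hsum, tsum_eq_sum]
    intro x hx
    apply hs
    intro hxs
    have := hR x hxs
    refine hx (Finset.mem_image.2 ⟨(x + j).toNat, Finset.mem_range.2 ?_, ?_⟩) <;> omega
  by_contra hneg
  push Not at hneg
  obtain ⟨m, hm⟩ := exists_nat_gt (2 * R * (∑' x, |c x|) / -(∑' x, c x))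
  rw [div_lt_iff₀ (by linarith)] at hm
  have h0 := h (R + m + R)
  rw [Finset.sum_range_add, Finset.sum_range_add] at h0
  have b1 : ∑ j ∈ Finset.range R, ∑ k ∈ Finset.range (R + m + R), c ((k : ℤ) - j) ≤
      R * ∑' x, |c x| := by
    simpa using Finset.sum_le_sum fun j (_ : j ∈ Finset.range R) => hrow (R + m + R) j
  have b2 : ∑ j ∈ Finset.range m, ∑ k ∈ Finset.range (R + m + R), c ((k : ℤ) - (R + j : ℕ)) =
      m * ∑' x, c x := by
    rw [Finset.sum_congr rfl fun j hj => hmid (R + m + R) (R + j) (by omega)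
      (by have := Finset.mem_range.1 hj; omega)]
    simp
  have b3 : ∑ j ∈ Finset.range R, ∑ k ∈ Finset.range (R + m + R), c ((k : ℤ) - (R + m + j : ℕ)) ≤
      R * ∑' x, |c x| := by
    simpa using Finset.sum_le_sum fun j (_ : j ∈ Finset.range R) =>
      hrow (R + m + R) (R + m + j)
  linarith

lemma semiInner_self_nonneg (f : M.LocalL2) : 0 ≤ M.semiInner f f := by
  obtain ⟨Λ, hf⟩ := f.isLocal
  have hfm := f.measurable
  have hf2 := f.memLp
  refine tsum_nonneg_of_finset_sums (s := Finset.image₂ (fun a b => a - b) Λ Λ)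
    (fun x hx => corr_eq_zero hfm hfm hf hf hx) fun n => ?_
  set m := ∫ ω, f ω ∂M.gibbs with hmdef
  have hI : ∀ j : ℤ, Integrable (fun ω => f (shift j ω)) M.gibbs := fun j =>
    (memLp_shift j hf2).integrable (by norm_num)
  have hII : ∀ j k : ℤ, Integrable (fun ω => f (shift j ω) * f (shift k ω)) M.gibbs :=
    fun j k => MemLp.integrable_mul (memLp_shift j hf2) (memLp_shift k hf2)
  have hint : ∀ j : ℤ, ∫ ω, f (shift j ω) ∂M.gibbs = m := fun j => integral_shift j hfm
  have key : ∀ j k : ℤ, M.corr f f (k - j) =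
      ∫ ω, (f (shift j ω) - m) * (f (shift k ω) - m) ∂M.gibbs := by
    intro j k
    have e : ∀ ω, (f (shift j ω) - m) * (f (shift k ω) - m) =
        f (shift j ω) * f (shift k ω) - m * f (shift j ω) - m * f (shift k ω) + m * m := by
      intro ω; ring
    simp only [e]
    have hA : Integrable (fun ω => f (shift j ω) * f (shift k ω) - m * f (shift j ω)) M.gibbs :=
      (hII j k).sub ((hI j).const_mul m)
    have hB : Integrable (fun ω => f (shift j ω) * f (shift k ω) - m * f (shift j ω) -
        m * f (shift k ω)) M.gibbs := hA.sub ((hI k).const_mul m)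
    rw [integral_add hB (integrable_const _), integral_sub hA ((hI k).const_mul m),
      integral_sub (hII j k) ((hI j).const_mul m), integral_const_mul, integral_const_mul,
      hint, hint]
    have hm : Measurable (fun ω => f ω * f (shift (k - j) ω)) :=
      hfm.mul (hfm.comp (measurable_shift _))
    unfold corr
    rw [← integral_shift (M := M) j hm]
    simp only [shift_shift, sub_add_cancel, integral_const, probReal_univ, smul_eq_mul]
    rw [← hmdef]
    ring
  have hIp : ∀ j k : ℤ, Integrable (fun ω => (f (shift j ω) - m) * (f (shift k ω) - m)) M.gibbs :=
    fun j k => MemLp.integrable_mul ((memLp_shift j hf2).sub (memLp_const m))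
      ((memLp_shift k hf2).sub (memLp_const m))
  have : ∑ j ∈ Finset.range n, ∑ k ∈ Finset.range n, M.corr f f ((k : ℤ) - j) =
      ∫ ω, (∑ j ∈ Finset.range n, (f (shift j ω) - m)) ^ 2 ∂M.gibbs := by
    simp only [sq, Finset.sum_mul_sum]
    have hrow : ∀ j ∈ Finset.range n, Integrable (fun ω => ∑ k ∈ Finset.range n,
        (f (shift j ω) - m) * (f (shift k ω) - m)) M.gibbs :=
      fun j _ => integrable_finsetSum _ fun k _ => hIp j k
    rw [integral_finsetSum _ hrow]
    refine Finset.sum_congr rfl fun j _ => ?_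
    rw [integral_finsetSum (Finset.range n) fun (k : ℕ) _ => hIp j k]
    exact Finset.sum_congr rfl fun k _ => key j k
  rw [this]
  exact integral_nonneg fun ω => sq_nonneg _

variable (M)

/-- The semi-inner product `≪·,·≫` on local square integrable functions. -/
instance semiInnerCore : PreInnerProductSpace.Core ℝ M.LocalL2 where
  inner f g := M.semiInner f g
  conj_inner_symm f g := by simpa using semiInner_symm f g
  re_inner_nonneg f := by simpa using semiInner_self_nonneg f
  add_left f g h := by
    simp only [semiInner, corr_add_left]
    exact (summable_corr f h).tsum_add (summable_corr g h)
  smul_left f g c := by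
    simp only [semiInner, corr_smul_left, conj_trivial]
    exact tsum_mul_left

instance : SeminormedAddCommGroup M.LocalL2 :=
  InnerProductSpace.Core.toSeminormedAddCommGroup (𝕜 := ℝ)
instance : InnerProductSpace ℝ M.LocalL2 := InnerProductSpace.ofCore M.semiInnerCore

/-- The Hilbert space `ℍ`, the completion of the local square integrable functions for the
semi-inner product `≪·,·≫`. Bounded local functions are dense in it, see `dense_bounded`, so that it
is also the completion of the space of bounded local functions. -/
abbrev H : Type := UniformSpace.Completion M.LocalL2

lemma norm_sq_le (f : M.LocalL2) {Λ : Finset ℤ} (hf : DependsOn f (Λ : Set ℤ)) :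
    ‖f‖ ^ 2 ≤ (Finset.image₂ (fun a b => a - b) Λ Λ).card * ∫ ω, f ω ^ 2 ∂M.gibbs := by
  have hfm := f.measurable
  have hf2 := f.memLp
  have h1 : ‖f‖ ^ 2 = M.semiInner f f := (real_inner_self_eq_norm_sq f).symm
  rw [h1, semiInner, tsum_eq_sum fun x hx => corr_eq_zero hfm hfm hf hf hx, ← nsmul_eq_mul]
  refine Finset.sum_le_card_nsmul _ _ _ fun x _ => ?_
  have hsq : Integrable (fun ω => f ω ^ 2) M.gibbs := hf2.integrable_sq
  have hsq' : Integrable (fun ω => f (shift x ω) ^ 2) M.gibbs := (memLp_shift x hf2).integrable_sq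
  have h2 : ∫ ω, f ω * f (shift x ω) ∂M.gibbs ≤
      ∫ ω, (f ω ^ 2 + f (shift x ω) ^ 2) / 2 ∂M.gibbs := by
    refine integral_mono (integrable_mul_shift f f x) ((hsq.add hsq').div_const 2) fun ω => ?_
    have := sq_nonneg (f ω - f (shift x ω))
    simp only
    linarith
  rw [integral_div, integral_add hsq hsq', integral_shift x (f := fun ω => f ω ^ 2)
    (hfm.pow_const 2)] at h2
  have h3 : 0 ≤ (∫ ω, f ω ∂M.gibbs) * ∫ ω, f ω ∂M.gibbs := mul_self_nonneg _
  unfold corr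
  linarith

lemma exists_bounded_near (f : M.LocalL2) {ε : ℝ} (hε : 0 < ε) :
    ∃ g : M.LocalL2, (∃ C, ∀ ω, |g ω| ≤ C) ∧ ‖f - g‖ < ε := by
  obtain ⟨Λ, hf⟩ := f.isLocal
  have hfm := f.measurable
  have hf2 := f.memLp
  have hloc : ∀ n : ℕ, DependsOn (fun ω => max (-(n : ℝ)) (min n (f ω))) (Λ : Set ℤ) := by
    intro n ω ω' h
    simp only [hf h]
  have hm : ∀ n : ℕ, Measurable (fun ω => max (-(n : ℝ)) (min n (f ω))) := fun n =>
    measurable_const.max (measurable_const.min hfm)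
  have hb : ∀ (n : ℕ) ω, |max (-(n : ℝ)) (min n (f ω))| ≤ n := by
    intro n ω
    have hn : (0 : ℝ) ≤ n := Nat.cast_nonneg n
    exact abs_le.2 ⟨le_max_left _ _, max_le (by linarith) (min_le_left _ _)⟩
  let g : ℕ → M.LocalL2 := fun n => LocalL2.mk (fun ω => max (-(n : ℝ)) (min n (f ω)))
    ⟨Λ, hloc n⟩ (hm n) (MemLp.of_bound (hm n).aestronglyMeasurable n (ae_of_all _ (hb n)))
  have hdiff : ∀ n ω, |f ω - g n ω| ≤ |f ω| := by
    intro n ω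
    have hn : (0 : ℝ) ≤ n := Nat.cast_nonneg n
    change |f ω - max (-(n : ℝ)) (min n (f ω))| ≤ |f ω|
    rcases le_total 0 (f ω) with h | h
    · rw [max_eq_right (by have := le_min hn h; linarith), abs_of_nonneg h,
        abs_of_nonneg (by linarith [min_le_right (n : ℝ) (f ω)])]
      linarith [le_min hn h]
    · rw [min_eq_right (by linarith), abs_of_nonpos h,
        abs_of_nonpos (by linarith [le_max_right (-(n : ℝ)) (f ω)])]
      linarith [max_le (by linarith : -(n : ℝ) ≤ 0) h]
  have hlim : Tendsto (fun n => ∫ ω, (f ω - g n ω) ^ 2 ∂M.gibbs) atTop (𝓝 0) := by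
    have h0 : (0 : ℝ) = ∫ ω : Config, (0 : ℝ) ∂M.gibbs := by simp
    rw [h0]
    refine tendsto_integral_of_dominated_convergence (fun ω => f ω ^ 2)
      (fun n => ((hfm.sub (hm n)).pow_const 2).aestronglyMeasurable) hf2.integrable_sq
      (fun n => ae_of_all _ fun ω => ?_) (ae_of_all _ fun ω => ?_)
    · rw [Real.norm_of_nonneg (sq_nonneg _)]
      exact sq_le_sq.2 (hdiff n ω)
    · obtain ⟨N, hN⟩ := exists_nat_ge |f ω|
      refine tendsto_const_nhds.congr' ?_
      filter_upwards [eventually_ge_atTop N] with n hn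
      have hn' : |f ω| ≤ n := hN.trans (by exact_mod_cast hn)
      change 0 = (f ω - max (-(n : ℝ)) (min n (f ω))) ^ 2
      rw [min_eq_right (abs_le.1 hn').2, max_eq_right (abs_le.1 hn').1]
      simp
  have hlim2 := hlim.const_mul ((Finset.image₂ (fun a b => a - b) Λ Λ).card : ℝ)
  rw [mul_zero] at hlim2
  obtain ⟨n, hn⟩ := (hlim2.eventually (gt_mem_nhds (by positivity : 0 < ε ^ 2))).exists
  refine ⟨g n, ⟨n, hb n⟩, ?_⟩
  have hdep : DependsOn (f - g n : M.LocalL2) (Λ : Set ℤ) := by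
    intro ω ω' h
    change f ω - g n ω = f ω' - g n ω'
    rw [hf h, show g n ω = g n ω' from hloc n h]
  exact lt_of_pow_lt_pow_left₀ 2 hε.le ((M.norm_sq_le (f - g n) hdep).trans_lt hn)

theorem dense_bounded :
    Dense {u : M.H | ∃ f : M.LocalL2, (∃ C, ∀ ω, |f ω| ≤ C) ∧ u = (f : M.H)} := by
  rw [Metric.dense_iff]
  intro u ε hε
  obtain ⟨v, hv, f, rfl⟩ := Metric.dense_iff.1
    (UniformSpace.Completion.denseRange_coe (α := M.LocalL2)) u (ε / 2) (by positivity)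
  obtain ⟨g, hg, hfg⟩ := M.exists_bounded_near f (half_pos hε)
  refine ⟨(g : M.H), ?_, g, hg, rfl⟩
  rw [Metric.mem_ball] at hv ⊢
  have h2 : dist (g : M.H) (f : M.H) < ε / 2 := by
    rw [dist_comm, UniformSpace.Completion.dist_eq, dist_eq_norm]; exact hfg
  linarith [dist_triangle (g : M.H) f u]

/-- `ℍ^a`, the closed subspace of `ℍ` of the functions that are antisymmetric in the momenta:
`f(r, -p) = -f(r, p)`. -/
def antisymm : Set M.H :=
  closure {u | ∃ f : M.LocalL2, (∀ ω, f (reverse ω) = -f ω) ∧ u = (f : M.H)}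

/-- The Liouville operator
`A f = ∑_x ((p_x - p_{x-1}) ∂_{r_x} f + (V'(r_{x+1}) - V'(r_x)) ∂_{p_x} f)`
(for local `f` only finitely many terms are nonzero). -/
def liouville (f : Config → ℝ) (ω : Config) : ℝ :=
  ∑ᶠ x : ℤ, (((ω x).2 - (ω (x - 1)).2) * partialR x f ω +
    (M.V' (ω (x + 1)).1 - M.V' (ω x).1) * partialP x f ω)

/-- The velocity-flip noise `S f = (1/2) ∑_x (f(r, p^x) - f(r, p))`. -/
def noise (f : Config → ℝ) (ω : Config) : ℝ :=
  1 / 2 * ∑ᶠ x : ℤ, (f (flipAt x ω) - f ω)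

/-- The generator `L = A + γ S`. -/
def generator (f : Config → ℝ) (ω : Config) : ℝ := M.liouville f ω + M.γ * noise f ω

/-- The graph in `ℍ × ℍ` of the generator with domain `C_0^1`. -/
def generatorGraph : Set (M.H × M.H) :=
  {w | ∃ f h : M.LocalL2, IsC01 f ∧ (∀ ω, h ω = M.generator f ω) ∧ w = ((f : M.H), (h : M.H))}

/-- `R = (z - L)⁻¹` where `L` is the closure in `ℍ` of the generator on `C_0^1`: for every `g`, the
vector `R g` is the one and only solution `w` in the domain of `L` of the resolvent equation
`(z - L) w = g`, i.e. `L w = z w - g`. -/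
def IsResolvent (z : ℝ) (R : M.H →L[ℝ] M.H) : Prop :=
  ∀ g w : M.H, R g = w ↔ (w, z • w - g) ∈ closure M.generatorGraph

/-- The momentum `p_0` as a local square integrable function. -/
def momentum : M.LocalL2 :=
  LocalL2.mk (fun ω => (ω 0).2) ⟨{0}, fun ω ω' h => by simp [h 0 (by simp)]⟩ (by fun_prop)
    (M.memLp_site_p.comp_measurePreserving (M.measurePreserving_coord 0))

/-- The energy current `j^e_{0,1} = -p_0 V'(r_1)` as a local square integrable function. -/
def energyCurrent : M.LocalL2 :=
  LocalL2.mk (fun ω => -(ω 0).2 * M.V' (ω 1).1)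
    ⟨{0, 1}, fun ω ω' h => by simp [h 0 (by simp), h 1 (by simp)]⟩
    (by have := M.continuous_V'.measurable; fun_prop)
    (by
      have hV := M.continuous_V'.measurable
      have h0 := (M.memLp_site_p.comp_measurePreserving (M.measurePreserving_coord 0)).integrable_sq
      have h1 :=
        (M.memLp_site_V'.comp_measurePreserving (M.measurePreserving_coord 1)).integrable_sq
      have hind := (M.iIndepFun_coord.indepFun (show (0 : ℤ) ≠ 1 by norm_num)).comp
        (φ := fun y => y.2 ^ 2) (ψ := fun y => M.V' y.1 ^ 2) (by fun_prop) (by fun_prop)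
      rw [memLp_two_iff_integrable_sq (by fun_prop)]
      refine (hind.integrable_mul h0 h1).congr (ae_of_all _ fun ω => ?_)
      simp only [Pi.mul_apply, Function.comp_apply]
      ring)

/-- `p_0` as an element of `ℍ`. -/
def p₀ : M.H := (M.momentum : M.H)

/-- `j^e_{0,1} + τ p_0` as an element of `ℍ`. -/
def heatCurrent : M.H := ((M.energyCurrent + M.τ • M.momentum : M.LocalL2) : M.H)

end Chain

end

/-! Write `J` for the reversal of all momenta, an isometric involution of `ℍ`, equal to `-1` on
`ℍ^a`. The Liouville part `A` is a derivation that leaves the Gibbs state invariant, hence is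
antisymmetric for `≪·,·≫`, and it anticommutes with `J`. The noise is symmetric and commutes with
`J`. Together these give `≪Ju, Lv≫ = ≪JLu, v≫`, formally `L* = JLJ` (`generatorSubmodule_reversal`).
The single-site flips commute, so as quadratic forms `1 - J ≤ ∑_x (1 - flip_x)`, and the noise has a
gap: `≪u, Lu≫ ≤ -(γ/4) ‖u - Ju‖²` (`generatorSubmodule_gap`). Both relations survive the closure of
the graph.

Let `Jg = -g`, `u_z = (z - L)⁻¹ g` and `φ(z) = ≪g, u_z≫`. The gap gives `φ ≥ 0` and bounds `‖u_z - J
u_z‖` uniformly in `z`. Reversibility turns `φ'(z) = -≪g, (z - L)⁻² g≫` into `≪J u_z, u_z≫ = ‖u_z‖²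
- ‖u_z - J u_z‖² / 2`, which is therefore bounded below by some `-K`. So `φ(z) + K z` is
nondecreasing and nonnegative, and it converges as `z` decreases to `0`, although `‖u_z‖` itself may
blow up (`exists_tendsto_inner_resolvent`). Polarisation yields `σ`, and reversibility its symmetry.

Since `L` is dissipative, its resolvents exist once `z - L` has dense range for large `z`
(`exists_graphResolvent`, `exists_dense_range`). No infinite dynamics is constructed. In the box
`{-n, …, n}`, with the force regularised and the derivative along the drift replaced by a jump of
size `ε`, the resolvent equation is solved approximately by iterating a contraction. The iterates
keep a Lipschitz constant, for the norm `sup_x 2^{-|x|} |v_x|`, that depends neither on `n` nor on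
`ε`. The error made at the edge of the box is then of order `2^{-n}` in `L²`, and this beats the
factor of order `n` by which the squared norm of `ℍ` may exceed that of `L²` on functions of the box
(`exists_residual_le`, `exists_norm_resolvent_sub_lt`).

Finally `L p_0 = V'(r_1) - V'(r_0) - γ p_0`, and gradients vanish in `ℍ`, so `p_0` is an eigenvector
with eigenvalue `-γ` (`p₀_mem_closure`). The coefficients involving `p_0` then reduce to `≪p_0, p_0≫
= T` and `≪j^e_{0,1} + τ p_0, p_0≫ = 0`. -/

noncomputable section

/-! ### Resolvents of the closure of a dissipative operator. -/

section HilbertResolvent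

variable {E : Type*} [NormedAddCommGroup E] [InnerProductSpace ℝ E]

/-- `R = (z - L)⁻¹` where `G` is the graph of `L`. -/
def IsGraphResolvent (G : Set (E × E)) (z : ℝ) (R : E →L[ℝ] E) : Prop :=
  ∀ g w : E, R g = w ↔ (w, z • w - g) ∈ G

lemma IsGraphResolvent.mem {G : Set (E × E)} {z : ℝ} {R : E →L[ℝ] E}
    (h : IsGraphResolvent G z R) (g : E) : (R g, z • R g - g) ∈ G :=
  (h g (R g)).1 rfl

/-- Pair `z u - L u` with `u` and apply Cauchy-Schwarz. This is the bound `‖(z - L)⁻¹‖ ≤ 1 / z`. -/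
lemma norm_le_of_dissipative {w : E × E} (hw : inner ℝ w.1 w.2 ≤ 0) (z : ℝ) :
    z * ‖w.1‖ ≤ ‖z • w.1 - w.2‖ := by
  rcases eq_or_ne w.1 0 with h | h
  · simp [h]
  · have h0 : 0 < ‖w.1‖ := norm_pos_iff.2 h
    have h1 := real_inner_le_norm w.1 (z • w.1 - w.2)
    rw [inner_sub_right, inner_smul_right, real_inner_self_eq_norm_sq] at h1
    refine le_of_mul_le_mul_left ?_ h0
    nlinarith

/-- The map `(u, L u) ↦ z u - L u` on the graph `G` of an operator `L`. -/
def resolventMap (G : Submodule ℝ (E × E)) (z : ℝ) : G →L[ℝ] E :=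
  (z • ContinuousLinearMap.fst ℝ E E - ContinuousLinearMap.snd ℝ E E).comp G.subtypeL

lemma resolventMap_apply (G : Submodule ℝ (E × E)) (z : ℝ) (w : G) :
    resolventMap G z w = z • (w : E × E).1 - (w : E × E).2 := rfl

lemma inner_le_zero_of_mem_closure {D : Submodule ℝ (E × E)}
    (hD : ∀ w ∈ D, inner ℝ w.1 w.2 ≤ 0) : ∀ w ∈ D.topologicalClosure, inner ℝ w.1 w.2 ≤ 0 := by
  have hc : IsClosed {w : E × E | inner ℝ w.1 w.2 ≤ 0} :=
    isClosed_le (by fun_prop) continuous_const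
  exact fun w hw => closure_minimal (s := (D : Set (E × E))) hD hc hw

/-- With `g = z u - L u`, dissipativity gives `‖u‖ ≤ ‖g‖ / z`, and `L u = z u - g` gives `‖L u‖ ≤ 2
‖g‖`. The constant is the sum of the two bounds, which dominates the sup norm of `(u, L u)`. -/
lemma antilipschitz_resolventMap {G : Submodule ℝ (E × E)}
    (hG : ∀ w ∈ G, inner ℝ w.1 w.2 ≤ 0) {z : ℝ} (hz : 0 < z) :
    AntilipschitzWith (Real.toNNReal (1 / z + 2)) (resolventMap G z) := by
  refine AddMonoidHomClass.antilipschitz_of_bound _ fun w => ?_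
  have h1 := norm_le_of_dissipative (hG w w.2) z
  rw [← resolventMap_apply] at h1
  rw [Real.coe_toNNReal _ (by positivity)]
  have h2 : (w : E × E).2 = z • (w : E × E).1 - resolventMap G z w := by
    rw [resolventMap_apply]; abel
  have h3 : ‖(w : E × E).2‖ ≤ z * ‖(w : E × E).1‖ + ‖resolventMap G z w‖ := by
    rw [h2]
    refine (norm_sub_le _ _).trans ?_
    rw [norm_smul, Real.norm_of_nonneg hz.le]
  have h4 : ‖(w : E × E).1‖ ≤ 1 / z * ‖resolventMap G z w‖ := by
    rw [one_div, ← div_eq_inv_mul, le_div_iff₀ hz]; linarith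
  have h5 := norm_nonneg (resolventMap G z w)
  have h6 : 0 ≤ 1 / z * ‖resolventMap G z w‖ := by positivity
  rw [Submodule.coe_norm, Prod.norm_def, add_mul]
  exact max_le (by linarith) (by linarith)

lemma IsGraphResolvent.norm_apply_le {G : Set (E × E)} (hG : ∀ w ∈ G, inner ℝ w.1 w.2 ≤ 0) {z : ℝ}
    {R : E →L[ℝ] E} (h : IsGraphResolvent G z R) (g : E) : z * ‖R g‖ ≤ ‖g‖ := by
  simpa using norm_le_of_dissipative (hG _ (h.mem g)) z

variable [CompleteSpace E]

/-- A closed graph is a Banach space on which `z - L` is a continuous bijection onto `E`. Its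
inverse is continuous by the open mapping theorem, and the resolvent is the first component of that
inverse. -/
lemma exists_graphResolvent_of_surjective {G : Submodule ℝ (E × E)} (hGc : IsClosed (G : Set
    (E × E)))
    (hG : ∀ w ∈ G, inner ℝ w.1 w.2 ≤ 0) {z : ℝ} (hz : 0 < z)
    (hs : Function.Surjective (resolventMap G z)) :
    ∃ R : E →L[ℝ] E, IsGraphResolvent (G : Set (E × E)) z R := by
  have : CompleteSpace G := hGc.completeSpace_coe
  have hinj : Function.Injective (resolventMap G z) := (antilipschitz_resolventMap hG hz).injective
  let e : G ≃L[ℝ] E := ContinuousLinearEquiv.ofBijective (resolventMap G z)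
    (LinearMap.ker_eq_bot.2 hinj) (LinearMap.range_eq_top.2 hs)
  have he : ∀ w : G, e w = z • (w : E × E).1 - (w : E × E).2 := fun w => rfl
  refine ⟨(ContinuousLinearMap.fst ℝ E E).comp (G.subtypeL.comp e.symm.toContinuousLinearMap),
    fun g w => ⟨?_, fun h => ?_⟩⟩
  · rintro rfl
    have h1 := he (e.symm g)
    rw [e.apply_symm_apply] at h1
    have h2 : ((e.symm g : E × E).1, z • (e.symm g : E × E).1 - g) = (e.symm g : E × E) := by
      refine Prod.ext rfl ?_
      change z • (e.symm g : E × E).1 - g = (e.symm g : E × E).2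
      nth_rewrite 2 [h1]
      abel
    change ((e.symm g : E × E).1, z • (e.symm g : E × E).1 - g) ∈ (G : Set (E × E))
    rw [h2]
    exact (e.symm g).2
  · have h1 : e ⟨_, h⟩ = g := by rw [he]; simp
    change (e.symm g : E × E).1 = w
    rw [← h1, e.symm_apply_apply]

/-- The antilipschitz bound makes the range closed, so a dense range is everything. -/
lemma surjective_resolventMap {G : Submodule ℝ (E × E)} (hGc : IsClosed (G : Set (E × E)))
    (hG : ∀ w ∈ G, inner ℝ w.1 w.2 ≤ 0) {z : ℝ} (hz : 0 < z)
    (hd : Dense (Set.range (resolventMap G z))) : Function.Surjective (resolventMap G z) := by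
  have : CompleteSpace G := hGc.completeSpace_coe
  have hu : UniformContinuous (resolventMap G z) := (resolventMap G z).uniformContinuous
  have hcl : IsClosed (Set.range (resolventMap G z)) :=
    (antilipschitz_resolventMap hG hz).isClosed_range hu
  rw [← Set.range_eq_univ, ← hcl.closure_eq, hd.closure_eq]

/-- The resolvents of the closure of a dissipative operator exist as soon as the range of `z - L` is
dense for all large `z`. -/
theorem exists_graphResolvent (D : Submodule ℝ (E × E)) (hD : ∀ w ∈ D, inner ℝ w.1 w.2 ≤ 0)
    (hdense : ∃ z₀ : ℝ, ∀ z ≥ z₀, Dense {u : E | ∃ w ∈ D, z • w.1 - w.2 = u}) {z : ℝ} (hz : 0 < z) :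
    ∃ R : E →L[ℝ] E, IsGraphResolvent (closure (D : Set (E × E))) z R := by
  obtain ⟨z₀, hz₀⟩ := hdense
  have hG := inner_le_zero_of_mem_closure hD
  have hGc := D.isClosed_topologicalClosure
  rw [← Submodule.topologicalClosure_coe]
  set y := max z₀ z with hy
  have hy0 : 0 < y := hz.trans_le (le_max_right _ _)
  have hsurj : Function.Surjective (resolventMap D.topologicalClosure y) := by
    refine surjective_resolventMap hGc hG hy0 ((hz₀ y (le_max_left _ _)).mono ?_)
    rintro _ ⟨w, hw, rfl⟩
    exact ⟨⟨w, D.le_topologicalClosure hw⟩, rfl⟩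
  obtain ⟨R, hR⟩ := exists_graphResolvent_of_surjective hGc hG hy0 hsurj
  refine exists_graphResolvent_of_surjective hGc hG hz fun g => ?_
  -- With `R` the resolvent at a large `y ≥ z`, one Neumann series reaches every `z` in `(0, y]`,
  -- because `‖(y - z) R‖ ≤ (y - z) / y < 1`.
  have hlt : ‖(y - z) • R‖ < 1 := by
    have h1 : ‖R‖ ≤ 1 / y := ContinuousLinearMap.opNorm_le_bound _ (by positivity) fun g => by
      rw [one_div, ← div_eq_inv_mul, le_div_iff₀ hy0]
      linarith [hR.norm_apply_le hG g]
    have h2 : 0 ≤ y - z := sub_nonneg.2 (le_max_right _ _)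
    rw [norm_smul, Real.norm_of_nonneg h2]
    calc _ ≤ (y - z) * (1 / y) := by gcongr
      _ < 1 := by rw [mul_one_div, div_lt_one hy0]; linarith
  let U := Units.oneSub ((y - z) • R) hlt
  set v := (↑U⁻¹ : E →L[ℝ] E) g with hv
  -- Then `w = R v` satisfies `y w - L w = v`, hence `z w - L w = v - (y - z) R v = g`.
  have h1 : v - (y - z) • R v = g := by
    have : ((U : E →L[ℝ] E) * (↑U⁻¹ : E →L[ℝ] E)) g = g := by rw [U.mul_inv]; rfl
    exact this
  refine ⟨⟨_, hR.mem v⟩, ?_⟩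
  rw [resolventMap_apply]
  simp only
  rw [← h1, sub_smul]
  abel

end HilbertResolvent

/-! ### The Green-Kubo limit for generators with adjoint `J L J` and a gap on odd vectors. -/

section Reversible

variable {E : Type*} [NormedAddCommGroup E] [InnerProductSpace ℝ E]

lemma inner_reversal_of_mem_closure {D : Submodule ℝ (E × E)} {J : E →L[ℝ] E}
    (h : ∀ w ∈ D, ∀ w' ∈ D, inner ℝ (J w.1) w'.2 = inner ℝ (J w.2) w'.1) :
    ∀ w ∈ closure (D : Set (E × E)), ∀ w' ∈ closure (D : Set (E × E)),
      inner ℝ (J w.1) w'.2 = inner ℝ (J w.2) w'.1 := by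
  intro w hw w' hw'
  have hc : IsClosed {q : (E × E) × (E × E) | inner ℝ (J q.1.1) q.2.2 = inner ℝ (J q.1.2) q.2.1} :=
    isClosed_eq (by fun_prop) (by fun_prop)
  have : (w, w') ∈ closure ((D : Set (E × E)) ×ˢ (D : Set (E × E))) := by
    rw [closure_prod_eq]; exact ⟨hw, hw'⟩
  exact closure_minimal (fun q hq => h q.1 hq.1 q.2 hq.2) hc this

lemma inner_le_of_mem_closure {D : Submodule ℝ (E × E)} {J : E →L[ℝ] E} {c : ℝ}
    (h : ∀ w ∈ D, inner ℝ w.1 w.2 ≤ -c * ‖w.1 - J w.1‖ ^ 2) :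
    ∀ w ∈ closure (D : Set (E × E)), inner ℝ w.1 w.2 ≤ -c * ‖w.1 - J w.1‖ ^ 2 := by
  have hc : IsClosed {w : E × E | inner ℝ w.1 w.2 ≤ -c * ‖w.1 - J w.1‖ ^ 2} :=
    isClosed_le (by fun_prop) (by fun_prop)
  exact fun w hw => closure_minimal (s := (D : Set (E × E))) h hc hw

variable {G : Set (E × E)} {J : E →L[ℝ] E} {R : ℝ → E →L[ℝ] E}

/-- Apply the graph identity to the pairs `(R f, z R f - f)` and `(R g, z R g - g)`. The terms in
`z` cancel. -/
lemma inner_resolvent_reversal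
    (h : ∀ w ∈ G, ∀ w' ∈ G, inner ℝ (J w.1) w'.2 = inner ℝ (J w.2) w'.1) {z : ℝ}
    {R : E →L[ℝ] E} (hR : IsGraphResolvent G z R) (f g : E) :
    inner ℝ (J (R f)) g = inner ℝ (J f) (R g) := by
  have h1 := h _ (hR.mem f) _ (hR.mem g)
  simp only [map_sub, map_smul, inner_sub_left, inner_sub_right, inner_smul_left,
    inner_smul_right, conj_trivial] at h1
  linarith

lemma resolvent_identity (hR : ∀ z, 0 < z → IsGraphResolvent G z (R z)) {y z : ℝ} (hy : 0 < y)
    (hz : 0 < z) (g : E) : R z g - R y g = (y - z) • R y (R z g) := by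
  have h : R y (g + (y - z) • R z g) = R z g := by
    rw [hR y hy]
    convert (hR z hz).mem g using 2
    rw [sub_smul]; abel
  rw [map_add, map_smul] at h
  exact sub_eq_iff_eq_add'.2 h.symm

/-- The Green-Kubo limit for a dissipative operator `L` whose adjoint is `J L J` and which has a
spectral gap on the vectors with `J g = -g`. -/
theorem exists_tendsto_inner_resolvent {c : ℝ} (hc : 0 < c) (hJn : ∀ u, ‖J u‖ = ‖u‖)
    (hJs : ∀ u v, inner ℝ (J u) v = inner ℝ u (J v))
    (hrev : ∀ w ∈ G, ∀ w' ∈ G, inner ℝ (J w.1) w'.2 = inner ℝ (J w.2) w'.1)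
    (hgap : ∀ w ∈ G, inner ℝ w.1 w.2 ≤ -c * ‖w.1 - J w.1‖ ^ 2)
    (hR : ∀ z, 0 < z → IsGraphResolvent G z (R z)) {g : E} (hg : J g = -g) :
    ∃ l : ℝ, Tendsto (fun z => inner ℝ g (R z g)) (𝓝[>] 0) (𝓝 l) := by
  have hdis : ∀ w ∈ G, inner ℝ w.1 w.2 ≤ 0 := fun w hw => (hgap w hw).trans (by
    have := sq_nonneg ‖w.1 - J w.1‖; nlinarith)
  -- Energy estimate: the gap applied to `u = R z g`, for which `L u = z u - g`.
  have hen : ∀ z, 0 < z → z * ‖R z g‖ ^ 2 + c * ‖R z g - J (R z g)‖ ^ 2 ≤ inner ℝ g (R z g) := by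
    intro z hz
    have h1 := hgap _ ((hR z hz).mem g)
    simp only [inner_sub_right, inner_smul_right, real_inner_self_eq_norm_sq] at h1
    rw [real_inner_comm]
    linarith
  -- As `Jg = -g`, only the odd part of `u = R z g` is seen by `g`: `⟪g, u⟫ = ⟪g, u - Ju⟫ / 2`. With
  -- `s = ‖u - Ju‖`, the energy estimate reads `c s² ≤ ‖g‖ s / 2`, a bound uniform in `z`.
  have hanti : ∀ z, 0 < z → ‖R z g - J (R z g)‖ ≤ ‖g‖ / (2 * c) := by
    intro z hz
    have h1 := hen z hz
    have h2 : inner ℝ g (R z g - J (R z g)) = 2 * inner ℝ g (R z g) := by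
      rw [inner_sub_right, ← hJs, hg, inner_neg_left]; ring
    have h3 := real_inner_le_norm g (R z g - J (R z g))
    have h4 : 0 ≤ z * ‖R z g‖ ^ 2 := by positivity
    set s := ‖R z g - J (R z g)‖
    have hs : 0 ≤ s := norm_nonneg _
    rw [le_div_iff₀ (by positivity)]
    rcases hs.eq_or_lt with h0 | h0
    · rw [← h0]; simp
    · refine le_of_mul_le_mul_left ?_ h0
      nlinarith
  -- The resolvent identity gives the derivative `-⟪g, R² g⟫`. Reversibility and `Jg = -g` rewrite
  -- it as `⟪J R g, R g⟫`, and expanding `‖u - Ju‖²` with `‖Ju‖ = ‖u‖` gives the stated form, whose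
  -- only negative term is controlled by `hanti`.
  have hder : ∀ z, 0 < z → HasDerivAt (fun z => inner ℝ g (R z g))
      (‖R z g‖ ^ 2 - ‖R z g - J (R z g)‖ ^ 2 / 2) z := by
    intro z hz
    have hval : ‖R z g‖ ^ 2 - ‖R z g - J (R z g)‖ ^ 2 / 2 = -inner ℝ g (R z (R z g)) := by
      have h1 := inner_resolvent_reversal hrev (hR z hz) g (R z g)
      rw [hg, inner_neg_left] at h1
      rw [← h1, norm_sub_sq_real, hJn, real_inner_comm]
      ring
    rw [hval, hasDerivAt_iff_tendsto_slope]
    have hcont : Tendsto (fun y => R y g) (𝓝[≠] z) (𝓝 (R z g)) := by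
      rw [tendsto_iff_norm_sub_tendsto_zero]
      have hlim : Tendsto (fun y => |z - y| * (‖R z g‖ / y)) (𝓝[≠] z) (𝓝 0) := by
        have : ContinuousAt (fun y => |z - y| * (‖R z g‖ / y)) z := by
          have := hz.ne'
          fun_prop (disch := assumption)
        have h := this.tendsto.mono_left (nhdsWithin_le_nhds (s := {z}ᶜ))
        simpa using h
      refine squeeze_zero' (Eventually.of_forall fun _ => norm_nonneg _) ?_ hlim
      filter_upwards [nhdsWithin_le_nhds (lt_mem_nhds hz)] with y hy
      rw [norm_sub_rev, resolvent_identity hR hy hz, norm_smul, Real.norm_eq_abs, abs_sub_comm]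
      gcongr
      rw [le_div_iff₀ hy, mul_comm]
      exact (hR y hy).norm_apply_le hdis _
    have hlim2 : Tendsto (fun y => -inner ℝ g (R z (R y g))) (𝓝[≠] z)
        (𝓝 (-inner ℝ g (R z (R z g)))) :=
      ((tendsto_const_nhds.inner (((R z).continuous.tendsto _).comp hcont))).neg
    refine hlim2.congr' ?_
    filter_upwards [nhdsWithin_le_nhds (lt_mem_nhds hz), self_mem_nhdsWithin] with y hy hyz
    have hyz' : y - z ≠ 0 := sub_ne_zero.2 hyz
    rw [slope_def_field, ← inner_sub_right, resolvent_identity hR hz hy, inner_smul_right]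
    field_simp
    ring
  -- `-K` is the lower bound for the derivative that results from `hanti`.
  set K := (‖g‖ / (2 * c)) ^ 2 / 2 with hK
  have hmono : MonotoneOn (fun z => inner ℝ g (R z g) + K * z) (Set.Ioi 0) := by
    have hder' : ∀ z, 0 < z → HasDerivAt (fun z => inner ℝ g (R z g) + K * z)
        (‖R z g‖ ^ 2 - ‖R z g - J (R z g)‖ ^ 2 / 2 + K) z := fun z hz => by
      have h := (hder z hz).add ((hasDerivAt_id z).const_mul K)
      rw [mul_one] at h
      exact h
    refine monotoneOn_of_deriv_nonneg (convex_Ioi 0)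
      (fun z hz => (hder' z hz).continuousAt.continuousWithinAt)
      (fun z hz => ?_) (fun z hz => ?_)
    · rw [interior_Ioi] at hz
      exact (hder' z hz).differentiableAt.differentiableWithinAt
    · rw [interior_Ioi] at hz
      rw [(hder' z hz).deriv]
      have h1 : ‖R z g - J (R z g)‖ ^ 2 ≤ (‖g‖ / (2 * c)) ^ 2 :=
        pow_le_pow_left₀ (norm_nonneg _) (hanti z hz) 2
      have := sq_nonneg ‖R z g‖
      rw [hK]; linarith
  -- A monotone function on `(0, 1)` bounded below, here by `0` through the energy estimate, has a
  -- finite right limit at `0`.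
  have hlim := hmono.mono Set.Ioo_subset_Ioi_self |>.tendsto_nhdsWithin_Ioo_right
    (x := 0) (y := 1) (by norm_num) (by
      refine ⟨0, ?_⟩
      rintro _ ⟨z, hz, rfl⟩
      have h1 := hen z hz.1
      have h2 : 0 ≤ z * ‖R z g‖ ^ 2 := mul_nonneg hz.1.le (sq_nonneg _)
      have h3 : 0 ≤ K * z := mul_nonneg (by positivity) hz.1.le
      have h4 : 0 ≤ c * ‖R z g - J (R z g)‖ ^ 2 := by positivity
      simp only
      linarith)
  have hlin : Tendsto (fun z : ℝ => K * z) (𝓝[>] 0) (𝓝 0) := by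
    have : Continuous fun z : ℝ => K * z := by fun_prop
    simpa using (this.tendsto 0).mono_left nhdsWithin_le_nhds
  have hlim' := hlim.sub hlin
  simp only [add_sub_cancel_right] at hlim'
  exact ⟨_, hlim'⟩

/-- On odd vectors reversibility makes `(f, g) ↦ ⟪f, R g⟫` symmetric at every fixed `z`.
Polarisation then transfers the convergence of the quadratic form to the bilinear one, and the
symmetry passes to the limit. -/
theorem exists_tendsto_inner_resolvent_bilin {c : ℝ} (hc : 0 < c) (hJn : ∀ u, ‖J u‖ = ‖u‖)
    (hJs : ∀ u v, inner ℝ (J u) v = inner ℝ u (J v))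
    (hrev : ∀ w ∈ G, ∀ w' ∈ G, inner ℝ (J w.1) w'.2 = inner ℝ (J w.2) w'.1)
    (hgap : ∀ w ∈ G, inner ℝ w.1 w.2 ≤ -c * ‖w.1 - J w.1‖ ^ 2)
    (hR : ∀ z, 0 < z → IsGraphResolvent G z (R z)) :
    ∃ σ : E → E → ℝ, ∀ f g, J f = -f → J g = -g →
      Tendsto (fun z => inner ℝ f (R z g)) (𝓝[>] 0) (𝓝 (σ f g)) ∧ σ f g = σ g f := by
  have hsymm : ∀ z, 0 < z → ∀ f g, J f = -f → J g = -g →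
      inner ℝ f (R z g) = inner ℝ g (R z f) := by
    intro z hz f g hf hg
    have h := inner_resolvent_reversal hrev (hR z hz) f g
    rw [hJs, hf, hg, inner_neg_left, inner_neg_right] at h
    rw [real_inner_comm (R z f) g]
    linarith
  have hlim : ∀ f g, J f = -f → J g = -g →
      ∃ l : ℝ, Tendsto (fun z => inner ℝ f (R z g)) (𝓝[>] 0) (𝓝 l) := by
    intro f g hf hg
    obtain ⟨a, ha⟩ := exists_tendsto_inner_resolvent (g := f + g) hc hJn hJs hrev hgap hR
      (by rw [map_add, hf, hg]; abel)
    obtain ⟨b, hb⟩ := exists_tendsto_inner_resolvent (g := f - g) hc hJn hJs hrev hgap hR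
      (by rw [map_sub, hf, hg]; abel)
    refine ⟨_, ((ha.sub hb).const_mul (1 / 4)).congr' ?_⟩
    filter_upwards [self_mem_nhdsWithin] with z hz
    have := hsymm z hz f g hf hg
    simp only [map_add, map_sub, inner_add_left, inner_add_right, inner_sub_left, inner_sub_right]
    linarith
  classical
  -- The form is defined on all pairs. Its values away from the odd vectors are not used.
  refine ⟨fun f g => limUnder (𝓝[>] 0) fun z : ℝ => inner ℝ f (R z g), fun f g hf hg => ⟨?_, ?_⟩⟩
  · exact tendsto_nhds_limUnder (hlim f g hf hg)
  · obtain ⟨a, ha⟩ := hlim f g hf hg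
    have hb : Tendsto (fun z => inner ℝ g (R z f)) (𝓝[>] 0) (𝓝 a) := ha.congr' (by
      filter_upwards [self_mem_nhdsWithin] with z hz
      exact hsymm z hz f g hf hg)
    exact ha.limUnder_eq.trans hb.limUnder_eq.symm

end Reversible

end

/-! ### Momentum flips and integration by parts for the Gibbs state. -/

noncomputable section

namespace Config

/-- The signs of the momenta of the atoms in `s` are flipped. -/
def flipOn (s : Set ℤ) (ω : Config) : Config := by
  classical exact fun x => if x ∈ s then ((ω x).1, -(ω x).2) else ω x

lemma flipOn_apply_of_mem {s : Set ℤ} {x : ℤ} (h : x ∈ s) (ω : Config) :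
    flipOn s ω x = ((ω x).1, -(ω x).2) := by simp [flipOn, h]

lemma flipOn_apply_of_notMem {s : Set ℤ} {x : ℤ} (h : x ∉ s) (ω : Config) :
    flipOn s ω x = ω x := by simp [flipOn, h]

lemma flipOn_singleton (x : ℤ) : flipOn {x} = flipAt x := by
  funext ω y
  by_cases h : y = x
  · subst h; simp [flipOn, flipAt]
  · simp [flipOn, flipAt, h]

lemma flipOn_univ : flipOn Set.univ = reverse := by
  funext ω y; simp [flipOn, reverse]

lemma flipOn_flipOn (s : Set ℤ) (ω : Config) : flipOn s (flipOn s ω) = ω := by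
  funext y
  by_cases h : y ∈ s <;> simp [flipOn, h]

lemma flipOn_comm (s t : Set ℤ) (ω : Config) : flipOn s (flipOn t ω) = flipOn t (flipOn s ω) := by
  funext y
  by_cases h : y ∈ s <;> by_cases h' : y ∈ t <;> simp [flipOn, h, h']

lemma flipOn_union {s t : Set ℤ} (hd : Disjoint s t) (ω : Config) :
    flipOn (s ∪ t) ω = flipOn s (flipOn t ω) := by
  funext y
  by_cases h : y ∈ s
  · have h' : y ∉ t := Set.disjoint_left.1 hd h
    simp [flipOn, h, h']
  · by_cases h' : y ∈ t <;> simp [flipOn, h, h']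

lemma measurable_flipOn (s : Set ℤ) : Measurable (flipOn s) := by
  refine measurable_pi_lambda _ fun x => ?_
  by_cases h : x ∈ s
  · simp only [flipOn_apply_of_mem h]; fun_prop
  · simp only [flipOn_apply_of_notMem h]; fun_prop

lemma shift_flipOn (s : Set ℤ) (x : ℤ) (ω : Config) :
    shift x (flipOn ((fun y => y - x) ⁻¹' s) ω) = flipOn s (shift x ω) := by
  funext y
  by_cases h : y ∈ s <;> simp [shift, flipOn, h]

lemma shift_flipAt (x y : ℤ) (ω : Config) :
    shift x (flipAt (y + x) ω) = flipAt y (shift x ω) := by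
  rw [← flipOn_singleton, ← flipOn_singleton, ← shift_flipOn]
  congr 2
  ext z
  simp [sub_eq_iff_eq_add]

lemma shift_reverse (x : ℤ) (ω : Config) : shift x (reverse ω) = reverse (shift x ω) := rfl

end Config

open Config

namespace Chain

variable (M : Chain)

/-- The exponent of the density of the Gibbs state at one site. -/
def siteWeight (y : ℝ × ℝ) : ℝ := -(y.2 ^ 2 / 2 + M.V y.1 - M.τ * y.1) / M.T

lemma siteMeasure_eq : M.siteMeasure = (volume : Measure (ℝ × ℝ)).tilted M.siteWeight := rfl

lemma integrable_exp_siteWeight :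
    Integrable (fun y => Real.exp (M.siteWeight y)) (volume : Measure (ℝ × ℝ)) := by
  have h := M.integrable_site_weight_mul (a := fun _ => 1) (b := fun _ => 1)
    (by simpa using M.integrable_gibbs (M.τ / M.T))
    (by simpa using integrable_exp_neg_mul_sq M.gauss_pos)
  simp only [mul_one] at h
  exact h

/-- The density of the Gibbs state at one site is even in `p`, and Lebesgue measure is invariant
under `p ↦ -p`. -/
lemma measurePreserving_site_flip :
    MeasurePreserving (fun y : ℝ × ℝ => (y.1, -y.2)) M.siteMeasure M.siteMeasure := by
  have hv : MeasurePreserving (fun y : ℝ × ℝ => (y.1, -y.2))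
      (volume : Measure (ℝ × ℝ)) volume :=
    (MeasurePreserving.id (volume : Measure ℝ)).prod (Measure.measurePreserving_neg volume)
  refine ⟨by fun_prop, ?_⟩
  ext s hs
  have hm : Measurable fun y : ℝ × ℝ => (y.1, -y.2) := by fun_prop
  have hV := M.contDiff_V.continuous.measurable
  rw [Measure.map_apply hm hs, siteMeasure_eq, tilted_apply' _ _ (hm hs), tilted_apply' _ _ hs]
  conv_rhs => rw [← hv.map_eq]
  rw [setLIntegral_map hs (by unfold siteWeight; fun_prop) hm]
  refine lintegral_congr fun y => ?_
  simp only [siteWeight, neg_sq]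
  have h : ∀ F : ℝ × ℝ → ℝ, Measurable F →
      ∫ x, F x ∂Measure.map (fun y : ℝ × ℝ => (y.1, -y.2)) (volume : Measure (ℝ × ℝ)) =
      ∫ x, F x := fun F hF => by rw [hv.map_eq]
  rw [h _ (by fun_prop)]

lemma measurePreserving_flipOn (s : Set ℤ) : MeasurePreserving (flipOn s) M.gibbs M.gibbs := by
  classical
  refine ⟨measurable_flipOn s, ?_⟩
  let f : ℤ → ℝ × ℝ → ℝ × ℝ := fun x y => if x ∈ s then (y.1, -y.2) else y
  have hf : ∀ x, MeasurePreserving (f x) M.siteMeasure M.siteMeasure := fun x => by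
    by_cases h : x ∈ s
    · simp only [f, h, if_true]; exact M.measurePreserving_site_flip
    · simp only [f, h, if_false]; exact MeasurePreserving.id _
  have h := Measure.infinitePi_map_pi (μ := fun _ : ℤ => M.siteMeasure) (f := f)
    (fun x => (hf x).measurable)
  simp only [(hf _).map_eq] at h
  have hflip : flipOn s = fun ω x => f x (ω x) := by
    funext ω x
    by_cases hx : x ∈ s <;> simp [flipOn, f, hx]
  rw [hflip]
  exact h

/-- Resampling one coordinate of a product measure independently leaves it invariant; it suffices to
check cylinders. This gives Fubini at a single site, and so lifts integration by parts from one site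
to the chain. -/
lemma measurePreserving_update (x : ℤ) :
    MeasurePreserving (fun q : Config × (ℝ × ℝ) => Function.update q.1 x q.2)
      (M.gibbs.prod M.siteMeasure) M.gibbs := by
  have hm : Measurable fun q : Config × (ℝ × ℝ) => Function.update q.1 x q.2 := by
    refine measurable_pi_lambda _ fun y => ?_
    by_cases h : y = x
    · subst h; simp only [Function.update_self]; fun_prop
    · simp only [Function.update_of_ne h]; fun_prop
  refine ⟨hm, Measure.eq_infinitePi _ fun s t ht => ?_⟩
  have hs : MeasurableSet (Set.pi (s : Set ℤ) t) :=
    MeasurableSet.pi s.countable_toSet fun i _ => ht i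
  rw [Measure.map_apply hm hs]
  have hpre : (fun q : Config × (ℝ × ℝ) => Function.update q.1 x q.2) ⁻¹' (Set.pi (s : Set ℤ) t) =
      (Set.pi ((s.erase x : Finset ℤ) : Set ℤ) t) ×ˢ (if x ∈ s then t x else Set.univ) := by
    ext q
    simp only [Set.mem_preimage, Set.mem_pi, Finset.mem_coe, Set.mem_prod, Finset.mem_erase]
    constructor
    · intro h
      refine ⟨fun i hi => by simpa [hi.1] using h i hi.2, ?_⟩
      split_ifs with hx
      · simpa using h x hx
      · trivial
    · rintro ⟨h1, h2⟩ i hi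
      by_cases hix : i = x
      · subst hix; simpa [hi] using h2
      · simpa [hix] using h1 i ⟨hix, hi⟩
  rw [hpre, Measure.prod_prod]
  unfold gibbs
  rw [Measure.infinitePi_pi (μ := fun _ : ℤ => M.siteMeasure) fun i _ => ht i]
  by_cases hx : x ∈ s
  · rw [if_pos hx, Finset.prod_erase_mul _ _ hx]
  · rw [if_neg hx, measure_univ, mul_one, Finset.erase_eq_of_notMem hx]

lemma integral_update (x : ℤ) {f : Config → ℝ} (hf : Integrable f M.gibbs) :
    ∫ ω, f ω ∂M.gibbs = ∫ ω, ∫ y, f (Function.update ω x y) ∂M.siteMeasure ∂M.gibbs := by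
  have h := M.measurePreserving_update x
  have hi : Integrable (fun q : Config × (ℝ × ℝ) => f (Function.update q.1 x q.2))
    (M.gibbs.prod M.siteMeasure) := h.integrable_comp_of_integrable hf
  conv_lhs => rw [← h.map_eq]
  rw [integral_map h.measurable.aemeasurable (by rw [h.map_eq]; exact hf.aestronglyMeasurable),
    integral_prod _ hi]

lemma hasFDerivAt_V (r : ℝ) : HasDerivAt M.V (M.V' r) r :=
  ((M.contDiff_V.differentiable (by norm_num)) r).hasDerivAt

lemma contDiff_V' : ContDiff ℝ 1 M.V' := by
  have h2 : ContDiff ℝ (1 + 1) M.V := by simpa [one_add_one_eq_two] using M.contDiff_V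
  exact (contDiff_succ_iff_deriv.1 h2).2.2

/-- Integration by parts for the Gibbs state of one site. -/
lemma integral_site_mul_fderiv {φ G : ℝ × ℝ → ℝ} {v : ℝ × ℝ} (hφ : Differentiable ℝ φ)
    (hφv : ∀ y, fderiv ℝ φ y v = 0) (hG : Differentiable ℝ G)
    (h1 : Integrable (fun y => φ y * fderiv ℝ G y v) M.siteMeasure)
    (h2 : Integrable (fun y => φ y * ((M.V' y.1 - M.τ) / M.T * v.1 + y.2 / M.T * v.2) * G y)
      M.siteMeasure)
    (h3 : Integrable (fun y => φ y * G y) M.siteMeasure) :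
    ∫ y, φ y * fderiv ℝ G y v ∂M.siteMeasure =
      ∫ y, φ y * ((M.V' y.1 - M.τ) / M.T * v.1 + y.2 / M.T * v.2) * G y ∂M.siteMeasure := by
  have hT := M.T_pos.ne'
  have hw : ∀ y, HasFDerivAt M.siteWeight
      ((-(1 / M.T)) • (y.2 • ContinuousLinearMap.snd ℝ ℝ ℝ +
          (M.V' y.1) • ContinuousLinearMap.fst ℝ ℝ ℝ
        - M.τ • ContinuousLinearMap.fst ℝ ℝ ℝ)) y := by
    intro y
    have e1 : HasFDerivAt (fun y : ℝ × ℝ => y.1)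
        (ContinuousLinearMap.fst ℝ ℝ ℝ) y := hasFDerivAt_fst
    have e2 : HasFDerivAt (fun y : ℝ × ℝ => y.2)
        (ContinuousLinearMap.snd ℝ ℝ ℝ) y := hasFDerivAt_snd
    have e3 := (M.hasFDerivAt_V y.1).comp_hasFDerivAt y e1
    have e4 := (((e2.pow 2).const_mul (1 / 2)).add e3).sub (e1.const_mul M.τ)
    have e5 := e4.const_mul (-(1 / M.T))
    have e6 : M.siteWeight = fun y =>
        -(1 / M.T) * (1 / 2 * y.2 ^ 2 + M.V y.1 - M.τ * y.1) := by
      funext z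
      simp only [siteWeight]
      ring
    rw [e6]
    exact e5.congr_fderiv (by ext <;> simp)
  have he : ∀ y, HasFDerivAt (fun y => Real.exp (M.siteWeight y) * φ y) _ y := fun y =>
    ((hw y).exp).mul (hφ y).hasFDerivAt
  -- Since `φ` is constant in the direction `v`, the derivative falls only on the Gibbs weight.
  have hev : ∀ y, fderiv ℝ (fun y => Real.exp (M.siteWeight y) * φ y) y v =
      -(Real.exp (M.siteWeight y) * (φ y * ((M.V' y.1 - M.τ) / M.T * v.1 + y.2 / M.T * v.2))) := by
    intro y
    rw [(he y).fderiv]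
    simp [hφv]
    field_simp
    ring
  rw [siteMeasure_eq, integrable_tilted_iff M.integrable_exp_siteWeight] at h1 h2 h3
  simp only [smul_eq_mul] at h1 h2 h3
  have key := integral_mul_fderiv_eq_neg_fderiv_mul_of_integrable (μ := volume)
    (f := fun y => Real.exp (M.siteWeight y) * φ y) (g := G) (v := v)
    (by
      refine h2.neg.congr (ae_of_all _ fun y => ?_)
      simp only [hev, Pi.neg_apply]; ring)
    (by refine h1.congr (ae_of_all _ fun y => ?_); simp only; ring)
    (by refine h3.congr (ae_of_all _ fun y => ?_); simp only; ring)
    (fun y _ => (he y).differentiableAt) (fun y _ => hG y)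
  rw [siteMeasure_eq, integral_tilted, integral_tilted]
  simp only [smul_eq_mul, div_mul_eq_mul_div, integral_div]
  congr 1
  calc _ = ∫ y, Real.exp (M.siteWeight y) * φ y * fderiv ℝ G y v := by
        refine integral_congr_ae (ae_of_all _ fun y => ?_); simp only; ring
    _ = _ := by
      rw [key, ← integral_neg]
      refine integral_congr_ae (ae_of_all _ fun y => ?_)
      simp only [hev]; ring

end Chain

end

/-! ### Calculus of local functions of class `C_0^1`. -/

noncomputable section

open Config

/-- Bounded continuously differentiable functions with bounded derivative. -/
def IsC1Bounded {E : Type*} [NormedAddCommGroup E] [NormedSpace ℝ E] (F : E → ℝ) : Prop :=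
  ContDiff ℝ 1 F ∧ (∃ C, ∀ y, |F y| ≤ C) ∧ ∃ C, ∀ y, ‖fderiv ℝ F y‖ ≤ C

namespace IsC1Bounded

variable {E E' : Type*} [NormedAddCommGroup E] [NormedSpace ℝ E] [NormedAddCommGroup E']
  [NormedSpace ℝ E'] {F G : E → ℝ}

lemma differentiable (hF : IsC1Bounded F) : Differentiable ℝ F :=
  hF.1.differentiable (by norm_num)

lemma comp_clm (hF : IsC1Bounded F) (A : E' →L[ℝ] E) : IsC1Bounded fun y => F (A y) := by
  obtain ⟨h1, ⟨C, hC⟩, C', hC'⟩ := hF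
  refine ⟨h1.comp A.contDiff, ⟨C, fun y => hC _⟩, C' * ‖A‖, fun y => ?_⟩
  have h := ((h1.differentiable (by norm_num) (A y)).hasFDerivAt.comp y A.hasFDerivAt).fderiv
  change ‖fderiv ℝ (F ∘ A) y‖ ≤ _
  rw [h]
  refine (ContinuousLinearMap.opNorm_comp_le _ _).trans ?_
  gcongr
  exact hC' _

lemma comp_add_const (hF : IsC1Bounded F) (a : E) : IsC1Bounded fun y => F (y + a) := by
  obtain ⟨h1, ⟨C, hC⟩, C', hC'⟩ := hF
  refine ⟨h1.comp (contDiff_id.add contDiff_const), ⟨C, fun y => hC _⟩, C', fun y => ?_⟩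
  rw [fderiv_comp_add_right]
  exact hC' _

lemma add (hF : IsC1Bounded F) (hG : IsC1Bounded G) : IsC1Bounded fun y => F y + G y := by
  obtain ⟨h1, ⟨C, hC⟩, C', hC'⟩ := id hF
  obtain ⟨h2, ⟨D, hD⟩, D', hD'⟩ := id hG
  refine ⟨h1.add h2, ⟨C + D, fun y => (abs_add_le _ _).trans (add_le_add (hC y) (hD y))⟩, C' + D',
    fun y => ?_⟩
  rw [fderiv_fun_add (hF.differentiable y) (hG.differentiable y)]
  exact (norm_add_le _ _).trans (add_le_add (hC' y) (hD' y))

lemma mul (hF : IsC1Bounded F) (hG : IsC1Bounded G) : IsC1Bounded fun y => F y * G y := by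
  obtain ⟨h1, ⟨C, hC⟩, C', hC'⟩ := id hF
  obtain ⟨h2, ⟨D, hD⟩, D', hD'⟩ := id hG
  refine ⟨h1.mul h2, ⟨C * D, fun y => ?_⟩, C * D' + D * C', fun y => ?_⟩
  · rw [abs_mul]
    exact mul_le_mul (hC y) (hD y) (abs_nonneg _) ((abs_nonneg _).trans (hC y))
  · rw [fderiv_fun_mul (hF.differentiable y) (hG.differentiable y)]
    refine (norm_add_le _ _).trans ?_
    rw [norm_smul, norm_smul]
    exact add_le_add
      (mul_le_mul (hC y) (hD' y) (norm_nonneg _) ((abs_nonneg _).trans (hC y)))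
      (mul_le_mul (hD y) (hC' y) (norm_nonneg _) ((abs_nonneg _).trans (hD y)))

lemma const (c : ℝ) : IsC1Bounded fun _ : E => c :=
  ⟨contDiff_const, ⟨|c|, fun _ => le_rfl⟩, 0, fun y => by simp⟩

end IsC1Bounded

namespace Config

/-- The function `f` is the composition of `F` with the restriction of configurations to `Λ`. -/
def Represents (Λ : Finset ℤ) (F : (Λ → ℝ × ℝ) → ℝ) (f : Config → ℝ) : Prop :=
  ∀ ω, f ω = F fun x => ω x

lemma Represents.dependsOn {Λ : Finset ℤ} {F : (Λ → ℝ × ℝ) → ℝ} {f : Config → ℝ}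
    (h : Represents Λ F f) : DependsOn f (Λ : Set ℤ) := by
  intro ω ω' hω
  rw [h, h]
  congr 1
  funext x
  exact hω x x.2

/-- The inclusion of `ℝ × ℝ` into the configurations on `Λ` as the coordinate at `x`. -/
def siteEmb (Λ : Finset ℤ) (x : ℤ) : ℝ × ℝ →L[ℝ] (Λ → ℝ × ℝ) :=
  ContinuousLinearMap.pi fun i => if (i : ℤ) = x then ContinuousLinearMap.id ℝ (ℝ × ℝ) else 0

lemma siteEmb_apply (Λ : Finset ℤ) (x : ℤ) (y : ℝ × ℝ) (i : Λ) :
    siteEmb Λ x y i = if (i : ℤ) = x then y else 0 := by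
  unfold siteEmb
  rw [ContinuousLinearMap.pi_apply]
  split_ifs <;> rfl

lemma sum_siteEmb (Λ : Finset ℤ) (v : ℤ → ℝ × ℝ) :
    ∑ x ∈ Λ, siteEmb Λ x (v x) = fun i : Λ => v i := by
  funext i
  simp [Finset.sum_apply, siteEmb_apply]

/-- Changing one site is an affine operation on the window, so slices in one coordinate inherit the
regularity and bounds of `F`. -/
lemma restrict_update (Λ : Finset ℤ) (ω : Config) (x : ℤ) (y : ℝ × ℝ) :
    (fun i : Λ => Function.update ω x y i) = siteEmb Λ x y + ((fun i : Λ => ω i) - siteEmb Λ x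
        (ω x)) := by
  funext i
  simp only [Pi.add_apply, Pi.sub_apply, siteEmb_apply]
  by_cases h : (i : ℤ) = x
  · simp [h]
  · simp [h]

lemma Represents.slice {Λ : Finset ℤ} {F : (Λ → ℝ × ℝ) → ℝ} {f : Config → ℝ}
    (h : Represents Λ F f) (ω : Config) (x : ℤ) :
    (fun y => f (Function.update ω x y)) =
      fun y => F (siteEmb Λ x y + ((fun i : Λ => ω i) - siteEmb Λ x (ω x))) := by
  funext y
  rw [h, restrict_update]

lemma IsC01.slice {f : Config → ℝ} (hf : IsC01 f) (ω : Config) (x : ℤ) :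
    IsC1Bounded fun y => f (Function.update ω x y) := by
  obtain ⟨Λ, F, hF, h⟩ := hf
  rw [Represents.slice hF]
  exact IsC1Bounded.comp_clm (IsC1Bounded.comp_add_const h _) (siteEmb Λ x)

lemma Represents.fderiv_slice {Λ : Finset ℤ} {F : (Λ → ℝ × ℝ) → ℝ} {f : Config → ℝ}
    (h : Represents Λ F f) (hF : Differentiable ℝ F) (ω : Config) (x : ℤ) (v : ℝ × ℝ) :
    fderiv ℝ (fun y => f (Function.update ω x y)) (ω x) v =
      fderiv ℝ F (fun i : Λ => ω i) (siteEmb Λ x v) := by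
  rw [h.slice ω x]
  set a := (fun i : Λ => ω i) - siteEmb Λ x (ω x) with ha
  have e : siteEmb Λ x (ω x) + a = fun i : Λ => ω i := by rw [ha]; abel
  have h1 : HasFDerivAt (fun y => siteEmb Λ x y + a) (siteEmb Λ x) (ω x) :=
    (siteEmb Λ x).hasFDerivAt.add_const a
  have h2 : HasFDerivAt F (fderiv ℝ F fun i : Λ => ω i) (siteEmb Λ x (ω x) + a) := by
    rw [e]; exact (hF _).hasFDerivAt
  have h3 := h2.comp (ω x) h1
  change fderiv ℝ (F ∘ fun y => siteEmb Λ x y + a) (ω x) v = _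
  rw [h3.fderiv]
  rfl

lemma partialR_eq_fderiv_slice {f : Config → ℝ} {ω : Config} {x : ℤ}
    (h : DifferentiableAt ℝ (fun y => f (Function.update ω x y)) (ω x)) :
    partialR x f ω = fderiv ℝ (fun y => f (Function.update ω x y)) (ω x) (1, 0) := by
  have h1 : HasDerivAt (fun s : ℝ => (s, (ω x).2)) ((1 : ℝ), (0 : ℝ)) (ω x).1 :=
    (hasDerivAt_id _).prodMk (hasDerivAt_const _ _)
  exact (HasFDerivAt.comp_hasDerivAt (x := (ω x).1) (f := fun s : ℝ => (s, (ω x).2))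
    (l := fun y => f (Function.update ω x y)) h.hasFDerivAt h1).deriv

lemma partialP_eq_fderiv_slice {f : Config → ℝ} {ω : Config} {x : ℤ}
    (h : DifferentiableAt ℝ (fun y => f (Function.update ω x y)) (ω x)) :
    partialP x f ω = fderiv ℝ (fun y => f (Function.update ω x y)) (ω x) (0, 1) := by
  have h1 : HasDerivAt (fun s : ℝ => ((ω x).1, s)) ((0 : ℝ), (1 : ℝ)) (ω x).2 :=
    (hasDerivAt_const _ _).prodMk (hasDerivAt_id _)
  exact (HasFDerivAt.comp_hasDerivAt (x := (ω x).2) (f := fun s : ℝ => ((ω x).1, s))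
    (l := fun y => f (Function.update ω x y)) h.hasFDerivAt h1).deriv

lemma IsC01.partialR_update {f : Config → ℝ} (hf : IsC01 f) (x : ℤ) (ω : Config) (y : ℝ × ℝ) :
    partialR x f (Function.update ω x y) =
      fderiv ℝ (fun y => f (Function.update ω x y)) y (1, 0) := by
  rw [partialR_eq_fderiv_slice ((hf.slice _ x).differentiable _)]
  simp only [Function.update_idem, Function.update_self]

lemma IsC01.partialP_update {f : Config → ℝ} (hf : IsC01 f) (x : ℤ) (ω : Config) (y : ℝ × ℝ) :
    partialP x f (Function.update ω x y) =
      fderiv ℝ (fun y => f (Function.update ω x y)) y (0, 1) := by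
  rw [partialP_eq_fderiv_slice ((hf.slice _ x).differentiable _)]
  simp only [Function.update_idem, Function.update_self]

lemma Represents.partialR {Λ : Finset ℤ} {F : (Λ → ℝ × ℝ) → ℝ} {f : Config → ℝ}
    (h : Represents Λ F f) (hF : IsC1Bounded F) (x : ℤ) (ω : Config) :
    partialR x f ω = fderiv ℝ F (fun i : Λ => ω i) (siteEmb Λ x (1, 0)) := by
  rw [partialR_eq_fderiv_slice ((IsC01.slice ⟨Λ, F, h, hF⟩ ω x).differentiable _),
    h.fderiv_slice hF.differentiable]

lemma Represents.partialP {Λ : Finset ℤ} {F : (Λ → ℝ × ℝ) → ℝ} {f : Config → ℝ}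
    (h : Represents Λ F f) (hF : IsC1Bounded F) (x : ℤ) (ω : Config) :
    partialP x f ω = fderiv ℝ F (fun i : Λ => ω i) (siteEmb Λ x (0, 1)) := by
  rw [partialP_eq_fderiv_slice ((IsC01.slice ⟨Λ, F, h, hF⟩ ω x).differentiable _),
    h.fderiv_slice hF.differentiable]

lemma measurable_fderiv_restrict {Λ : Finset ℤ} {F : (Λ → ℝ × ℝ) → ℝ} (hF : ContDiff ℝ 1 F)
    (v : Λ → ℝ × ℝ) : Measurable fun ω : Config => fderiv ℝ F (fun i : Λ => ω i) v := by
  have h : Continuous fun y => fderiv ℝ F y v :=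
    (hF.continuous_fderiv (by norm_num)).clm_apply continuous_const
  exact h.measurable.comp (by fun_prop)

lemma IsC01.measurable {f : Config → ℝ} (hf : IsC01 f) : Measurable f := by
  obtain ⟨Λ, F, h, hF⟩ := hf
  have : f = F ∘ fun (ω : Config) (i : Λ) => ω i := funext h
  rw [this]
  exact hF.1.continuous.measurable.comp (by fun_prop)

lemma IsC01.isLocal {f : Config → ℝ} (hf : IsC01 f) : IsLocal f := by
  obtain ⟨Λ, F, h, hF⟩ := hf
  exact ⟨Λ, Represents.dependsOn h⟩

lemma IsC01.bounded {f : Config → ℝ} (hf : IsC01 f) : ∃ C, ∀ ω, |f ω| ≤ C := by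
  obtain ⟨Λ, F, h, -, ⟨C, hC⟩, -⟩ := hf
  exact ⟨C, fun ω => by rw [h]; exact hC _⟩

lemma IsC01.measurable_partialR {f : Config → ℝ} (hf : IsC01 f) (x : ℤ) :
    Measurable (Config.partialR x f) := by
  obtain ⟨Λ, F, h, hF⟩ := hf
  rw [funext (Represents.partialR h hF x)]
  exact measurable_fderiv_restrict hF.1 _

lemma IsC01.measurable_partialP {f : Config → ℝ} (hf : IsC01 f) (x : ℤ) :
    Measurable (Config.partialP x f) := by
  obtain ⟨Λ, F, h, hF⟩ := hf
  rw [funext (Represents.partialP h hF x)]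
  exact measurable_fderiv_restrict hF.1 _

lemma IsC01.bounded_partialR {f : Config → ℝ} (hf : IsC01 f) (x : ℤ) :
    ∃ C, ∀ ω, |Config.partialR x f ω| ≤ C := by
  obtain ⟨Λ, F, h, hF⟩ := hf
  obtain ⟨C, hC⟩ := hF.2.2
  refine ⟨C * ‖siteEmb Λ x (1, 0)‖, fun ω => ?_⟩
  rw [Represents.partialR h hF x]
  exact ContinuousLinearMap.le_of_opNorm_le _ (hC _) _

lemma IsC01.bounded_partialP {f : Config → ℝ} (hf : IsC01 f) (x : ℤ) :
    ∃ C, ∀ ω, |Config.partialP x f ω| ≤ C := by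
  obtain ⟨Λ, F, h, hF⟩ := hf
  obtain ⟨C, hC⟩ := hF.2.2
  refine ⟨C * ‖siteEmb Λ x (0, 1)‖, fun ω => ?_⟩
  rw [Represents.partialP h hF x]
  exact ContinuousLinearMap.le_of_opNorm_le _ (hC _) _

lemma update_of_notMem {f : Config → ℝ} {Λ : Finset ℤ} (hf : DependsOn f (Λ : Set ℤ)) {x : ℤ}
    (hx : x ∉ Λ) (ω : Config) (y : ℝ × ℝ) : f (Function.update ω x y) = f ω := by
  apply hf
  intro i hi
  refine Function.update_of_ne ?_ _ _
  rintro rfl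
  exact hx hi

lemma partialR_of_notMem {f : Config → ℝ} {Λ : Finset ℤ} (hf : DependsOn f (Λ : Set ℤ)) {x : ℤ}
    (hx : x ∉ Λ) (ω : Config) : Config.partialR x f ω = 0 := by
  simp only [Config.partialR, update_of_notMem hf hx, deriv_const]

lemma partialP_of_notMem {f : Config → ℝ} {Λ : Finset ℤ} (hf : DependsOn f (Λ : Set ℤ)) {x : ℤ}
    (hx : x ∉ Λ) (ω : Config) : Config.partialP x f ω = 0 := by
  simp only [Config.partialP, update_of_notMem hf hx, deriv_const]

lemma dependsOn_partialR {f : Config → ℝ} {Λ : Finset ℤ} (hf : DependsOn f (Λ : Set ℤ)) (x : ℤ) :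
    DependsOn (Config.partialR x f) (Λ : Set ℤ) := by
  by_cases hx : x ∈ Λ
  · intro ω ω' h
    simp only [Config.partialR]
    rw [h x hx]
    congr 1
    funext s
    apply hf
    intro i hi
    by_cases hix : i = x
    · subst hix; simp
    · simp [hix, h i hi]
  · intro ω ω' _
    rw [partialR_of_notMem hf hx, partialR_of_notMem hf hx]

lemma dependsOn_partialP {f : Config → ℝ} {Λ : Finset ℤ} (hf : DependsOn f (Λ : Set ℤ)) (x : ℤ) :
    DependsOn (Config.partialP x f) (Λ : Set ℤ) := by
  by_cases hx : x ∈ Λ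
  · intro ω ω' h
    simp only [Config.partialP]
    rw [h x hx]
    congr 1
    funext s
    apply hf
    intro i hi
    by_cases hix : i = x
    · subst hix; simp
    · simp [hix, h i hi]
  · intro ω ω' _
    rw [partialP_of_notMem hf hx, partialP_of_notMem hf hx]

/-- The common form of shifts and of the reversal: the sites are relabelled by `e` and a linear map
acts at each site. -/
lemma IsC01.comp_clm {f : Config → ℝ} (hf : IsC01 f) {φ : Config → Config} {e : ℤ → ℤ}
    {A : ℤ → (ℝ × ℝ →L[ℝ] ℝ × ℝ)} (hφ : ∀ ω x, φ ω x = A x (ω (e x))) :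
    IsC01 fun ω => f (φ ω) := by
  obtain ⟨Λ, F, h, hF⟩ := hf
  let B : (↥(Λ.image e) → ℝ × ℝ) →L[ℝ] (Λ → ℝ × ℝ) := ContinuousLinearMap.pi fun x : Λ =>
    (A x).comp (ContinuousLinearMap.proj ⟨e x, Finset.mem_image_of_mem e x.2⟩)
  refine ⟨Λ.image e, fun y => F (B y), fun ω => ?_, IsC1Bounded.comp_clm hF B⟩
  exact (h _).trans (congrArg F (funext fun x => hφ ω x))

lemma IsC01.shift {f : Config → ℝ} (hf : IsC01 f) (x : ℤ) : IsC01 fun ω => f (shift x ω) :=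
  hf.comp_clm (e := fun y => y + x) (A := fun _ => ContinuousLinearMap.id ℝ _) fun _ _ => rfl

lemma IsC01.reverse {f : Config → ℝ} (hf : IsC01 f) : IsC01 fun ω => f (reverse ω) :=
  hf.comp_clm (e := fun y => y) (A := fun _ => (ContinuousLinearMap.fst ℝ ℝ ℝ).prod
    (-ContinuousLinearMap.snd ℝ ℝ ℝ)) fun _ _ => rfl

/-- A window can always be enlarged, so any two functions have a common one, as sums and products
require. -/
lemma IsC01.exists_represents {f : Config → ℝ} (hf : IsC01 f) :
    ∃ Λ₀ : Finset ℤ, ∀ Λ : Finset ℤ, Λ₀ ⊆ Λ →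
      ∃ F : (Λ → ℝ × ℝ) → ℝ, Represents Λ F f ∧ IsC1Bounded F := by
  obtain ⟨Λ₀, F, h, hF⟩ := hf
  refine ⟨Λ₀, fun Λ hΛ => ⟨_, fun ω => ?_, IsC1Bounded.comp_clm hF (ContinuousLinearMap.pi
    fun x : Λ₀ => ContinuousLinearMap.proj (⟨x, hΛ x.2⟩ : Λ))⟩⟩
  rw [h]
  rfl

lemma IsC01.mul {f g : Config → ℝ} (hf : IsC01 f) (hg : IsC01 g) : IsC01 fun ω => f ω * g ω := by
  obtain ⟨Λ₁, h₁⟩ := hf.exists_represents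
  obtain ⟨Λ₂, h₂⟩ := hg.exists_represents
  obtain ⟨F, hF, hF'⟩ := h₁ (Λ₁ ∪ Λ₂) Finset.subset_union_left
  obtain ⟨G, hG, hG'⟩ := h₂ (Λ₁ ∪ Λ₂) Finset.subset_union_right
  exact ⟨_, _, fun ω => congrArg₂ (· * ·) (hF ω) (hG ω), hF'.mul hG'⟩

lemma IsC01.add {f g : Config → ℝ} (hf : IsC01 f) (hg : IsC01 g) : IsC01 fun ω => f ω + g ω := by
  obtain ⟨Λ₁, h₁⟩ := hf.exists_represents
  obtain ⟨Λ₂, h₂⟩ := hg.exists_represents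
  obtain ⟨F, hF, hF'⟩ := h₁ (Λ₁ ∪ Λ₂) Finset.subset_union_left
  obtain ⟨G, hG, hG'⟩ := h₂ (Λ₁ ∪ Λ₂) Finset.subset_union_right
  exact ⟨_, _, fun ω => congrArg₂ (· + ·) (hF ω) (hG ω), hF'.add hG'⟩

lemma IsC01.const (c : ℝ) : IsC01 fun _ => c :=
  ⟨∅, fun _ => c, fun _ => rfl, IsC1Bounded.const c⟩

lemma IsC01.partialR_mul {f g : Config → ℝ} (hf : IsC01 f) (hg : IsC01 g) (x : ℤ) (ω : Config) :
    Config.partialR x (fun ω => f ω * g ω) ω =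
      f ω * Config.partialR x g ω + g ω * Config.partialR x f ω := by
  have h1 := (hf.slice ω x).differentiable (ω x)
  have h2 := (hg.slice ω x).differentiable (ω x)
  rw [partialR_eq_fderiv_slice h1, partialR_eq_fderiv_slice h2,
    partialR_eq_fderiv_slice (h1.mul h2), fderiv_fun_mul h1 h2]
  simp

lemma IsC01.partialP_mul {f g : Config → ℝ} (hf : IsC01 f) (hg : IsC01 g) (x : ℤ) (ω : Config) :
    Config.partialP x (fun ω => f ω * g ω) ω =
      f ω * Config.partialP x g ω + g ω * Config.partialP x f ω := by
  have h1 := (hf.slice ω x).differentiable (ω x)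
  have h2 := (hg.slice ω x).differentiable (ω x)
  rw [partialP_eq_fderiv_slice h1, partialP_eq_fderiv_slice h2,
    partialP_eq_fderiv_slice (h1.mul h2), fderiv_fun_mul h1 h2]
  simp

lemma IsC01.partialR_add {f g : Config → ℝ} (hf : IsC01 f) (hg : IsC01 g) (x : ℤ) (ω : Config) :
    Config.partialR x (fun ω => f ω + g ω) ω = Config.partialR x f ω + Config.partialR x g ω := by
  have h1 := (hf.slice ω x).differentiable (ω x)
  have h2 := (hg.slice ω x).differentiable (ω x)
  rw [partialR_eq_fderiv_slice h1, partialR_eq_fderiv_slice h2,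
    partialR_eq_fderiv_slice (h1.add h2), fderiv_fun_add h1 h2]
  simp

lemma IsC01.partialP_add {f g : Config → ℝ} (hf : IsC01 f) (hg : IsC01 g) (x : ℤ) (ω : Config) :
    Config.partialP x (fun ω => f ω + g ω) ω = Config.partialP x f ω + Config.partialP x g ω := by
  have h1 := (hf.slice ω x).differentiable (ω x)
  have h2 := (hg.slice ω x).differentiable (ω x)
  rw [partialP_eq_fderiv_slice h1, partialP_eq_fderiv_slice h2,
    partialP_eq_fderiv_slice (h1.add h2), fderiv_fun_add h1 h2]
  simp

lemma update_shift (f : Config → ℝ) (x y : ℤ) (ω : Config) (v : ℝ × ℝ) :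
    f (Function.update (Config.shift x ω) y v) = f (Config.shift x (Function.update ω (y +
        x) v)) := by
  congr 1
  funext z
  by_cases h : z = y
  · subst h; simp [Config.shift]
  · simp [Config.shift, h]

lemma partialR_shift (f : Config → ℝ) (x y : ℤ) (ω : Config) :
    Config.partialR y f (Config.shift x ω) =
      Config.partialR (y + x) (fun ω => f (Config.shift x ω)) ω := by
  simp only [Config.partialR, update_shift]
  rfl

lemma partialP_shift (f : Config → ℝ) (x y : ℤ) (ω : Config) :
    Config.partialP y f (Config.shift x ω) =
      Config.partialP (y + x) (fun ω => f (Config.shift x ω)) ω := by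
  simp only [Config.partialP, update_shift]
  rfl

lemma update_reverse (ω : Config) (x : ℤ) (a b : ℝ) :
    Function.update (Config.reverse ω) x (a, b) = Config.reverse (Function.update ω x (a, -b)) := by
  funext y
  by_cases h : y = x
  · subst h; simp [Config.reverse]
  · simp [Config.reverse, h]

lemma partialR_reverse (f : Config → ℝ) (x : ℤ) (ω : Config) :
    Config.partialR x (fun ω => f (Config.reverse ω)) ω = Config.partialR x f
        (Config.reverse ω) := by
  simp only [Config.partialR, update_reverse]
  simp [Config.reverse]

lemma partialP_reverse (f : Config → ℝ) (x : ℤ) (ω : Config) :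
    Config.partialP x (fun ω => f (Config.reverse ω)) ω =
      -Config.partialP x f (Config.reverse ω) := by
  simp only [Config.partialP, update_reverse]
  rw [deriv_comp_neg fun s => f (Config.reverse (Function.update ω x ((Config.reverse ω x).1, s)))]
  simp [Config.reverse]

end Config

end

/-! ### Invariance of the Gibbs state under the Liouville operator, and its antisymmetry. -/

noncomputable section

open Config

namespace Chain

variable (M : Chain)

lemma memLp_p (x : ℤ) : MemLp (fun ω : Config => (ω x).2) 2 M.gibbs :=
  M.memLp_site_p.comp_measurePreserving (M.measurePreserving_coord x)

lemma memLp_V' (x : ℤ) : MemLp (fun ω : Config => M.V' (ω x).1) 2 M.gibbs :=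
  M.memLp_site_V'.comp_measurePreserving (M.measurePreserving_coord x)

lemma memLp_mul_bounded {α : Type*} [MeasurableSpace α] {μ : Measure α} {f g : α → ℝ}
    (hf : MemLp f 2 μ) (hg : Measurable g) (hb : ∃ C, ∀ a, |g a| ≤ C) :
    MemLp (fun a => f a * g a) 2 μ := by
  obtain ⟨C, hC⟩ := hb
  refine hf.of_le_mul (c := C) (hf.1.mul hg.aestronglyMeasurable) (ae_of_all _ fun a => ?_)
  rw [norm_mul, mul_comm]
  exact mul_le_mul_of_nonneg_right (hC a) (norm_nonneg _)

/-- The current `p_{x-1} (V'(r_x) - τ)` of the Liouville dynamics. -/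
def bondCurrent (x : ℤ) (ω : Config) : ℝ := (ω (x - 1)).2 * (M.V' (ω x).1 - M.τ)

lemma integrable_bondCurrent (x : ℤ) : Integrable (M.bondCurrent x) M.gibbs :=
  MemLp.integrable_mul (M.memLp_p (x - 1)) ((M.memLp_V' x).sub (memLp_const M.τ))

lemma measurable_V' : Measurable M.V' := M.continuous_V'.measurable

lemma memLp_site_bounded {g : ℝ × ℝ → ℝ} (hg : Continuous g) (hb : ∃ C, ∀ y, |g y| ≤ C) :
    MemLp g 2 M.siteMeasure := by
  obtain ⟨C, hC⟩ := hb
  exact MemLp.of_bound hg.aestronglyMeasurable C (ae_of_all _ hC)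

lemma continuous_fderiv_apply {G : ℝ × ℝ → ℝ} (hG : IsC1Bounded G) (v : ℝ × ℝ) :
    Continuous fun y => fderiv ℝ G y v :=
  (hG.1.continuous_fderiv (by norm_num)).clm_apply continuous_const

lemma bounded_fderiv_apply {G : ℝ × ℝ → ℝ} (hG : IsC1Bounded G) (v : ℝ × ℝ) :
    ∃ C, ∀ y, |fderiv ℝ G y v| ≤ C := by
  obtain ⟨C, hC⟩ := hG.2.2
  exact ⟨C * ‖v‖, fun y => ContinuousLinearMap.le_of_opNorm_le _ (hC y) _⟩

/-- The constant `a` will be `p_{x-1}`, frozen while the site `x` is integrated. The factor `p - a`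
does not depend on `r`, the variable of differentiation. -/
lemma integral_site_p_mul_fderiv {G : ℝ × ℝ → ℝ} (hG : IsC1Bounded G) (a : ℝ) :
    ∫ y, (y.2 - a) * fderiv ℝ G y (1, 0) ∂M.siteMeasure =
      ∫ y, (y.2 - a) * ((M.V' y.1 - M.τ) / M.T) * G y ∂M.siteMeasure := by
  have hp : MemLp (fun y : ℝ × ℝ => y.2 - a) 2 M.siteMeasure :=
    M.memLp_site_p.sub (memLp_const a)
  have hV : MemLp (fun y : ℝ × ℝ => (M.V' y.1 - M.τ) / M.T) 2 M.siteMeasure := by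
    have := (M.memLp_site_V'.sub (memLp_const M.τ)).const_mul (M.T⁻¹)
    simpa [div_eq_inv_mul] using this
  have h := M.integral_site_mul_fderiv (φ := fun y => y.2 - a) (v := (1, 0)) (by fun_prop)
    (fun y => by
      have : HasFDerivAt (fun y : ℝ × ℝ => y.2 - a) (ContinuousLinearMap.snd ℝ ℝ ℝ) y :=
        hasFDerivAt_snd.sub_const a
      rw [this.fderiv]; simp) hG.differentiable
    (MemLp.integrable_mul hp (M.memLp_site_bounded (continuous_fderiv_apply hG _)
      (bounded_fderiv_apply hG _)))
    (by
      have := MemLp.integrable_mul hp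
        (memLp_mul_bounded hV hG.1.continuous.measurable hG.2.1)
      refine this.congr (ae_of_all _ fun y => ?_)
      simp only [Pi.mul_apply]; ring)
    (MemLp.integrable_mul hp (M.memLp_site_bounded hG.1.continuous hG.2.1))
  simpa using h

/-- The constant `a` will be `V'(r_{x+1})`, frozen while the site `x` is integrated. -/
lemma integral_site_V'_mul_fderiv {G : ℝ × ℝ → ℝ} (hG : IsC1Bounded G) (a : ℝ) :
    ∫ y, (a - M.V' y.1) * fderiv ℝ G y (0, 1) ∂M.siteMeasure =
      ∫ y, (a - M.V' y.1) * (y.2 / M.T) * G y ∂M.siteMeasure := by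
  have hp : MemLp (fun y : ℝ × ℝ => y.2 / M.T) 2 M.siteMeasure := by
    have := M.memLp_site_p.const_mul (M.T⁻¹)
    simpa [div_eq_inv_mul] using this
  have hV : MemLp (fun y : ℝ × ℝ => a - M.V' y.1) 2 M.siteMeasure :=
    (memLp_const a).sub M.memLp_site_V'
  have hd : Differentiable ℝ M.V' := M.contDiff_V'.differentiable (by norm_num)
  have h := M.integral_site_mul_fderiv (φ := fun y => a - M.V' y.1) (v := (0, 1))
    (by fun_prop)
    (fun y => by
      have h1 : HasFDerivAt (fun y : ℝ × ℝ => y.1) (ContinuousLinearMap.fst ℝ ℝ ℝ) y :=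
        hasFDerivAt_fst
      have h2 := ((hd y.1).hasDerivAt.comp_hasFDerivAt y h1).const_sub a
      change fderiv ℝ (fun y => a - (M.V' ∘ fun y : ℝ × ℝ => y.1) y) y (0, 1) = 0
      rw [h2.fderiv]; simp) hG.differentiable
    (MemLp.integrable_mul hV (M.memLp_site_bounded (continuous_fderiv_apply hG _)
      (bounded_fderiv_apply hG _)))
    (by
      have := MemLp.integrable_mul hV
        (memLp_mul_bounded hp hG.1.continuous.measurable hG.2.1)
      refine this.congr (ae_of_all _ fun y => ?_)
      simp only [Pi.mul_apply]; ring)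
    (MemLp.integrable_mul hV (M.memLp_site_bounded hG.1.continuous hG.2.1))
  simpa using h

variable {M} {f g : Config → ℝ}

lemma memLp_two_bounded (hf : Measurable f) (hb : ∃ C, ∀ ω, |f ω| ≤ C) : MemLp f 2 M.gibbs := by
  obtain ⟨C, hC⟩ := hb
  exact MemLp.of_bound hf.aestronglyMeasurable C (ae_of_all _ hC)

lemma integral_p_mul_partialR (hf : IsC01 f) (x : ℤ) :
    ∫ ω, ((ω x).2 - (ω (x - 1)).2) * partialR x f ω ∂M.gibbs =
      ∫ ω, ((ω x).2 - (ω (x - 1)).2) * ((M.V' (ω x).1 - M.τ) / M.T) * f ω ∂M.gibbs := by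
  have hp := (M.memLp_p x).sub (M.memLp_p (x - 1))
  have hV := ((M.memLp_V' x).sub (memLp_const M.τ)).const_mul (M.T⁻¹)
  have hI : Integrable (fun ω : Config => ((ω x).2 - (ω (x - 1)).2) * partialR x f ω) M.gibbs :=
    MemLp.integrable_mul hp
      (memLp_two_bounded (hf.measurable_partialR x) (hf.bounded_partialR x))
  have hJ : Integrable (fun ω : Config => ((ω x).2 - (ω (x - 1)).2) * ((M.V' (ω x).1 -
      M.τ) / M.T) * f ω)
      M.gibbs := by
    refine (MemLp.integrable_mul hp (memLp_mul_bounded hV hf.measurable hf.bounded)).congr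
      (ae_of_all _ fun ω => ?_)
    simp only [Pi.mul_apply, Pi.sub_apply]
    ring
  rw [M.integral_update x hI, M.integral_update x hJ]
  refine integral_congr_ae (ae_of_all _ fun ω => ?_)
  have h := M.integral_site_p_mul_fderiv (hf.slice ω x) (ω (x - 1)).2
  have hx : x - 1 ≠ x := by omega
  simpa only [hf.partialR_update, Function.update_self, Function.update_of_ne hx] using h

lemma integral_V'_mul_partialP (hf : IsC01 f) (x : ℤ) :
    ∫ ω, (M.V' (ω (x + 1)).1 - M.V' (ω x).1) * partialP x f ω ∂M.gibbs =
      ∫ ω, (M.V' (ω (x + 1)).1 - M.V' (ω x).1) * ((ω x).2 / M.T) * f ω ∂M.gibbs := by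
  have hV := (M.memLp_V' (x + 1)).sub (M.memLp_V' x)
  have hp := (M.memLp_p x).const_mul (M.T⁻¹)
  have hI : Integrable (fun ω : Config => (M.V' (ω (x + 1)).1 - M.V' (ω x).1) * partialP x f ω)
      M.gibbs := MemLp.integrable_mul hV
      (memLp_two_bounded (hf.measurable_partialP x) (hf.bounded_partialP x))
  have hJ : Integrable (fun ω : Config => (M.V' (ω (x + 1)).1 - M.V' (ω x).1) * ((ω x).2 / M.T) *
      f ω)
      M.gibbs := by
    refine (MemLp.integrable_mul hV (memLp_mul_bounded hp hf.measurable hf.bounded)).congr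
      (ae_of_all _ fun ω => ?_)
    simp only [Pi.mul_apply, Pi.sub_apply]
    ring
  rw [M.integral_update x hI, M.integral_update x hJ]
  refine integral_congr_ae (ae_of_all _ fun ω => ?_)
  have h := M.integral_site_V'_mul_fderiv (hf.slice ω x) (M.V' (ω (x + 1)).1)
  have hx : x + 1 ≠ x := by omega
  simpa only [hf.partialP_update, Function.update_self, Function.update_of_ne hx] using h

lemma liouville_eq_sum {Λ s : Finset ℤ} (hf : DependsOn f (Λ : Set ℤ)) (hs : Λ ⊆ s) (ω : Config) :
    M.liouville f ω = ∑ x ∈ s, (((ω x).2 - (ω (x - 1)).2) * partialR x f ω +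
      (M.V' (ω (x + 1)).1 - M.V' (ω x).1) * partialP x f ω) := by
  refine finsum_eq_sum_of_support_subset _ fun x hx => ?_
  by_contra hxs
  have hxΛ : x ∉ Λ := fun h => hxs (hs h)
  apply hx
  simp only
  rw [partialR_of_notMem hf hxΛ, partialP_of_notMem hf hxΛ, mul_zero, mul_zero, add_zero]

/-- The current is odd in `p_{x-1}`, of which `f` is independent. -/
lemma integral_mul_bondCurrent {Λ : Finset ℤ} (hf : DependsOn f (Λ : Set ℤ)) {x : ℤ}
    (hx : x - 1 ∉ Λ) : ∫ ω, M.bondCurrent x ω * f ω ∂M.gibbs = 0 := by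
  have h := M.measurePreserving_flipOn {x - 1}
  have hemb : MeasurableEmbedding (flipOn {x - 1}) :=
    (MeasurableEquiv.mk (Equiv.mk _ _ (flipOn_flipOn {x - 1}) (flipOn_flipOn {x - 1}))
      (measurable_flipOn _) (measurable_flipOn _)).measurableEmbedding
  have h2 := h.integral_comp hemb fun ω => M.bondCurrent x ω * f ω
  have h3 : ∀ ω, M.bondCurrent x (flipOn {x - 1} ω) * f (flipOn {x - 1} ω) =
      -(M.bondCurrent x ω * f ω) := by
    intro ω
    have e1 : f (flipOn {x - 1} ω) = f ω := by
      refine hf fun i hi => flipOn_apply_of_notMem ?_ _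
      rintro rfl
      exact hx hi
    have e2 : flipOn {x - 1} ω x = ω x := flipOn_apply_of_notMem (by simp; omega) _
    rw [e1]
    simp only [bondCurrent]
    rw [e2, flipOn_apply_of_mem (by simp)]
    ring
  simp only [h3, integral_neg] at h2
  linarith

/-- The Gibbs state is invariant under the Liouville dynamics. -/
theorem integral_liouville (hf : IsC01 f) : ∫ ω, M.liouville f ω ∂M.gibbs = 0 := by
  obtain ⟨Λ, hΛ⟩ := hf.isLocal
  obtain ⟨N, hN⟩ : ∃ N : ℕ, ∀ x ∈ Λ, x.natAbs < N := ⟨Λ.sup Int.natAbs + 1, fun x hx =>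
    Nat.lt_succ_of_le (Finset.le_sup (f := Int.natAbs) hx)⟩
  have hIR : ∀ x, Integrable (fun ω : Config => ((ω x).2 - (ω (x - 1)).2) * partialR x f ω)
      M.gibbs := fun x => MemLp.integrable_mul ((M.memLp_p x).sub (M.memLp_p (x - 1)))
      (memLp_two_bounded (hf.measurable_partialR x) (hf.bounded_partialR x))
  have hIP : ∀ x, Integrable (fun ω : Config =>
      (M.V' (ω (x + 1)).1 - M.V' (ω x).1) * partialP x f ω) M.gibbs := fun x =>
    MemLp.integrable_mul ((M.memLp_V' (x + 1)).sub (M.memLp_V' x))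
      (memLp_two_bounded (hf.measurable_partialP x) (hf.bounded_partialP x))
  have hB : ∀ x, Integrable (fun ω => M.bondCurrent x ω * f ω) M.gibbs := fun x => by
    obtain ⟨C, hC⟩ := hf.bounded
    exact (M.integrable_bondCurrent x).mul_bdd hf.measurable.aestronglyMeasurable
      (ae_of_all _ hC)
  -- After integration by parts the site `x` contributes the weight `(p_x - p_{x-1}) (V'(r_x) - τ) +
  -- (V'(r_{x+1}) - V'(r_x)) p_x`, in which `p_x V'(r_x)` cancels. What remains is a discrete
  -- gradient of bond currents, so the sum over sites telescopes.
  have hterm : ∀ x, ∫ ω, (((ω x).2 - (ω (x - 1)).2) * partialR x f ω +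
      (M.V' (ω (x + 1)).1 - M.V' (ω x).1) * partialP x f ω) ∂M.gibbs =
      M.T⁻¹ * ((∫ ω, M.bondCurrent (x + 1) ω * f ω ∂M.gibbs) -
        ∫ ω, M.bondCurrent x ω * f ω ∂M.gibbs) := by
    intro x
    rw [integral_add (hIR x) (hIP x), integral_p_mul_partialR hf, integral_V'_mul_partialP hf,
      ← integral_sub (hB (x + 1)) (hB x), ← integral_const_mul, ← integral_add]
    · refine integral_congr_ae (ae_of_all _ fun ω => ?_)
      simp only [bondCurrent, add_sub_cancel_right]
      ring
    · have hp := (M.memLp_p x).sub (M.memLp_p (x - 1))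
      have hV := ((M.memLp_V' x).sub (memLp_const M.τ)).const_mul (M.T⁻¹)
      refine (MemLp.integrable_mul hp (memLp_mul_bounded hV hf.measurable hf.bounded)).congr
        (ae_of_all _ fun ω => ?_)
      simp only [Pi.mul_apply, Pi.sub_apply]
      ring
    · have hV := (M.memLp_V' (x + 1)).sub (M.memLp_V' x)
      have hp := (M.memLp_p x).const_mul (M.T⁻¹)
      refine (MemLp.integrable_mul hV (memLp_mul_bounded hp hf.measurable hf.bounded)).congr
        (ae_of_all _ fun ω => ?_)
      simp only [Pi.mul_apply, Pi.sub_apply]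
      ring
  -- The window is `{-N, …, N}`, with `|x| < N` on the support of `f`. The two surviving currents
  -- carry `p_N` and `p_{-N-1}`, both outside the support.
  have hsub : Λ ⊆ (Finset.range (2 * N + 1)).image fun i : ℕ => (i : ℤ) - N := by
    intro x hx
    have := hN x hx
    exact Finset.mem_image.2 ⟨(x + N).toNat, Finset.mem_range.2 (by omega), by omega⟩
  simp only [liouville_eq_sum hΛ hsub]
  have hI : ∀ x, Integrable (fun ω : Config => ((ω x).2 - (ω (x - 1)).2) * partialR x f ω +
      (M.V' (ω (x + 1)).1 - M.V' (ω x).1) * partialP x f ω) M.gibbs := fun x =>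
    (hIR x).add (hIP x)
  rw [integral_finsetSum _ fun x _ => hI x, Finset.sum_image (by
    intro a _ b _ hab; simpa using hab)]
  simp only [hterm]
  rw [← Finset.mul_sum]
  have := Finset.sum_range_sub (fun i : ℕ => ∫ ω, M.bondCurrent ((i : ℤ) - N) ω * f ω ∂M.gibbs)
    (2 * N + 1)
  have e : ∀ i : ℕ, ((i : ℤ) - N + 1) = ((i + 1 : ℕ) : ℤ) - N := fun i => by push_cast; ring
  simp only [e]
  rw [this, integral_mul_bondCurrent hΛ, integral_mul_bondCurrent hΛ, sub_zero, mul_zero]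
  · intro h
    have := hN _ h
    push_cast at this
    omega
  · intro h
    have := hN _ h
    push_cast at this
    omega

lemma liouville_mul (hf : IsC01 f) (hg : IsC01 g) (ω : Config) :
    M.liouville (fun ω => f ω * g ω) ω = f ω * M.liouville g ω + g ω * M.liouville f ω := by
  obtain ⟨Λ₁, h₁⟩ := hf.isLocal
  obtain ⟨Λ₂, h₂⟩ := hg.isLocal
  obtain ⟨Λ₃, h₃⟩ := (hf.mul hg).isLocal
  rw [liouville_eq_sum h₁ (s := Λ₁ ∪ Λ₂ ∪ Λ₃) (by intro x; simp; tauto),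
    liouville_eq_sum h₂ (s := Λ₁ ∪ Λ₂ ∪ Λ₃) (by intro x; simp; tauto),
    liouville_eq_sum h₃ (s := Λ₁ ∪ Λ₂ ∪ Λ₃) (by intro x; simp; tauto), Finset.mul_sum,
        Finset.mul_sum,
    ← Finset.sum_add_distrib]
  refine Finset.sum_congr rfl fun x _ => ?_
  rw [hf.partialR_mul hg, hf.partialP_mul hg]
  ring

lemma liouville_add (hf : IsC01 f) (hg : IsC01 g) (ω : Config) :
    M.liouville (fun ω => f ω + g ω) ω = M.liouville f ω + M.liouville g ω := by
  obtain ⟨Λ₁, h₁⟩ := hf.isLocal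
  obtain ⟨Λ₂, h₂⟩ := hg.isLocal
  obtain ⟨Λ₃, h₃⟩ := (hf.add hg).isLocal
  rw [liouville_eq_sum h₁ (s := Λ₁ ∪ Λ₂ ∪ Λ₃) (by intro x; simp; tauto),
    liouville_eq_sum h₂ (s := Λ₁ ∪ Λ₂ ∪ Λ₃) (by intro x; simp; tauto),
    liouville_eq_sum h₃ (s := Λ₁ ∪ Λ₂ ∪ Λ₃) (by intro x; simp; tauto),
    ← Finset.sum_add_distrib]
  refine Finset.sum_congr rfl fun x _ => ?_
  rw [hf.partialR_add hg, hf.partialP_add hg]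
  ring

lemma liouville_const (c : ℝ) (ω : Config) : M.liouville (fun _ => c) ω = 0 := by
  rw [liouville_eq_sum (Λ := ∅) (s := ∅) (fun _ _ _ => rfl) subset_rfl, Finset.sum_empty]

lemma liouville_shift (f : Config → ℝ) (x : ℤ) (ω : Config) :
    M.liouville f (shift x ω) = M.liouville (fun ω => f (shift x ω)) ω := by
  unfold liouville
  conv_rhs => rw [← finsum_comp_equiv (Equiv.addRight x)]
  refine finsum_congr fun y => ?_
  rw [partialR_shift, partialP_shift]
  simp only [shift, Equiv.coe_addRight]
  rw [show y - 1 + x = y + x - 1 by ring, show y + 1 + x = y + x + 1 by ring]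

lemma liouville_reverse (f : Config → ℝ) (ω : Config) :
    M.liouville (fun ω => f (reverse ω)) ω = -M.liouville f (reverse ω) := by
  unfold liouville
  rw [← finsum_neg_distrib]
  refine finsum_congr fun y => ?_
  rw [partialR_reverse, partialP_reverse]
  simp only [reverse]
  ring

lemma measurable_liouville (hf : IsC01 f) : Measurable (M.liouville f) := by
  obtain ⟨Λ, hΛ⟩ := hf.isLocal
  rw [funext (liouville_eq_sum hΛ subset_rfl)]
  have hV := M.measurable_V'
  refine Finset.measurable_fun_sum _ fun x _ => ?_
  have h1 := hf.measurable_partialR x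
  have h2 := hf.measurable_partialP x
  fun_prop

lemma memLp_liouville (hf : IsC01 f) : MemLp (M.liouville f) 2 M.gibbs := by
  obtain ⟨Λ, hΛ⟩ := hf.isLocal
  rw [funext (liouville_eq_sum hΛ subset_rfl)]
  refine memLp_finsetSum _ fun x _ => ?_
  exact (memLp_mul_bounded ((M.memLp_p x).sub (M.memLp_p (x - 1))) (hf.measurable_partialR x)
    (hf.bounded_partialR x)).add (memLp_mul_bounded ((M.memLp_V' (x + 1)).sub (M.memLp_V' x))
    (hf.measurable_partialP x) (hf.bounded_partialP x))

lemma isLocal_liouville (hf : IsC01 f) : IsLocal (M.liouville f) := by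
  obtain ⟨Λ, hΛ⟩ := hf.isLocal
  refine ⟨Λ ∪ Λ.image (· - 1) ∪ Λ.image (· + 1), fun ω ω' h => ?_⟩
  rw [liouville_eq_sum hΛ subset_rfl, liouville_eq_sum hΛ subset_rfl]
  refine Finset.sum_congr rfl fun x hx => ?_
  have h0 : ∀ y ∈ (Λ : Set ℤ), ω y = ω' y := fun y hy => h y (by simp at hy; simp [hy])
  rw [dependsOn_partialR hΛ x h0, dependsOn_partialP hΛ x h0, h0 x hx, h (x - 1), h (x + 1)]
  · simp [hx]
  · simp [hx]

/-- The image of a function of class `C_0^1` under the Liouville operator. -/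
def liouvilleL2 (hf : IsC01 f) : M.LocalL2 :=
  LocalL2.mk (M.liouville f) (isLocal_liouville hf) (measurable_liouville hf) (memLp_liouville hf)

/-- Invariance applied to the product `f g`, expanded by the Leibniz rule. -/
lemma integral_mul_liouville (hf : IsC01 f) (hg : IsC01 g) :
    ∫ ω, f ω * M.liouville g ω ∂M.gibbs = -∫ ω, M.liouville f ω * g ω ∂M.gibbs := by
  have h := integral_liouville (M := M) (hf.mul hg)
  simp only [liouville_mul hf hg] at h
  rw [integral_add] at h
  · simp only [mul_comm (M.liouville f _)]
    linarith
  · exact MemLp.integrable_mul (memLp_two_bounded hf.measurable hf.bounded) (memLp_liouville hg)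
  · exact MemLp.integrable_mul (memLp_two_bounded hg.measurable hg.bounded) (memLp_liouville hf)

lemma corr_liouville (hf : IsC01 f) (hg : IsC01 g) (x : ℤ) :
    M.corr f (M.liouville g) x = -M.corr (M.liouville f) g x := by
  unfold corr
  simp only [liouville_shift]
  rw [integral_mul_liouville hf (hg.shift x), integral_liouville hf, integral_liouville hg]
  ring

/-- The Liouville operator is antisymmetric for the semi-inner product. -/
theorem semiInner_liouville (hf : IsC01 f) (hg : IsC01 g) :
    M.semiInner f (M.liouville g) = -M.semiInner (M.liouville f) g := by
  unfold semiInner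
  rw [← tsum_neg]
  exact tsum_congr fun x => corr_liouville hf hg x

end Chain

end

/-! ### The velocity-flip noise: symmetry and spectral gap. -/

noncomputable section

open Config

namespace Chain

variable {M : Chain}

lemma measurableEmbedding_flipOn (s : Set ℤ) : MeasurableEmbedding (flipOn s) :=
  (MeasurableEquiv.mk (Equiv.mk _ _ (flipOn_flipOn s) (flipOn_flipOn s))
    (measurable_flipOn _) (measurable_flipOn _)).measurableEmbedding

lemma integral_flipOn (s : Set ℤ) (f : Config → ℝ) :
    ∫ ω, f (flipOn s ω) ∂M.gibbs = ∫ ω, f ω ∂M.gibbs :=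
  (M.measurePreserving_flipOn s).integral_comp (measurableEmbedding_flipOn s) f

@[ext]
lemma LocalL2.ext {f g : M.LocalL2} (h : ∀ ω, f ω = g ω) : f = g :=
  Subtype.ext (funext h)

lemma LocalL2.add_apply (f g : M.LocalL2) (ω : Config) : (f + g : M.LocalL2) ω = f ω + g ω := rfl

lemma LocalL2.sub_apply (f g : M.LocalL2) (ω : Config) : (f - g : M.LocalL2) ω = f ω - g ω := rfl

lemma LocalL2.smul_apply (c : ℝ) (f : M.LocalL2) (ω : Config) : (c • f : M.LocalL2) ω = c * f ω :=
  rfl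

lemma inner_eq_semiInner (f g : M.LocalL2) : inner ℝ f g = M.semiInner f g := rfl

variable (M) in
/-- The shift of local square integrable functions. -/
def shiftL (x : ℤ) : M.LocalL2 →ₗ[ℝ] M.LocalL2 where
  toFun f := LocalL2.mk (fun ω => f (shift x ω))
    (by obtain ⟨Λ, h⟩ := f.isLocal; exact ⟨_, dependsOn_shift h x⟩)
    (f.measurable.comp (measurable_shift x)) (memLp_shift x f.memLp)
  map_add' _ _ := rfl
  map_smul' _ _ := rfl

lemma shiftL_apply (x : ℤ) (f : M.LocalL2) (ω : Config) : shiftL M x f ω = f (shift x ω) := rfl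

variable (M) in
/-- The flip of the momenta of the atoms in `s`, on local square integrable functions. -/
def flipL (s : Set ℤ) : M.LocalL2 →ₗ[ℝ] M.LocalL2 where
  toFun f := LocalL2.mk (fun ω => f (flipOn s ω))
    (by
      obtain ⟨Λ, h⟩ := f.isLocal
      refine ⟨Λ, fun ω ω' hω => h fun i hi => ?_⟩
      by_cases his : i ∈ s
      · rw [flipOn_apply_of_mem his, flipOn_apply_of_mem his, hω i hi]
      · rw [flipOn_apply_of_notMem his, flipOn_apply_of_notMem his, hω i hi])
    (f.measurable.comp (measurable_flipOn s))
    (f.memLp.comp_measurePreserving (M.measurePreserving_flipOn s))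
  map_add' _ _ := rfl
  map_smul' _ _ := rfl

lemma flipL_apply (s : Set ℤ) (f : M.LocalL2) (ω : Config) : flipL M s f ω = f (flipOn s ω) := rfl

/-- The reversal of all the momenta, on local square integrable functions. -/
abbrev reverseL (M : Chain) : M.LocalL2 →ₗ[ℝ] M.LocalL2 := flipL M Set.univ

lemma reverseL_apply (f : M.LocalL2) (ω : Config) : reverseL M f ω = f (reverse ω) := by
  rw [flipL_apply, flipOn_univ]

lemma noise_eq_sum {f : Config → ℝ} {Λ s : Finset ℤ} (hf : DependsOn f (Λ : Set ℤ)) (hs : Λ ⊆ s)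
    (ω : Config) : noise f ω = 1 / 2 * ∑ x ∈ s, (f (flipOn {x} ω) - f ω) := by
  unfold noise
  congr 1
  simp only [flipOn_singleton]
  refine finsum_eq_sum_of_support_subset _ fun x hx => ?_
  by_contra hxs
  apply hx
  simp only
  rw [flipAt, update_of_notMem hf (fun h => hxs (hs h)), sub_self]

lemma noise_eq_sum_flipL {f : M.LocalL2} {Λ s : Finset ℤ} (hf : DependsOn f (Λ : Set ℤ))
    (hs : Λ ⊆ s) : noise f = ((1 / 2 : ℝ) • ∑ x ∈ s, (flipL M {x} f - f) : M.LocalL2) := by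
  have hsum : ∀ (t : Finset ℤ) (ω : Config),
      (∑ x ∈ t, (flipL M {x} f - f) : M.LocalL2) ω = ∑ x ∈ t, (f (flipOn {x} ω) - f ω) := by
    intro t ω
    induction t using Finset.induction_on with
    | empty => rfl
    | insert a t ha ih =>
      rw [Finset.sum_insert ha, Finset.sum_insert ha, LocalL2.add_apply, ih]
      rfl
  funext ω
  rw [noise_eq_sum hf hs, LocalL2.smul_apply, hsum]

lemma noise_mem (f : M.LocalL2) : ∃ g : M.LocalL2, noise f = g := by
  obtain ⟨Λ, hΛ⟩ := f.isLocal
  exact ⟨_, noise_eq_sum_flipL hΛ subset_rfl⟩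

variable (M) in
/-- The velocity-flip noise on local square integrable functions. -/
def noiseL : M.LocalL2 →ₗ[ℝ] M.LocalL2 where
  toFun f := LocalL2.mk (noise f) (by obtain ⟨g, hg⟩ := noise_mem f; rw [hg]; exact g.isLocal)
    (by obtain ⟨g, hg⟩ := noise_mem f; rw [hg]; exact g.measurable)
    (by obtain ⟨g, hg⟩ := noise_mem f; rw [hg]; exact g.memLp)
  map_add' f g := by
    obtain ⟨Λ₁, h₁⟩ := f.isLocal
    obtain ⟨Λ₂, h₂⟩ := g.isLocal
    obtain ⟨Λ₃, h₃⟩ := (f + g).isLocal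
    ext ω
    change noise (f + g : M.LocalL2) ω = noise f ω + noise g ω
    rw [noise_eq_sum h₁ (s := Λ₁ ∪ Λ₂ ∪ Λ₃) (by intro x; simp; tauto),
      noise_eq_sum h₂ (s := Λ₁ ∪ Λ₂ ∪ Λ₃) (by intro x; simp; tauto),
      noise_eq_sum h₃ (s := Λ₁ ∪ Λ₂ ∪ Λ₃) (by intro x; simp; tauto), ← mul_add,
      ← Finset.sum_add_distrib]
    congr 1
    refine Finset.sum_congr rfl fun x _ => ?_
    simp only [LocalL2.add_apply]
    ring
  map_smul' c f := by
    obtain ⟨Λ₁, h₁⟩ := f.isLocal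
    obtain ⟨Λ₃, h₃⟩ := (c • f).isLocal
    ext ω
    change noise (c • f : M.LocalL2) ω = c * noise f ω
    rw [noise_eq_sum h₁ (s := Λ₁ ∪ Λ₃) (by intro x; simp; tauto),
      noise_eq_sum h₃ (s := Λ₁ ∪ Λ₃) (by intro x; simp; tauto), mul_left_comm]
    congr 1
    rw [Finset.mul_sum]
    refine Finset.sum_congr rfl fun x _ => ?_
    simp only [LocalL2.smul_apply]
    ring

lemma noiseL_apply (f : M.LocalL2) (ω : Config) : noiseL M f ω = noise f ω := rfl

lemma noiseL_eq_sum {f : M.LocalL2} {Λ s : Finset ℤ} (hf : DependsOn f (Λ : Set ℤ))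
    (hs : Λ ⊆ s) : noiseL M f = (1 / 2 : ℝ) • ∑ x ∈ s, (flipL M {x} f - f) := by
  ext ω
  rw [noiseL_apply, noise_eq_sum_flipL hf hs]

variable (M) in
/-- The bilinear form `μ(f g)`. -/
def l2Form : M.LocalL2 →ₗ[ℝ] M.LocalL2 →ₗ[ℝ] ℝ :=
  LinearMap.mk₂ ℝ (fun f g => ∫ ω, f ω * g ω ∂M.gibbs)
    (fun f f' g => by
      simp only [LocalL2.add_apply, add_mul]
      exact integral_add (MemLp.integrable_mul f.memLp g.memLp)
        (MemLp.integrable_mul f'.memLp g.memLp))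
    (fun c f g => by
      simp only [LocalL2.smul_apply, mul_assoc, integral_const_mul, smul_eq_mul])
    (fun f g g' => by
      simp only [LocalL2.add_apply, mul_add]
      exact integral_add (MemLp.integrable_mul f.memLp g.memLp)
        (MemLp.integrable_mul f.memLp g'.memLp))
    (fun c f g => by
      simp only [LocalL2.smul_apply, mul_left_comm _ c, integral_const_mul, smul_eq_mul])

lemma l2Form_apply (f g : M.LocalL2) : l2Form M f g = ∫ ω, f ω * g ω ∂M.gibbs := rfl

lemma l2Form_self_nonneg (f : M.LocalL2) : 0 ≤ l2Form M f f :=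
  integral_nonneg fun _ => mul_self_nonneg _

lemma l2Form_flipL_left (s : Set ℤ) (f g : M.LocalL2) :
    l2Form M (flipL M s f) g = l2Form M f (flipL M s g) := by
  simp only [l2Form_apply]
  rw [← integral_flipOn s]
  simp only [flipL_apply, flipOn_flipOn]

lemma flipL_flipL (s : Set ℤ) (f : M.LocalL2) : flipL M s (flipL M s f) = f := by
  ext ω; simp only [flipL_apply, flipOn_flipOn]

lemma flipL_comm (s t : Set ℤ) (f : M.LocalL2) :
    flipL M s (flipL M t f) = flipL M t (flipL M s f) := by
  ext ω; simp only [flipL_apply, flipOn_comm t s]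

lemma flipL_union {s t : Set ℤ} (hd : Disjoint s t) (f : M.LocalL2) :
    flipL M (s ∪ t) f = flipL M s (flipL M t f) := by
  ext ω; simp only [flipL_apply, flipOn_union hd, flipOn_comm t s]

/-- The two flips are commuting symmetric involutions `a`, `b`, so `0 ≤ ‖(1 - b)(1 - a) f‖² = 4 μ(f
(1 - a)(1 - b) f)`. Expanding the product gives `1 - ab ≤ (1 - a) + (1 - b)` as quadratic forms. -/
lemma l2Form_flipL_union_ge {s t : Set ℤ} (hd : Disjoint s t) (f : M.LocalL2) :
    l2Form M f (f - flipL M (s ∪ t) f) ≤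
      l2Form M f (f - flipL M s f) + l2Form M f (f - flipL M t f) := by
  have h := l2Form_self_nonneg (f - flipL M s f - flipL M t (f - flipL M s f))
  rw [flipL_union hd]
  simp only [map_sub, LinearMap.sub_apply, l2Form_flipL_left, flipL_flipL] at h ⊢
  have e1 : flipL M t (flipL M s f) = flipL M s (flipL M t f) := flipL_comm _ _ _
  simp only [e1, flipL_flipL] at h
  linarith

lemma l2Form_flipL_le_sum (s : Finset ℤ) (f : M.LocalL2) :
    l2Form M f (f - flipL M (s : Set ℤ) f) ≤ ∑ x ∈ s, l2Form M f (f - flipL M {x} f) := by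
  induction s using Finset.induction_on with
  | empty =>
    have : flipL M ((∅ : Finset ℤ) : Set ℤ) f = f := by
      ext ω
      rw [flipL_apply]
      congr 1
      funext x
      exact flipOn_apply_of_notMem (by simp) _
    rw [this, sub_self, map_zero, Finset.sum_empty]
  | insert a s ha ih =>
    rw [Finset.sum_insert ha, Finset.coe_insert, Set.insert_eq]
    exact (l2Form_flipL_union_ge (by simpa using ha) f).trans (by linarith)

lemma reverseL_eq_flipL {f : M.LocalL2} {Λ : Finset ℤ} (hf : DependsOn f (Λ : Set ℤ)) :
    reverseL M f = flipL M (Λ : Set ℤ) f := by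
  ext ω
  refine hf fun i hi => ?_
  rw [flipOn_apply_of_mem (Set.mem_univ i), flipOn_apply_of_mem hi]

/-- The spectral gap of the velocity-flip noise in `L²`. -/
lemma l2Form_noiseL_le (f : M.LocalL2) :
    l2Form M f (noiseL M f) ≤ -(1 / 4) * l2Form M (f - reverseL M f) (f - reverseL M f) := by
  obtain ⟨Λ, hΛ⟩ := f.isLocal
  have h1 := l2Form_flipL_le_sum Λ f
  rw [← reverseL_eq_flipL hΛ] at h1
  -- For an involution `J` that is symmetric, `‖(1 - J) f‖² = 2 μ(f (1 - J) f)`. With the factor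
  -- `1/2` in the noise this accounts for the constant `1/4`.
  have h2 : l2Form M (f - reverseL M f) (f - reverseL M f) =
      2 * l2Form M f (f - reverseL M f) := by
    simp only [map_sub, LinearMap.sub_apply, l2Form_flipL_left, flipL_flipL]
    ring
  have h3 : l2Form M f (noiseL M f) = -(1 / 2) * ∑ x ∈ Λ, l2Form M f (f - flipL M {x} f) := by
    rw [noiseL_eq_sum hΛ subset_rfl, map_smul, map_sum, smul_eq_mul, neg_mul, ← mul_neg,
      ← Finset.sum_neg_distrib]
    congr 1
    refine Finset.sum_congr rfl fun x _ => ?_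
    rw [← map_neg, neg_sub]
  rw [h2, h3]
  linarith

lemma l2Form_noiseL_left (f g : M.LocalL2) :
    l2Form M (noiseL M f) g = l2Form M f (noiseL M g) := by
  obtain ⟨Λ₁, h₁⟩ := f.isLocal
  obtain ⟨Λ₂, h₂⟩ := g.isLocal
  rw [noiseL_eq_sum h₁ (Finset.subset_union_left (s₂ := Λ₂)),
    noiseL_eq_sum h₂ (Finset.subset_union_right (s₁ := Λ₁))]
  simp only [map_smul, map_sum, LinearMap.smul_apply, LinearMap.sum_apply, map_sub,
    LinearMap.sub_apply, l2Form_flipL_left]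

lemma l2Form_shiftL (x y : ℤ) (f g : M.LocalL2) :
    l2Form M (shiftL M x f) (shiftL M y g) = l2Form M f (shiftL M (y - x) g) := by
  simp only [l2Form_apply, shiftL_apply]
  have hm : Measurable fun ω => f ω * g (shift (y - x) ω) :=
    f.measurable.mul (g.measurable.comp (measurable_shift (y - x)))
  rw [← integral_shift (M := M) x hm]
  simp only [shift_shift, sub_add_cancel]

lemma noiseL_shiftL (x : ℤ) (f : M.LocalL2) :
    noiseL M (shiftL M x f) = shiftL M x (noiseL M f) := by
  ext ω
  simp only [noiseL_apply, shiftL_apply, noise]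
  congr 1
  conv_lhs => rw [← finsum_comp_equiv (Equiv.addRight x)]
  simp only [Equiv.coe_addRight, shift_flipAt]

lemma flipL_univ_shiftL (x : ℤ) (f : M.LocalL2) :
    reverseL M (shiftL M x f) = shiftL M x (reverseL M f) := by
  ext ω
  simp only [reverseL_apply, shiftL_apply, shift_reverse]

lemma noiseL_reverseL (f : M.LocalL2) : noiseL M (reverseL M f) = reverseL M (noiseL M f) := by
  obtain ⟨Λ₁, h₁⟩ := f.isLocal
  obtain ⟨Λ₂, h₂⟩ := (reverseL M f).isLocal
  rw [noiseL_eq_sum h₁ (Finset.subset_union_left (s₂ := Λ₂)),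
    noiseL_eq_sum h₂ (Finset.subset_union_right (s₁ := Λ₁))]
  simp only [map_smul, map_sum, map_sub, flipL_comm Set.univ]

lemma corr_eq (f g : M.LocalL2) (x : ℤ) : M.corr f g x =
    l2Form M f (shiftL M x g) - (∫ ω, f ω ∂M.gibbs) * ∫ ω, g ω ∂M.gibbs := rfl

lemma integral_flipL (s : Set ℤ) (f : M.LocalL2) :
    ∫ ω, flipL M s f ω ∂M.gibbs = ∫ ω, f ω ∂M.gibbs := integral_flipOn s f

/-- By symmetry, this is the pairing of `f` with the noise applied to the constant `1`, which
vanishes. -/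
lemma integral_noiseL (f : M.LocalL2) : ∫ ω, noiseL M f ω ∂M.gibbs = 0 := by
  have h := l2Form_noiseL_left f
    (LocalL2.mk (fun _ => 1) ⟨∅, fun _ _ _ => rfl⟩ measurable_const (memLp_const 1))
  rw [noiseL_eq_sum (f := LocalL2.mk (fun _ => 1) ⟨∅, fun _ _ _ => rfl⟩ measurable_const
    (memLp_const 1)) (Λ := ∅) (fun _ _ _ => rfl) subset_rfl, Finset.sum_empty, smul_zero,
    map_zero, l2Form_apply] at h
  simpa [LocalL2.mk, LocalL2.fn] using h

/-- The noise is symmetric for the semi-inner product. -/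
lemma semiInner_noiseL (f g : M.LocalL2) :
    M.semiInner f (noiseL M g) = M.semiInner (noiseL M f) g := by
  refine tsum_congr fun x => ?_
  rw [corr_eq, corr_eq, integral_noiseL, integral_noiseL, ← noiseL_shiftL, l2Form_noiseL_left]
  ring

lemma semiInner_reverseL (f g : M.LocalL2) :
    M.semiInner (reverseL M f) g = M.semiInner f (reverseL M g) := by
  refine tsum_congr fun x => ?_
  rw [corr_eq, corr_eq, integral_flipL, integral_flipL, l2Form_flipL_left, flipL_univ_shiftL]

/-- The spectral gap of the velocity-flip noise for the semi-inner product. -/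
theorem semiInner_noiseL_le (f : M.LocalL2) :
    M.semiInner f (noiseL M f) ≤
      -(1 / 4) * M.semiInner (f - reverseL M f : M.LocalL2) (f - reverseL M f : M.LocalL2) := by
  set d := f - reverseL M f with hd
  have hs1 := summable_corr f (noiseL M f)
  have hs2 := summable_corr d d
  obtain ⟨Λ, hΛ⟩ := f.isLocal
  obtain ⟨Λ', hΛ'⟩ := (noiseL M f).isLocal
  obtain ⟨Λ'', hΛ''⟩ := d.isLocal
  have hd0 : ∫ ω, d ω ∂M.gibbs = 0 := by
    have e : ∀ ω, d ω = f ω - reverseL M f ω := fun ω => rfl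
    simp only [e]
    rw [integral_sub (integrable_coe f) (integrable_coe _), integral_flipL, sub_self]
  have key : 0 ≤ ∑' x, (-M.corr f (noiseL M f) x - 1 / 4 * M.corr d d x) := by
    refine tsum_nonneg_of_finset_sums (s := Finset.image₂ (fun a b => a - b) Λ Λ' ∪
      Finset.image₂ (fun a b => a - b) Λ'' Λ'') (fun x hx => ?_) fun n => ?_
    · rw [Finset.mem_union, not_or] at hx
      rw [corr_eq_zero f.measurable (noiseL M f).measurable hΛ hΛ' hx.1,
        corr_eq_zero d.measurable d.measurable hΛ'' hΛ'' hx.2]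
      ring
    -- The `L²` gap is applied to the block sum of `n` translates of `f`. Noise and reversal commute
    -- with shifts, so both sides become double sums of correlations. The centring terms vanish
    -- because `noiseL M f` and `d` have mean zero.
    · set F : M.LocalL2 := ∑ j ∈ Finset.range n, shiftL M (j : ℤ) f with hF
      have e1 : l2Form M F (noiseL M F) = ∑ j ∈ Finset.range n, ∑ k ∈ Finset.range n,
          M.corr f (noiseL M f) ((k : ℤ) - j) := by
        rw [hF, map_sum, map_sum, LinearMap.sum_apply]
        refine Finset.sum_congr rfl fun j _ => ?_
        rw [map_sum]
        refine Finset.sum_congr rfl fun k _ => ?_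
        rw [noiseL_shiftL, l2Form_shiftL, corr_eq, integral_noiseL, mul_zero, sub_zero]
      have e2 : l2Form M (F - reverseL M F) (F - reverseL M F) =
          ∑ j ∈ Finset.range n, ∑ k ∈ Finset.range n, M.corr d d ((k : ℤ) - j) := by
        have : F - reverseL M F = ∑ j ∈ Finset.range n, shiftL M (j : ℤ) d := by
          rw [hF, map_sum, ← Finset.sum_sub_distrib]
          refine Finset.sum_congr rfl fun j _ => ?_
          rw [flipL_univ_shiftL, ← map_sub]
        rw [this, LinearMap.map_sum₂]
        refine Finset.sum_congr rfl fun j _ => ?_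
        rw [map_sum]
        refine Finset.sum_congr rfl fun k _ => ?_
        rw [l2Form_shiftL, corr_eq, hd0, mul_zero, sub_zero]
      have h := l2Form_noiseL_le F
      rw [e1, e2] at h
      simp only [Finset.sum_sub_distrib, Finset.sum_neg_distrib, ← Finset.mul_sum]
      linarith
  rw [(hs1.neg).tsum_sub (hs2.mul_left _), tsum_neg, tsum_mul_left] at key
  unfold semiInner
  linarith

end Chain

end

/-! ### The generator and the reversal on `ℍ`. -/

noncomputable section

open Config

namespace Chain

variable {M : Chain}

/-- The generator on a local function of class `C_0^1`. -/
def generatorL2 {f : M.LocalL2} (hf : IsC01 f) : M.LocalL2 :=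
  liouvilleL2 (M := M) hf + M.γ • noiseL M f

lemma generatorL2_apply {f : M.LocalL2} (hf : IsC01 f) (ω : Config) :
    generatorL2 hf ω = M.generator f ω := rfl

lemma mem_generatorGraph_iff {w : M.H × M.H} : w ∈ M.generatorGraph ↔
    ∃ (f : M.LocalL2) (hf : IsC01 f), w = ((f : M.H), (generatorL2 hf : M.H)) := by
  constructor
  · rintro ⟨f, h, hf, hh, rfl⟩
    refine ⟨f, hf, ?_⟩
    rw [show h = generatorL2 hf from LocalL2.ext hh]
  · rintro ⟨f, hf, rfl⟩
    exact ⟨f, generatorL2 hf, hf, generatorL2_apply hf, rfl⟩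

lemma generatorL2_add {f g : M.LocalL2} (hf : IsC01 f) (hg : IsC01 g)
    (hfg : IsC01 (f + g : M.LocalL2)) :
    generatorL2 hfg = generatorL2 hf + generatorL2 hg := by
  ext ω
  change M.liouville (fun ω => f ω + g ω) ω + M.γ * noiseL M (f + g) ω =
    (M.liouville f ω + M.γ * noiseL M f ω) + (M.liouville g ω + M.γ * noiseL M g ω)
  rw [liouville_add hf hg, map_add, LocalL2.add_apply]
  ring

lemma generatorL2_smul {f : M.LocalL2} (c : ℝ) (hf : IsC01 f)
    (hcf : IsC01 (c • f : M.LocalL2)) : generatorL2 hcf = c • generatorL2 hf := by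
  ext ω
  change M.liouville (fun ω => c * f ω) ω + M.γ * noiseL M (c • f) ω =
    c * (M.liouville f ω + M.γ * noiseL M f ω)
  rw [liouville_mul (IsC01.const c) hf, liouville_const, map_smul, LocalL2.smul_apply]
  ring

variable (M) in
/-- The graph of the generator as a subspace of `ℍ × ℍ`. -/
def generatorSubmodule : Submodule ℝ (M.H × M.H) where
  carrier := M.generatorGraph
  add_mem' := by
    intro w w' hw hw'
    obtain ⟨f, hf, rfl⟩ := mem_generatorGraph_iff.1 hw
    obtain ⟨g, hg, rfl⟩ := mem_generatorGraph_iff.1 hw'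
    have hfg : IsC01 (f + g : M.LocalL2) := IsC01.add hf hg
    refine mem_generatorGraph_iff.2 ⟨f + g, hfg, ?_⟩
    rw [generatorL2_add hf hg hfg, UniformSpace.Completion.coe_add, UniformSpace.Completion.coe_add]
    rfl
  zero_mem' := by
    have h0 : IsC01 (0 : M.LocalL2) := IsC01.const 0
    refine mem_generatorGraph_iff.2 ⟨0, h0, ?_⟩
    have h1 : generatorL2 h0 = 0 := by
      ext ω
      change M.liouville (fun _ => 0) ω + M.γ * noiseL M 0 ω = 0
      rw [liouville_const, map_zero]
      exact (zero_add _).trans (mul_zero _)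
    rw [h1]
    rfl
  smul_mem' := by
    intro c w hw
    obtain ⟨f, hf, rfl⟩ := mem_generatorGraph_iff.1 hw
    have hcf : IsC01 (c • f : M.LocalL2) := (IsC01.const c).mul hf
    refine mem_generatorGraph_iff.2 ⟨c • f, hcf, ?_⟩
    rw [generatorL2_smul c hf hcf, UniformSpace.Completion.coe_smul,
      UniformSpace.Completion.coe_smul]
    rfl

lemma norm_sq_eq_semiInner (f : M.LocalL2) : ‖f‖ ^ 2 = M.semiInner f f :=
  (real_inner_self_eq_norm_sq f).symm

lemma norm_reverseL (f : M.LocalL2) : ‖reverseL M f‖ = ‖f‖ := by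
  rw [← sq_eq_sq₀ (norm_nonneg _) (norm_nonneg _), norm_sq_eq_semiInner, norm_sq_eq_semiInner,
    semiInner_reverseL, flipL_flipL]

variable (M) in
/-- The reversal of the momenta on `ℍ`. -/
def reversal : M.H →L[ℝ] M.H :=
  ((reverseL M).mkContinuous 1 fun f => by rw [norm_reverseL, one_mul]).completion

lemma reversal_coe (f : M.LocalL2) : M.reversal (f : M.H) = (reverseL M f : M.LocalL2) :=
  ContinuousLinearMap.completion_apply_coe _ f

lemma norm_reversal (u : M.H) : ‖M.reversal u‖ = ‖u‖ := by
  induction u using UniformSpace.Completion.induction_on with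
  | hp => exact isClosed_eq (by fun_prop) (by fun_prop)
  | ih f => rw [reversal_coe, UniformSpace.Completion.norm_coe, UniformSpace.Completion.norm_coe,
      norm_reverseL]

lemma inner_reversal (u v : M.H) : inner ℝ (M.reversal u) v = inner ℝ u (M.reversal v) := by
  induction u, v using UniformSpace.Completion.induction_on₂ with
  | hp => exact isClosed_eq (by fun_prop) (by fun_prop)
  | ih f g =>
    rw [reversal_coe, reversal_coe, UniformSpace.Completion.inner_coe,
      UniformSpace.Completion.inner_coe]
    exact semiInner_reverseL f g

lemma reversal_of_mem_antisymm {u : M.H} (hu : u ∈ M.antisymm) : M.reversal u = -u := by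
  have hc : IsClosed {u : M.H | M.reversal u = -u} := isClosed_eq (by fun_prop) (by fun_prop)
  refine closure_minimal ?_ hc hu
  rintro _ ⟨f, hf, rfl⟩
  change M.reversal (f : M.H) = -(f : M.H)
  have : reverseL M f = -f := by
    ext ω
    rw [reverseL_apply, hf]
    rfl
  rw [reversal_coe, this, UniformSpace.Completion.coe_neg]

/-- `A` is antisymmetric and anticommutes with the reversal, and the two signs cancel. The noise is
symmetric and commutes with it. -/
lemma semiInner_generatorL2 {f g : M.LocalL2} (hf : IsC01 f) (hg : IsC01 g) :
    M.semiInner (reverseL M f) (generatorL2 hg) = M.semiInner (reverseL M (generatorL2 hf)) g := by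
  have hrf : IsC01 (reverseL M f) := by
    rw [show (reverseL M f).fn = fun ω => f (reverse ω) from funext (reverseL_apply f)]
    exact hf.reverse
  have h1 : M.semiInner (reverseL M f) (liouvilleL2 (M := M) hg) =
      M.semiInner (reverseL M (liouvilleL2 hf)) g := by
    have e : reverseL M (liouvilleL2 (M := M) hf) = -liouvilleL2 (M := M) hrf := by
      ext ω
      rw [reverseL_apply]
      change M.liouville f (reverse ω) = -M.liouville (reverseL M f) ω
      rw [show (reverseL M f).fn = fun ω => f (reverse ω) from funext (reverseL_apply f),
        liouville_reverse, neg_neg]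
    rw [e, ← inner_eq_semiInner (-liouvilleL2 (M := M) hrf), inner_neg_left]
    exact semiInner_liouville hrf hg
  have h2 : M.semiInner (reverseL M f) (noiseL M g) = M.semiInner (reverseL M (noiseL M f)) g := by
    rw [semiInner_noiseL, noiseL_reverseL]
  simp only [← inner_eq_semiInner] at h1 h2 ⊢
  unfold generatorL2
  rw [map_add, map_smul, inner_add_left, inner_add_right, inner_smul_left, inner_smul_right,
    h1, h2, conj_trivial]

/-- The antisymmetric part contributes nothing to the diagonal, so the gap is that of `γ` times the
noise. -/
lemma semiInner_self_generatorL2_le {f : M.LocalL2} (hf : IsC01 f) :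
    M.semiInner f (generatorL2 hf) ≤ -(M.γ / 4) * ‖f - reverseL M f‖ ^ 2 := by
  have h1 : M.semiInner f (liouvilleL2 (M := M) hf) = 0 := by
    have h := semiInner_liouville (M := M) hf hf
    have h' := semiInner_symm f (liouvilleL2 (M := M) hf)
    change M.semiInner (M.liouville f) f = M.semiInner f (M.liouville f) at h'
    change M.semiInner f (M.liouville f) = 0
    linarith
  have h2 := semiInner_noiseL_le f
  rw [← norm_sq_eq_semiInner] at h2
  simp only [← inner_eq_semiInner] at h1 h2 ⊢
  unfold generatorL2
  rw [inner_add_right, inner_smul_right, h1]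
  have := mul_le_mul_of_nonneg_left h2 M.γ_pos.le
  linarith

lemma generatorSubmodule_reversal : ∀ w ∈ M.generatorSubmodule, ∀ w' ∈ M.generatorSubmodule,
    inner ℝ (M.reversal w.1) w'.2 = inner ℝ (M.reversal w.2) w'.1 := by
  intro w hw w' hw'
  obtain ⟨f, hf, rfl⟩ := mem_generatorGraph_iff.1 hw
  obtain ⟨g, hg, rfl⟩ := mem_generatorGraph_iff.1 hw'
  simp only [reversal_coe, UniformSpace.Completion.inner_coe]
  exact semiInner_generatorL2 hf hg

lemma generatorSubmodule_gap : ∀ w ∈ M.generatorSubmodule,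
    inner ℝ w.1 w.2 ≤ -(M.γ / 4) * ‖w.1 - M.reversal w.1‖ ^ 2 := by
  intro w hw
  obtain ⟨f, hf, rfl⟩ := mem_generatorGraph_iff.1 hw
  simp only [reversal_coe, UniformSpace.Completion.inner_coe,
    ← UniformSpace.Completion.coe_sub, UniformSpace.Completion.norm_coe]
  exact semiInner_self_generatorL2_le hf

end Chain

end

/-! ### Functions with controlled second differences, and resolvents of jump processes. -/

noncomputable section

section Tame

variable {E : Type*} [NormedAddCommGroup E] [NormedSpace ℝ E]

/-- Continuously differentiable functions which are bounded by `a`, with differences bounded by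
`ℓ p(v)` and second differences bounded by `m p(v) p(w)`, for a seminorm `p`. -/
structure IsTame (p : Seminorm ℝ E) (a l m : ℝ) (u : E → ℝ) : Prop where
  contDiff : ContDiff ℝ 1 u
  bound : ∀ y, |u y| ≤ a
  lip : ∀ y v, |u (y + v) - u y| ≤ l * p v
  lip₂ : ∀ y v w, |u (y + v + w) - u (y + v) - u (y + w) + u y| ≤ m * p v * p w

namespace IsTame

variable {p : Seminorm ℝ E} {a l m a' l' m' : ℝ} {u u' : E → ℝ}

lemma differentiable (h : IsTame p a l m u) : Differentiable ℝ u :=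
  h.contDiff.differentiable (by norm_num)

lemma add (h : IsTame p a l m u) (h' : IsTame p a' l' m' u') :
    IsTame p (a + a') (l + l') (m + m') fun y => u y + u' y where
  contDiff := h.contDiff.add h'.contDiff
  bound y := (abs_add_le _ _).trans (add_le_add (h.bound y) (h'.bound y))
  lip y v := by
    have e : u (y + v) + u' (y + v) - (u y + u' y) = (u (y + v) - u y) + (u' (y + v) - u' y) := by
      ring
    rw [e, add_mul]
    exact (abs_add_le _ _).trans (add_le_add (h.lip y v) (h'.lip y v))
  lip₂ y v w := by
    have e : u (y + v + w) + u' (y + v + w) - (u (y + v) + u' (y + v)) -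
        (u (y + w) + u' (y + w)) + (u y + u' y) =
        (u (y + v + w) - u (y + v) - u (y + w) + u y) +
        (u' (y + v + w) - u' (y + v) - u' (y + w) + u' y) := by ring
    rw [e, add_mul, add_mul]
    exact (abs_add_le _ _).trans (add_le_add (h.lip₂ y v w) (h'.lip₂ y v w))

lemma const_mul (h : IsTame p a l m u) {c : ℝ} (hc : 0 ≤ c) :
    IsTame p (c * a) (c * l) (c * m) fun y => c * u y where
  contDiff := contDiff_const.mul h.contDiff
  bound y := by
    rw [abs_mul, abs_of_nonneg hc]
    exact mul_le_mul_of_nonneg_left (h.bound y) hc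
  lip y v := by
    rw [← mul_sub, abs_mul, abs_of_nonneg hc, mul_assoc]
    exact mul_le_mul_of_nonneg_left (h.lip y v) hc
  lip₂ y v w := by
    rw [← mul_sub, ← mul_sub, ← mul_add, abs_mul, abs_of_nonneg hc, mul_assoc, mul_assoc,
      ← mul_assoc m]
    exact mul_le_mul_of_nonneg_left (h.lip₂ y v w) hc

lemma zero : IsTame p 0 0 0 fun _ : E => (0 : ℝ) :=
  ⟨contDiff_const, by simp, by simp, by simp⟩

lemma sum {ι : Type*} (s : Finset ι) {u : ι → E → ℝ} (h : ∀ i ∈ s, IsTame p a l m (u i)) :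
    IsTame p (s.card * a) (s.card * l) (s.card * m) fun y => ∑ i ∈ s, u i y := by
  classical
  induction s using Finset.induction_on with
  | empty => simpa using zero
  | insert i s hi ih =>
    have h1 := (h i (Finset.mem_insert_self _ _)).add
      (ih fun j hj => h j (Finset.mem_insert_of_mem hj))
    simp only [Finset.sum_insert hi, Finset.card_insert_of_notMem hi]
    push_cast
    simp only [add_mul, one_mul, add_comm _ a, add_comm _ l, add_comm _ m]
    exact h1

lemma mono (h : IsTame p a l m u) (ha : a ≤ a') (hl : l ≤ l') (hm : m ≤ m') :
    IsTame p a' l' m' u where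
  contDiff := h.contDiff
  bound y := (h.bound y).trans ha
  lip y v := (h.lip y v).trans (mul_le_mul_of_nonneg_right hl (apply_nonneg p v))
  lip₂ y v w := (h.lip₂ y v w).trans (by
    have := apply_nonneg p v
    have := apply_nonneg p w
    gcongr)

/-- Write `ψ (y + v + w) = ψ y + A + B + R`, where `A`, `B` are the first increments and `R` is the
second difference of `ψ`. The increments cost `m K²` and the remainder costs `l κ`. -/
lemma comp (h : IsTame p a l m u) (hl : 0 ≤ l) (hm : 0 ≤ m) {ψ : E → E} {K κ : ℝ} (hK : 0 ≤ K)
    (hψ : ContDiff ℝ 1 ψ) (hψ₁ : ∀ y v, p (ψ (y + v) - ψ y) ≤ K * p v)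
    (hψ₂ : ∀ y v w, p (ψ (y + v + w) - ψ (y + v) - ψ (y + w) + ψ y) ≤ κ * p v * p w) :
    IsTame p a (l * K) (m * K ^ 2 + l * κ) fun y => u (ψ y) where
  contDiff := h.contDiff.comp hψ
  bound y := h.bound _
  lip y v := by
    have h1 := h.lip (ψ y) (ψ (y + v) - ψ y)
    rw [add_sub_cancel] at h1
    refine h1.trans ?_
    rw [mul_assoc]
    exact mul_le_mul_of_nonneg_left (hψ₁ y v) hl
  lip₂ y v w := by
    set A := ψ (y + v) - ψ y with hA
    set B := ψ (y + w) - ψ y with hB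
    set R := ψ (y + v + w) - ψ (y + v) - ψ (y + w) + ψ y with hR
    have e1 : ψ (y + v) = ψ y + A := by rw [hA]; abel
    have e2 : ψ (y + w) = ψ y + B := by rw [hB]; abel
    have e3 : ψ (y + v + w) = ψ y + A + B + R := by rw [hA, hB, hR]; abel
    have h1 := h.lip₂ (ψ y) A B
    have h2 := h.lip (ψ y + A + B) R
    have hpv := apply_nonneg p v
    have hpw := apply_nonneg p w
    have h3 : m * p A * p B ≤ m * (K * p v) * (K * p w) := by
      have := hψ₁ y v
      have := hψ₁ y w
      have := apply_nonneg p A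
      have := apply_nonneg p B
      gcongr
    have h4 : l * p R ≤ l * (κ * p v * p w) := mul_le_mul_of_nonneg_left (hψ₂ y v w) hl
    rw [e1, e2, e3]
    have e : u (ψ y + A + B + R) - u (ψ y + A) - u (ψ y + B) + u (ψ y) =
      (u (ψ y + A + B + R) - u (ψ y + A + B)) +
        (u (ψ y + A + B) - u (ψ y + A) - u (ψ y + B) + u (ψ y)) := by ring
    rw [e]
    refine (abs_add_le _ _).trans ?_
    calc _ ≤ l * (κ * p v * p w) + m * (K * p v) * (K * p w) :=
          add_le_add (h2.trans h4) (h1.trans h3)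
      _ = _ := by ring

lemma abs_fderiv_le (h : IsTame p a l m u) (y v : E) : |fderiv ℝ u y v| ≤ l * p v := by
  have h1 : HasDerivAt (fun t : ℝ => u (y + t • v)) (fderiv ℝ u y v) 0 := by
    have h2 : HasDerivAt (fun t : ℝ => y + t • v) v 0 := by
      simpa using ((hasDerivAt_id (0 : ℝ)).smul_const v).const_add y
    have h3 : HasFDerivAt u (fderiv ℝ u y) (y + (0 : ℝ) • v) := by
      simpa using (h.differentiable y).hasFDerivAt
    exact h3.comp_hasDerivAt 0 h2
  have h0 : 0 ≤ l * p v := (abs_nonneg _).trans (h.lip y v)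
  have h2 := h1.le_of_lip' h0 (Eventually.of_forall fun t => by
    have := h.lip y (t • v)
    simp only [zero_smul, add_zero, sub_zero]
    rw [map_smul_eq_mul] at this
    calc _ ≤ l * (‖t‖ * p v) := this
      _ = _ := by ring)
  exact h2

lemma abs_fderiv_sub_le (h : IsTame p a l m u) (y v w : E) :
    |fderiv ℝ u (y + v) w - fderiv ℝ u y w| ≤ m * p v * p w := by
  have hd : ∀ y, HasDerivAt (fun t : ℝ => u (y + t • w)) (fderiv ℝ u y w) 0 := by
    intro y
    have h2 : HasDerivAt (fun t : ℝ => y + t • w) w 0 := by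
      simpa using ((hasDerivAt_id (0 : ℝ)).smul_const w).const_add y
    have h3 : HasFDerivAt u (fderiv ℝ u y) (y + (0 : ℝ) • w) := by
      simpa using (h.differentiable y).hasFDerivAt
    exact h3.comp_hasDerivAt 0 h2
  have h0 : 0 ≤ m * p v * p w := (abs_nonneg _).trans (h.lip₂ y v w)
  have h2 := ((hd (y + v)).sub (hd y)).le_of_lip' h0 (Eventually.of_forall fun t => by
    have := h.lip₂ y v (t • w)
    simp only [zero_smul, add_zero, sub_zero, Pi.sub_apply]
    rw [map_smul_eq_mul] at this
    calc _ = |u (y + v + t • w) - u (y + v) - u (y + t • w) + u y| := by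
          rw [Real.norm_eq_abs]; congr 1; ring
      _ ≤ m * p v * (‖t‖ * p w) := this
      _ = _ := by ring)
  exact h2

/-- A first order Taylor bound. The second difference estimate makes the directional derivative
Lipschitz, so no second derivative of `u` is needed. -/
lemma abs_slope_sub_fderiv_le (h : IsTame p a l m u) (hm : 0 ≤ m) {ε : ℝ} (hε : 0 < ε) (y b : E) :
    |ε⁻¹ * (u (y + ε • b) - u y) - fderiv ℝ u y b| ≤ ε * (m * p b ^ 2) := by
  have hd : ∀ t : ℝ, HasDerivAt (fun t : ℝ => u (y + t • b) - t * fderiv ℝ u y b)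
      (fderiv ℝ u (y + t • b) b - fderiv ℝ u y b) t := by
    intro t
    have h2 : HasDerivAt (fun t : ℝ => y + t • b) b t := by
      simpa using ((hasDerivAt_id t).smul_const b).const_add y
    have h3 := (h.differentiable (y + t • b)).hasFDerivAt.comp_hasDerivAt t h2
    have h4 := (hasDerivAt_id t).mul_const (fderiv ℝ u y b)
    rw [one_mul] at h4
    exact h3.sub h4
  have h1 := norm_image_sub_le_of_norm_deriv_le_segment' (a := 0) (b := ε)
    (f := fun t : ℝ => u (y + t • b) - t * fderiv ℝ u y b) (C := ε * (m * p b ^ 2))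
    (fun t _ => (hd t).hasDerivWithinAt) (fun t ht => by
      refine (h.abs_fderiv_sub_le y (t • b) b).trans ?_
      rw [map_smul_eq_mul, Real.norm_of_nonneg ht.1]
      calc m * (t * p b) * p b = t * (m * p b ^ 2) := by ring
        _ ≤ _ := by gcongr; exact ht.2.le) ε ⟨hε.le, le_rfl⟩
  simp only [zero_smul, add_zero, zero_mul, sub_zero, Real.norm_eq_abs] at h1
  have e : ε⁻¹ * (u (y + ε • b) - u y) - fderiv ℝ u y b =
      ε⁻¹ * (u (y + ε • b) - ε * fderiv ℝ u y b - u y) := by field_simp; ring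
  rw [e, abs_mul, abs_of_pos (inv_pos.2 hε), inv_mul_le_iff₀ hε]
  linarith

/-- Approximate solutions of the resolvent equation of a jump process. -/
theorem exists_approx_resolvent {g : E → ℝ} (hg : IsTame p a l m g) (ha : 0 ≤ a) (hl : 0 ≤ l)
    (hm : 0 ≤ m) {C κ z ε c : ℝ} (hC : 0 ≤ C) (hκ : 0 ≤ κ) (hε : 0 < ε) (hε₁ : ε ≤ 1) (hc : 0 ≤ c)
    (hz : 2 * C + C ^ 2 + 1 ≤ z) {ψ : E → E} (hψ : ContDiff ℝ 1 ψ)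
    (hψ₁ : ∀ y v, p (ψ (y + v) - ψ y) ≤ (1 + ε * C) * p v)
    (hψ₂ : ∀ y v w, p (ψ (y + v + w) - ψ (y + v) - ψ (y + w) + ψ y) ≤ ε * κ * p v * p w)
    {ι : Type*} (s : Finset ι) (φ : ι → E →L[ℝ] E) (hφ : ∀ i v, p (φ i v) ≤ p v) {η : ℝ}
    (hη : 0 < η) :
    ∃ u : E → ℝ, IsTame p a l (m + l * κ) u ∧ ∀ y, |z * u y - ε⁻¹ * (u (ψ y) - u y) -
      c * ∑ i ∈ s, (u (φ i y) - u y) - g y| ≤ η := by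
  have hz0 : 0 < z := by nlinarith [sq_nonneg C]
  set q := ε⁻¹ + c * s.card with hq
  have hq0 : 0 < q := by positivity
  have hD : 0 < z + q := by linarith
  -- The fixed points of `T` are the solutions of `z u - ε⁻¹ (u ∘ ψ - u) - c ∑ (u ∘ φ_i - u) = g`;
  -- `q` is the total jump rate.
  set T : (E → ℝ) → E → ℝ := fun u y =>
    (z + q)⁻¹ * (g y + (ε⁻¹ * u (ψ y) + c * ∑ i ∈ s, u (φ i y))) with hT
  -- The constants are chosen to be stable under `T`. Stability of `l` needs `1 + C ≤ z`. For `m + l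
  -- κ`, the source contributes `m`, the curvature of `ψ` contributes `l κ`, and its expansion
  -- contributes `(m + l κ) (2 C + ε C²)`. The total stays below `z (m + l κ)` because `2 C + C² + 1
  -- ≤ z`, a threshold that does not involve `κ`.
  have hTtame : ∀ u, IsTame p a l (m + l * κ) u → IsTame p a l (m + l * κ) (T u) := by
    intro u hu
    have hm' : 0 ≤ m + l * κ := by positivity
    have h1 := (hu.comp hl hm' (K := 1 + ε * C) (by positivity) hψ hψ₁ hψ₂).const_mul
      (inv_pos.2 hε).le
    have h2 : ∀ i ∈ s, IsTame p a l (m + l * κ) fun y => u (φ i y) := fun i _ => by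
      have := hu.comp hl hm' (ψ := φ i) (K := 1) (κ := 0) zero_le_one (φ i).contDiff
        (fun y v => by rw [← map_sub, add_sub_cancel_left, one_mul]; exact hφ i v)
        (fun y v w => by
          rw [← map_sub, ← map_sub, ← map_add,
            show y + v + w - (y + v) - (y + w) + y = 0 by abel, map_zero, map_zero, zero_mul,
            zero_mul])
      simpa using this
    have h3 := (hg.add (h1.add ((sum s h2).const_mul hc))).const_mul (inv_pos.2 hD).le
    refine h3.mono ?_ ?_ ?_
    · rw [inv_mul_le_iff₀ hD, hq]
      have : a ≤ z * a := le_mul_of_one_le_left ha (by nlinarith [sq_nonneg C])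
      linarith
    · rw [inv_mul_le_iff₀ hD, hq]
      have e : ε⁻¹ * (l * (1 + ε * C)) = ε⁻¹ * l + l * C := by field_simp
      have : l * (1 + C) ≤ l * z := by gcongr; nlinarith [sq_nonneg C]
      rw [e]
      linarith
    · rw [inv_mul_le_iff₀ hD, hq]
      have e : ε⁻¹ * ((m + l * κ) * (1 + ε * C) ^ 2 + l * (ε * κ)) =
          ε⁻¹ * (m + l * κ) + (m + l * κ) * (2 * C + ε * C ^ 2) + l * κ := by field_simp; ring
      have h5 : (m + l * κ) * (2 * C + ε * C ^ 2 + 1) ≤ (m + l * κ) * z := by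
        gcongr
        nlinarith [sq_nonneg C]
      rw [e]
      linarith
  have hTcontr : ∀ u u' : E → ℝ, ∀ d, (∀ y, |u y - u' y| ≤ d) →
      ∀ y, |T u y - T u' y| ≤ q / (z + q) * d := by
    intro u u' d hd y
    have e : T u y - T u' y = (z + q)⁻¹ * (ε⁻¹ * (u (ψ y) - u' (ψ y)) +
        c * ∑ i ∈ s, (u (φ i y) - u' (φ i y))) := by
      simp only [hT, Finset.sum_sub_distrib]; ring
    rw [e, abs_mul, abs_of_pos (inv_pos.2 hD), div_mul_eq_mul_div, ← div_eq_inv_mul]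
    gcongr
    refine (abs_add_le _ _).trans ?_
    rw [abs_mul, abs_mul, abs_of_pos (inv_pos.2 hε), abs_of_nonneg hc, hq, add_mul]
    have h1 : |∑ i ∈ s, (u (φ i y) - u' (φ i y))| ≤ s.card * d := by
      refine (Finset.abs_sum_le_sum_abs _ _).trans ?_
      rw [← nsmul_eq_mul]
      exact Finset.sum_le_card_nsmul _ _ _ fun i _ => hd _
    have h2 := hd (ψ y)
    rw [mul_assoc]
    gcongr
  have hiter : ∀ k, IsTame p a l (m + l * κ) (T^[k] fun _ => 0) := by
    intro k
    induction k with
    | zero => exact zero.mono ha hl (by positivity)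
    | succ k ih => rw [Function.iterate_succ_apply']; exact hTtame _ ih
  have hdiff : ∀ k y, |(T^[k + 1] fun _ => 0) y - (T^[k] fun _ => 0) y| ≤
      (q / (z + q)) ^ k * a := by
    intro k
    induction k with
    | zero =>
      intro y
      have := (hiter 1).bound y
      simpa using this
    | succ k ih =>
      intro y
      rw [Function.iterate_succ_apply', Function.iterate_succ_apply' T k, pow_succ, mul_comm _
          (q / _),
        mul_assoc]
      have := hTcontr _ _ _ ih y
      rwa [Function.iterate_succ_apply'] at this
  have hlim : Tendsto (fun k : ℕ => (z + q) * ((q / (z + q)) ^ k * a)) atTop (𝓝 0) := by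
    have := ((tendsto_pow_atTop_nhds_zero_of_lt_one (by positivity)
      ((div_lt_one hD).2 (by linarith : q < z + q))).mul_const a).const_mul (z + q)
    simpa using this
  -- A finite iterate is kept instead of the fixed point, since a uniform limit of `C¹` functions
  -- need not be `C¹`. The residual of `u` is `-(z + q) (T u - u)`, which is geometrically small.
  obtain ⟨k, hk⟩ := (hlim.eventually (gt_mem_nhds hη)).exists
  refine ⟨_, hiter k, fun y => ?_⟩
  have h1 := hdiff k y
  rw [Function.iterate_succ_apply'] at h1
  set u := T^[k] fun _ => 0
  have e : z * u y - ε⁻¹ * (u (ψ y) - u y) - c * ∑ i ∈ s, (u (φ i y) - u y) - g y =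
      -((z + q) * (T u y - u y)) := by
    have h2 : (z + q) * T u y = g y + (ε⁻¹ * u (ψ y) + c * ∑ i ∈ s, u (φ i y)) := by
      simp only [hT]; rw [mul_inv_cancel_left₀ hD.ne']
    rw [mul_sub (z + q), h2, Finset.sum_sub_distrib, Finset.sum_const, nsmul_eq_mul, hq]
    ring
  rw [e, abs_neg, abs_mul, abs_of_pos hD]
  exact (mul_le_mul_of_nonneg_left h1 hD.le).trans hk.le

end IsTame

end Tame

end

/-! ### Regularised forces and the drift of a finite box in a weighted norm. -/

noncomputable section

open Config

/-- `W` is a continuously differentiable approximation of `U` at precision `δ`, with Lipschitz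
constant `B` and second differences controlled by `Q`. -/
structure IsRegularization (U : ℝ → ℝ) (B δ Q : ℝ) (W : ℝ → ℝ) : Prop where
  contDiff : ContDiff ℝ 1 W
  close : ∀ r, |W r - U r| ≤ δ
  lip : ∀ r s, |W (r + s) - W r| ≤ B * |s|
  lip₂ : ∀ r s t, |W (r + s + t) - W (r + s) - W (r + t) + W r| ≤ Q * |s| * |t|

lemma abs_add_sub_le_of_hasDerivAt {u u' : ℝ → ℝ} {c : ℝ} (hu : ∀ r, HasDerivAt u (u' r) r)
    (hc : ∀ r, |u' r| ≤ c) (r s : ℝ) : |u (r + s) - u r| ≤ c * |s| := by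
  have h := Convex.norm_image_sub_le_of_norm_hasDerivWithin_le (f := u) (s := Set.univ) (C := c)
    (x := r) (y := r + s) (fun x _ => (hu x).hasDerivWithinAt) (fun x _ => hc x) convex_univ
    trivial trivial
  simpa using h

namespace Chain

variable (M : Chain)

lemma exists_lipschitz_V' : ∃ B, 0 ≤ B ∧ ∀ r s, |M.V' (r + s) - M.V' r| ≤ B * |s| := by
  obtain ⟨B, hB⟩ := M.bounded_V''
  exact ⟨B, (abs_nonneg _).trans (hB 0), abs_add_sub_le_of_hasDerivAt
    (fun r => (M.contDiff_V'.differentiable (by norm_num) r).hasDerivAt) hB⟩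

/-- The difference quotient of `V` at scale `h` is within `B h` of `V'` and keeps its Lipschitz
constant `B`. Its own derivative is Lipschitz, with constant `2 B / h`, which `V'` need not offer
since `V` is only `C²`. The price is that `Q` depends on the precision. -/
lemma exists_regularization {B : ℝ} (hB0 : 0 ≤ B) (hB : ∀ r s, |M.V' (r + s) - M.V' r| ≤ B * |s|)
    {δ : ℝ} (hδ : 0 < δ) : ∃ Q W, 0 ≤ Q ∧ IsRegularization M.V' B δ Q W := by
  set h := δ / (B + 1) with hh
  have hh0 : 0 < h := by positivity
  have hBh : B * h ≤ δ := by
    rw [hh, mul_div_assoc', div_le_iff₀ (by positivity)]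
    nlinarith
  set W : ℝ → ℝ := fun r => h⁻¹ * (M.V (r + h) - M.V r) with hW
  have hWd : ∀ r, HasDerivAt W (h⁻¹ * (M.V' (r + h) - M.V' r)) r := fun r =>
    (((M.hasFDerivAt_V (r + h)).comp_add_const r h).sub (M.hasFDerivAt_V r)).const_mul _
  refine ⟨h⁻¹ * (2 * B), W, by positivity, ?_, fun r => ?_, ?_, fun r s t => ?_⟩
  · have := M.contDiff_V.of_le (show (1 : WithTop ℕ∞) ≤ 2 by norm_num)
    exact contDiff_const.mul ((this.comp (contDiff_id.add contDiff_const)).sub this)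
  · have h1 := norm_image_sub_le_of_norm_deriv_le_segment' (a := 0) (b := h)
      (f := fun t : ℝ => M.V (r + t) - t * M.V' r) (C := δ)
      (f' := fun t => M.V' (r + t) - M.V' r)
      (fun t _ => by
        have := ((M.hasFDerivAt_V (r + t)).comp_const_add r t).sub
          ((hasDerivAt_id t).mul_const (M.V' r))
        rw [one_mul] at this
        exact this.hasDerivWithinAt) (fun t ht => by
        refine (hB r t).trans (le_trans ?_ hBh)
        rw [abs_of_nonneg ht.1]
        exact mul_le_mul_of_nonneg_left ht.2.le hB0) h ⟨hh0.le, le_rfl⟩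
    simp only [add_zero, zero_mul, sub_zero, Real.norm_eq_abs] at h1
    have e : W r - M.V' r = h⁻¹ * (M.V (r + h) - h * M.V' r - M.V r) := by
      simp only [hW]; field_simp; ring
    rw [e, abs_mul, abs_of_pos (inv_pos.2 hh0), inv_mul_le_iff₀ hh0]
    linarith
  · refine abs_add_sub_le_of_hasDerivAt hWd fun r => ?_
    rw [abs_mul, abs_of_pos (inv_pos.2 hh0), inv_mul_le_iff₀ hh0]
    have := hB r h
    rw [abs_of_pos hh0] at this
    linarith
  · have h1 := abs_add_sub_le_of_hasDerivAt (u := fun r => W (r + s) - W r)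
      (fun r => ((hWd (r + s)).comp_add_const r s).sub (hWd r)) (c := h⁻¹ * (2 * B) * |s|)
      (fun r => by
        have e : h⁻¹ * (M.V' (r + s + h) - M.V' (r + s)) - h⁻¹ * (M.V' (r + h) - M.V' r) =
          h⁻¹ * ((M.V' (r + h + s) - M.V' (r + h)) - (M.V' (r + s) - M.V' r)) := by
          rw [add_right_comm r h s]; ring
        rw [e, abs_mul, abs_of_pos (inv_pos.2 hh0), mul_assoc]
        refine mul_le_mul_of_nonneg_left ?_ (inv_pos.2 hh0).le
        refine (abs_sub _ _).trans ?_
        linarith [hB (r + h) s, hB r s]) r t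
    have e : W (r + s + t) - W (r + s) - W (r + t) + W r =
        W (r + t + s) - W (r + t) - (W (r + s) - W r) := by
      rw [add_right_comm r s t]; ring
    rw [e]
    exact h1

end Chain

namespace Config

/-- The weight `2 ^ |x|`. -/
def weight (x : ℤ) : ℝ := 2 ^ x.natAbs

lemma one_le_weight (x : ℤ) : 1 ≤ weight x := one_le_pow₀ (by norm_num)

lemma weight_pos (x : ℤ) : 0 < weight x := by unfold weight; positivity

lemma weight_add_one_le (x : ℤ) : weight (x + 1) ≤ 2 * weight x := by
  unfold weight
  rw [← pow_succ']
  exact pow_le_pow_right₀ (by norm_num) (by omega)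

lemma weight_sub_one_le (x : ℤ) : weight (x - 1) ≤ 2 * weight x := by
  unfold weight
  rw [← pow_succ']
  exact pow_le_pow_right₀ (by norm_num) (by omega)

variable (Λ : Finset ℤ)

/-- The norm `sup_x 2^{-|x|} |v_x|` on the configurations on `Λ`. -/
def weightedNorm : Seminorm ℝ (Λ → ℝ × ℝ) :=
  (normSeminorm ℝ (Λ → ℝ × ℝ)).comp
    (LinearMap.pi fun x : Λ => (weight x)⁻¹ • LinearMap.proj (R := ℝ) x)

variable {Λ}

lemma weightedNorm_le_iff {v : Λ → ℝ × ℝ} {c : ℝ} (hc : 0 ≤ c) :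
    weightedNorm Λ v ≤ c ↔ ∀ x : Λ, ‖v x‖ ≤ c * weight x := by
  change ‖fun x : Λ => (weight x)⁻¹ • v x‖ ≤ c ↔ _
  rw [pi_norm_le_iff_of_nonneg hc]
  refine forall_congr' fun x => ?_
  have := weight_pos x
  rw [norm_smul, norm_inv, Real.norm_of_nonneg this.le, inv_mul_le_iff₀ this, mul_comm]

lemma norm_apply_le (v : Λ → ℝ × ℝ) (x : Λ) : ‖v x‖ ≤ weightedNorm Λ v * weight x :=
  (weightedNorm_le_iff (apply_nonneg _ _)).1 le_rfl x

lemma weightedNorm_le_norm (v : Λ → ℝ × ℝ) : weightedNorm Λ v ≤ ‖v‖ :=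
  (weightedNorm_le_iff (norm_nonneg _)).2 fun x =>
    (norm_le_pi_norm v x).trans (le_mul_of_one_le_right (norm_nonneg _) (one_le_weight x))

variable (Λ) in
/-- The coordinate at `x` of the extension by zero. -/
def coord (x : ℤ) : (Λ → ℝ × ℝ) →L[ℝ] ℝ × ℝ :=
  if h : x ∈ Λ then ContinuousLinearMap.proj ⟨x, h⟩ else 0

lemma coord_of_mem {x : ℤ} (h : x ∈ Λ) (y : Λ → ℝ × ℝ) : coord Λ x y = y ⟨x, h⟩ := by
  simp [coord, h]

lemma coord_of_notMem {x : ℤ} (h : x ∉ Λ) (y : Λ → ℝ × ℝ) : coord Λ x y = 0 := by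
  simp [coord, h]

lemma norm_coord_le (v : Λ → ℝ × ℝ) (x : ℤ) : ‖coord Λ x v‖ ≤ weightedNorm Λ v * weight x := by
  by_cases h : x ∈ Λ
  · rw [coord_of_mem h]
    exact norm_apply_le v ⟨x, h⟩
  · rw [coord_of_notMem h, norm_zero]
    have := weight_pos x
    positivity

lemma abs_coord_fst_le (v : Λ → ℝ × ℝ) (x : ℤ) :
    |(coord Λ x v).1| ≤ weightedNorm Λ v * weight x :=
  (norm_fst_le (coord Λ x v)).trans (norm_coord_le v x)

lemma abs_coord_snd_le (v : Λ → ℝ × ℝ) (x : ℤ) :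
    |(coord Λ x v).2| ≤ weightedNorm Λ v * weight x :=
  (norm_snd_le (coord Λ x v)).trans (norm_coord_le v x)

variable (Λ) in
/-- The vector field of the chain restricted to `Λ`, with zero boundary conditions and with the
force `W`. -/
def boxDrift (W : ℝ → ℝ) (y : Λ → ℝ × ℝ) : Λ → ℝ × ℝ := fun x =>
  ((coord Λ x y).2 - (coord Λ (x - 1) y).2, W (coord Λ (x + 1) y).1 - W (coord Λ x y).1)

variable {U W : ℝ → ℝ} {B δ Q : ℝ}

lemma contDiff_boxDrift (hW : ContDiff ℝ 1 W) : ContDiff ℝ 1 (boxDrift Λ W) := by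
  refine contDiff_pi.2 fun x => ?_
  have h1 : ∀ x, ContDiff ℝ 1 fun y => (coord Λ x y).1 := fun x =>
    contDiff_fst.comp (coord Λ x).contDiff
  have h2 : ∀ x, ContDiff ℝ 1 fun y => (coord Λ x y).2 := fun x =>
    contDiff_snd.comp (coord Λ x).contDiff
  exact ((h2 _).sub (h2 _)).prodMk ((hW.comp (h1 _)).sub (hW.comp (h1 _)))

/-- Interactions are between nearest neighbours, and the weight at most doubles from a site to a
neighbour, so each component has Lipschitz constant at most `(1 + 2) (1 + B)`. It depends on neither
the box nor the precision. -/
lemma weightedNorm_boxDrift_sub_le (hW : IsRegularization U B δ Q W) (hB : 0 ≤ B)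
    (y v : Λ → ℝ × ℝ) :
    weightedNorm Λ (boxDrift Λ W (y + v) - boxDrift Λ W y) ≤ 3 * (1 + B) * weightedNorm Λ v := by
  have hp := apply_nonneg (weightedNorm Λ) v
  refine (weightedNorm_le_iff (by positivity)).2 fun x => ?_
  have hw := weight_pos x
  have h0 := abs_coord_snd_le v x
  have h1 := (abs_coord_snd_le v (x - 1)).trans
    (mul_le_mul_of_nonneg_left (weight_sub_one_le x) hp)
  have h2 := abs_coord_fst_le v x
  have h3 := (abs_coord_fst_le v (x + 1)).trans
    (mul_le_mul_of_nonneg_left (weight_add_one_le x) hp)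
  have h4 := hW.lip (coord Λ (x + 1) y).1 (coord Λ (x + 1) v).1
  have h5 := hW.lip (coord Λ x y).1 (coord Λ x v).1
  have hpw : 0 ≤ weightedNorm Λ v * weight x := by positivity
  have hBp : 0 ≤ B * (weightedNorm Λ v * weight x) := by positivity
  refine max_le ?_ ?_
  · simp only [boxDrift, Pi.sub_apply, map_add, Prod.snd_add, Prod.fst_sub, Real.norm_eq_abs]
    have e : (coord Λ x y).2 + (coord Λ x v).2 - ((coord Λ (x - 1) y).2 + (coord Λ (x - 1) v).2) -
        ((coord Λ x y).2 - (coord Λ (x - 1) y).2) =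
        (coord Λ x v).2 - (coord Λ (x - 1) v).2 := by ring
    rw [e]
    refine (abs_sub _ _).trans ?_
    linarith
  · simp only [boxDrift, Pi.sub_apply, map_add, Prod.fst_add, Prod.snd_sub, Real.norm_eq_abs]
    have e : ∀ a b c d : ℝ, a - b - (c - d) = (a - c) - (b - d) := fun a b c d => by ring
    rw [e]
    refine (abs_sub _ _).trans ?_
    have h6 := mul_le_mul_of_nonneg_left h3 hB
    have h7 := mul_le_mul_of_nonneg_left h2 hB
    linarith

/-- Only the force is nonlinear. Its second differences produce the square of a weight, one factor
of which is bounded by `c`; the factor `5` is `2 · 2` for the neighbour plus `1` for the site. The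
dependence of `c` on the box is harmless, because the jump size is chosen last. -/
lemma weightedNorm_boxDrift_sub₂_le (hW : IsRegularization U B δ Q W) (hQ : 0 ≤ Q)
    {c : ℝ} (hc0 : 0 ≤ c) (hc : ∀ x ∈ Λ, weight x ≤ c) (y v w : Λ → ℝ × ℝ) :
    weightedNorm Λ (boxDrift Λ W (y + v + w) - boxDrift Λ W (y + v) - boxDrift Λ W (y + w) +
      boxDrift Λ W y) ≤ 5 * Q * c * weightedNorm Λ v * weightedNorm Λ w := by
  have hp := apply_nonneg (weightedNorm Λ) v
  have hp' := apply_nonneg (weightedNorm Λ) w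
  refine (weightedNorm_le_iff (by positivity)).2 fun x => ?_
  have hw := weight_pos x
  refine max_le ?_ ?_
  · simp only [boxDrift, Pi.add_apply, Pi.sub_apply, map_add, Prod.snd_add, Prod.fst_sub,
      Prod.fst_add, Real.norm_eq_abs]
    ring_nf
    rw [abs_zero]
    positivity
  · simp only [boxDrift, Pi.add_apply, Pi.sub_apply, map_add, Prod.snd_add, Prod.snd_sub,
      Prod.fst_add, Real.norm_eq_abs]
    have h4 := hW.lip₂ (coord Λ (x + 1) y).1 (coord Λ (x + 1) v).1 (coord Λ (x + 1) w).1
    have h5 := hW.lip₂ (coord Λ x y).1 (coord Λ x v).1 (coord Λ x w).1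
    have b1 := (abs_coord_fst_le v (x + 1)).trans
      (mul_le_mul_of_nonneg_left (weight_add_one_le x) hp)
    have b2 := (abs_coord_fst_le w (x + 1)).trans
      (mul_le_mul_of_nonneg_left (weight_add_one_le x) hp')
    have b3 := abs_coord_fst_le v x
    have b4 := abs_coord_fst_le w x
    have h6 : Q * |(coord Λ (x + 1) v).1| * |(coord Λ (x + 1) w).1| ≤
        Q * (weightedNorm Λ v * (2 * weight x)) * (weightedNorm Λ w * (2 * weight x)) := by
      gcongr
    have h7 : Q * |(coord Λ x v).1| * |(coord Λ x w).1| ≤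
        Q * (weightedNorm Λ v * weight x) * (weightedNorm Λ w * weight x) := by
      gcongr
    have h8 : Q * (weightedNorm Λ v * weight x) * (weightedNorm Λ w * weight x) ≤
        Q * (weightedNorm Λ v * weight x) * (weightedNorm Λ w * c) := by
      gcongr
      exact hc x x.2
    have e : ∀ a a' b b' c c' d d' : ℝ, a - a' - (b - b') - (c - c') + (d - d') =
        (a - b - c + d) - (a' - b' - c' + d') := by intros; ring
    rw [e]
    refine (abs_sub _ _).trans ?_
    linarith

end Config

end

/-! ### The box dynamics compared with the infinite chain. -/

noncomputable section

open Config

lemma IsTame.isC1Bounded {E : Type*} [NormedAddCommGroup E] [NormedSpace ℝ E] {p : Seminorm ℝ E}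
    {a l m : ℝ} {u : E → ℝ} (h : IsTame p a l m u) (hl : 0 ≤ l) (hp : ∀ v, p v ≤ ‖v‖) :
    IsC1Bounded u :=
  ⟨h.contDiff, ⟨a, h.bound⟩, l, fun y => ContinuousLinearMap.opNorm_le_bound _ hl fun v =>
    (h.abs_fderiv_le y v).trans (mul_le_mul_of_nonneg_left (hp v) hl)⟩

/-- Dominated convergence as `ε → 0`. The minimum is essential: `c` is square integrable but `c²`
need not be, so the Taylor bound alone may have infinite norm, while `l c` dominates. -/
lemma exists_integral_min_sq_le {α : Type*} [MeasurableSpace α] {μ : Measure α} {c : α → ℝ}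
    (hc : MemLp c 2 μ) (hc0 : ∀ ω, 0 ≤ c ω) (hcm : Measurable c) {m l : ℝ} (hm : 0 ≤ m)
    (hl : 0 ≤ l) {ρ : ℝ} (hρ : 0 < ρ) : ∃ ε : ℝ, 0 < ε ∧ ε ≤ 1 ∧
      ∫ ω, (min (ε * (m * c ω ^ 2)) (l * c ω)) ^ 2 ∂μ ≤ ρ := by
  have hlim : Tendsto (fun ε : ℝ => ∫ ω, (min (ε * (m * c ω ^ 2)) (l * c ω)) ^ 2 ∂μ) (𝓝[>] 0)
      (𝓝 0) := by
    have h0 : (0 : ℝ) = ∫ _ : α, (0 : ℝ) ∂μ := by simp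
    conv => arg 3; rw [h0]
    refine tendsto_integral_filter_of_dominated_convergence (fun ω => (l * c ω) ^ 2)
      (Eventually.of_forall fun ε => ?_) ?_ (hc.const_mul l).integrable_sq
      (ae_of_all _ fun ω => ?_)
    · exact (by fun_prop : Measurable fun ω => (min (ε * (m * c ω ^ 2)) (l *
        c ω)) ^ 2).aestronglyMeasurable
    · filter_upwards [self_mem_nhdsWithin] with ε hε
      refine ae_of_all _ fun ω => ?_
      have hε : 0 < ε := hε
      have h1 := hc0 ω
      rw [Real.norm_of_nonneg (sq_nonneg _)]
      exact pow_le_pow_left₀ (by positivity) (min_le_right _ _) 2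
    · have h1 : Continuous fun ε : ℝ => (min (ε * (m * c ω ^ 2)) (l * c ω)) ^ 2 := by fun_prop
      have h2 := (h1.tendsto 0).mono_left (nhdsWithin_le_nhds (s := Set.Ioi 0))
      have h3 := hc0 ω
      have h4 : (0 : ℝ) ≤ l * c ω := by positivity
      simpa [min_eq_left h4] using h2
  have h1 := hlim.eventually (ge_mem_nhds hρ)
  have h2 : ∀ᶠ ε : ℝ in 𝓝[>] 0, ε ≤ 1 :=
    nhdsWithin_le_nhds (ge_mem_nhds (zero_lt_one (α := ℝ)))
  obtain ⟨ε, hε1, hε2, hε3⟩ := (h1.and (h2.and self_mem_nhdsWithin)).exists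
  exact ⟨ε, hε3, hε2, hε1⟩

namespace Config

/-- The box `{-n, …, n}`. -/
def box (n : ℕ) : Finset ℤ := Finset.Icc (-(n : ℤ)) n

lemma mem_box {n : ℕ} {x : ℤ} : x ∈ box n ↔ -(n : ℤ) ≤ x ∧ x ≤ n := Finset.mem_Icc

/-- By `norm_sq_le`, this controls the squared norm in `ℍ` of a function of the box by its squared
`L²` norm, with a factor only linear in `n`. -/
lemma card_image₂_box_le (n : ℕ) :
    (Finset.image₂ (fun a b : ℤ => a - b) (box n) (box n)).card ≤ 4 * n + 1 := by
  have h : Finset.image₂ (fun a b : ℤ => a - b) (box n) (box n) ⊆ box (2 * n) := by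
    intro x hx
    obtain ⟨a, ha, b, hb, rfl⟩ := Finset.mem_image₂.1 hx
    rw [mem_box] at *
    push_cast
    omega
  refine (Finset.card_le_card h).trans ?_
  rw [box, Int.card_Icc]
  push_cast
  omega

/-- The restriction of a configuration to `Λ`. -/
def restr (Λ : Finset ℤ) (ω : Config) : Λ → ℝ × ℝ := fun x => ω x

lemma coord_restr {Λ : Finset ℤ} {x : ℤ} (h : x ∈ Λ) (ω : Config) :
    coord Λ x (restr Λ ω) = ω x := coord_of_mem h _

/-- The flip of the momentum of the atom `x` for configurations on `Λ`. -/
def boxFlip (Λ : Finset ℤ) (x : ℤ) : (Λ → ℝ × ℝ) →L[ℝ] (Λ → ℝ × ℝ) :=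
  ContinuousLinearMap.pi fun i => if (i : ℤ) = x then
    ((ContinuousLinearMap.fst ℝ ℝ ℝ).prod (-ContinuousLinearMap.snd ℝ ℝ ℝ)).comp
      (ContinuousLinearMap.proj i) else ContinuousLinearMap.proj i

lemma boxFlip_apply (Λ : Finset ℤ) (x : ℤ) (y : Λ → ℝ × ℝ) (i : Λ) :
    boxFlip Λ x y i = if (i : ℤ) = x then ((y i).1, -(y i).2) else y i := by
  unfold boxFlip
  rw [ContinuousLinearMap.pi_apply]
  split_ifs <;> rfl

lemma restr_flipOn (Λ : Finset ℤ) (x : ℤ) (ω : Config) :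
    restr Λ (flipOn {x} ω) = boxFlip Λ x (restr Λ ω) := by
  funext i
  rw [boxFlip_apply]
  split_ifs with h
  · exact flipOn_apply_of_mem (s := {x}) h ω
  · exact flipOn_apply_of_notMem (s := {x}) h ω

lemma weightedNorm_boxFlip_le (Λ : Finset ℤ) (x : ℤ) (v : Λ → ℝ × ℝ) :
    weightedNorm Λ (boxFlip Λ x v) ≤ weightedNorm Λ v := by
  refine (weightedNorm_le_iff (apply_nonneg _ _)).2 fun i => le_trans (le_of_eq ?_)
      (norm_apply_le v i)
  rw [boxFlip_apply]
  split_ifs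
  · simp [Prod.norm_def]
  · rfl

end Config

namespace Chain

variable {M : Chain}

variable (M) in
/-- The velocity of the site `x` under the Liouville dynamics. -/
def drift (ω : Config) (x : ℤ) : ℝ × ℝ :=
  ((ω x).2 - (ω (x - 1)).2, M.V' (ω (x + 1)).1 - M.V' (ω x).1)

/-- `A f` is the derivative of `F` along the drift of the infinite chain, whose values on the window
involve the neighbours outside it. -/
lemma liouville_eq_fderiv {Λ : Finset ℤ} {F : (Λ → ℝ × ℝ) → ℝ} {f : Config → ℝ}
    (h : Represents Λ F f) (hF : IsC1Bounded F) (ω : Config) :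
    M.liouville f ω = fderiv ℝ F (restr Λ ω) (restr Λ (M.drift ω)) := by
  rw [liouville_eq_sum h.dependsOn subset_rfl]
  simp only [h.partialR hF, h.partialP hF]
  change _ = fderiv ℝ F (restr Λ ω) (fun i : Λ => M.drift ω i)
  rw [← sum_siteEmb Λ (M.drift ω), map_sum]
  refine Finset.sum_congr rfl fun x _ => ?_
  have e : M.drift ω x = ((ω x).2 - (ω (x - 1)).2) • ((1 : ℝ), (0 : ℝ)) +
      (M.V' (ω (x + 1)).1 - M.V' (ω x).1) • ((0 : ℝ), (1 : ℝ)) := by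
    simp [drift]
  rw [e]
  simp only [map_add, map_smul, smul_eq_mul]
  rfl

lemma noise_eq_sum_boxFlip {Λ : Finset ℤ} {F : (Λ → ℝ × ℝ) → ℝ} {f : Config → ℝ}
    (h : Represents Λ F f) (ω : Config) :
    noise f ω = 1 / 2 * ∑ x ∈ Λ, (F (boxFlip Λ x (restr Λ ω)) - F (restr Λ ω)) := by
  rw [noise_eq_sum h.dependsOn subset_rfl]
  congr 1
  refine Finset.sum_congr rfl fun x _ => ?_
  rw [h, h, ← restr_flipOn]
  rfl

variable (M) in
/-- The size of the forces exerted on the box of size `n` by its complement. -/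
def outerForce (n : ℕ) (ω : Config) : ℝ :=
  |(ω (-(n : ℤ) - 1)).2| + |M.V' (ω (n + 1)).1| + |M.V' 0|

lemma outerForce_nonneg (n : ℕ) (ω : Config) : 0 ≤ M.outerForce n ω := by
  unfold outerForce; positivity

/-- Inside the box only the regularisation of the two forces is felt, hence `2 δ`. The zero boundary
condition changes the drift only at the sites `±n`, where the norm carries the factor `2^{-n}`. -/
lemma weightedNorm_boxDrift_sub_drift_le {W : ℝ → ℝ} {B δ Q : ℝ}
    (hW : IsRegularization M.V' B δ Q W) (n : ℕ) (ω : Config) :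
    weightedNorm (box n) (boxDrift (box n) W (restr (box n) ω) - restr (box n) (M.drift ω)) ≤
      2 * δ + (2 ^ n)⁻¹ * M.outerForce n ω := by
  have hδ : 0 ≤ δ := (abs_nonneg _).trans (hW.close 0)
  have hZ := M.outerForce_nonneg n ω
  have hc : 0 ≤ (2 ^ n : ℝ)⁻¹ * M.outerForce n ω := by positivity
  refine (weightedNorm_le_iff (by positivity)).2 fun x => ?_
  obtain ⟨x, hx⟩ := x
  have hx' := mem_box.1 hx
  have hw1 := one_le_weight x
  have hmul : 2 * δ + (2 ^ n)⁻¹ * M.outerForce n ω * weight x ≤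
      (2 * δ + (2 ^ n)⁻¹ * M.outerForce n ω) * weight x := by
    rw [add_mul]
    have := le_mul_of_one_le_right (mul_nonneg zero_le_two hδ) hw1
    linarith
  have hpos : 0 ≤ (2 ^ n)⁻¹ * M.outerForce n ω * weight x :=
    mul_nonneg hc (weight_pos x).le
  have hwn : x.natAbs = n → (2 ^ n)⁻¹ * M.outerForce n ω * weight x = M.outerForce n ω := by
    intro h
    rw [weight, h]
    field_simp
  have hZ' : |(ω (-(n : ℤ) - 1)).2| + |M.V' (ω (n + 1)).1| + |M.V' 0| = M.outerForce n ω := rfl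
  refine le_trans (max_le ?_ ?_) hmul
  · simp only [boxDrift, drift, restr, Pi.sub_apply, Prod.fst_sub, Real.norm_eq_abs]
    change |(coord (box n) x (restr (box n) ω)).2 - (coord (box n) (x - 1) (restr (box n) ω)).2 -
      ((ω x).2 - (ω (x - 1)).2)| ≤ _
    rw [coord_restr hx]
    by_cases h : x - 1 ∈ box n
    · rw [coord_restr h, sub_self, abs_zero]
      positivity
    · have hxn : x = -(n : ℤ) := by rw [mem_box] at h; omega
      rw [coord_of_notMem h, hwn (by omega), ← hZ', hxn]
      have e : ∀ a b : ℝ, a - (0 : ℝ × ℝ).2 - (a - b) = b := fun a b => by simp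
      rw [e]
      have h1 := abs_nonneg (M.V' (ω (n + 1)).1)
      have h2 := abs_nonneg (M.V' 0)
      linarith
  · simp only [boxDrift, drift, restr, Pi.sub_apply, Prod.snd_sub, Real.norm_eq_abs]
    change |W (coord (box n) (x + 1) (restr (box n) ω)).1 - W (coord (box n) x (restr
        (box n) ω)).1 -
      (M.V' (ω (x + 1)).1 - M.V' (ω x).1)| ≤ _
    rw [coord_restr hx]
    have h0 := hW.close (ω x).1
    by_cases h : x + 1 ∈ box n
    · rw [coord_restr h]
      have h1 := hW.close (ω (x + 1)).1
      rw [abs_le] at h0 h1 ⊢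
      constructor <;> linarith
    · have hxn : x = n := by rw [mem_box] at h; omega
      rw [coord_of_notMem h, hwn (by omega), ← hZ', hxn]
      rw [hxn] at h0
      have h1 := hW.close 0
      have h2 := neg_abs_le (M.V' (ω (n + 1)).1)
      have h3 := neg_abs_le (M.V' 0)
      have h4 := le_abs_self (M.V' (ω (n + 1)).1)
      have h5 := le_abs_self (M.V' 0)
      have h6 := abs_nonneg (ω (-(n : ℤ) - 1)).2
      simp only [Prod.fst_zero]
      rw [abs_le] at h0 h1 ⊢
      constructor <;> linarith

/-- A bound for the velocities in the box of size `n`. -/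
lemma exists_memLp_bound_drift (n : ℕ) : ∃ c : Config → ℝ, Measurable c ∧ MemLp c 2 M.gibbs ∧
    (∀ ω, 0 ≤ c ω) ∧ (∀ ω, weightedNorm (box n) (restr (box n) (M.drift ω)) ≤ c ω) ∧
    ∀ ω, M.outerForce n ω ≤ c ω := by
  have hV := M.measurable_V'
  have hZ : MemLp (M.outerForce n) 2 M.gibbs :=
    ((M.memLp_p _).abs.add (M.memLp_V' _).abs).add (memLp_const _)
  have hD : ∀ x : ℤ, MemLp (fun ω : Config => |(ω x).2 - (ω (x - 1)).2| +
      |M.V' (ω (x + 1)).1 - M.V' (ω x).1|) 2 M.gibbs := fun x =>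
    ((M.memLp_p x).sub (M.memLp_p (x - 1))).abs.add ((M.memLp_V' (x + 1)).sub (M.memLp_V' x)).abs
  have hD' : ∀ ω : Config, 0 ≤ ∑ x ∈ box n, (|(ω x).2 - (ω (x - 1)).2| +
      |M.V' (ω (x + 1)).1 - M.V' (ω x).1|) := fun ω => Finset.sum_nonneg fun x _ => by positivity
  refine ⟨fun ω => ∑ x ∈ box n, (|(ω x).2 - (ω (x - 1)).2| +
    |M.V' (ω (x + 1)).1 - M.V' (ω x).1|) + M.outerForce n ω, ?_, ?_, fun ω => ?_, fun ω => ?_,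
    fun ω => ?_⟩
  · unfold outerForce
    fun_prop
  · exact (memLp_finsetSum _ fun x _ => hD x).add hZ
  · exact add_nonneg (hD' ω) (M.outerForce_nonneg n ω)
  · refine (weightedNorm_le_norm _).trans ?_
    refine (pi_norm_le_iff_of_nonneg (add_nonneg (hD' ω) (M.outerForce_nonneg n ω))).2 fun x => ?_
    have h1 := Finset.single_le_sum (f := fun x : ℤ => |(ω x).2 - (ω (x - 1)).2| +
      |M.V' (ω (x + 1)).1 - M.V' (ω x).1|) (fun i _ => by positivity) x.2
    have h2 := M.outerForce_nonneg n ω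
    have h3 := abs_nonneg ((ω x).2 - (ω (x - 1)).2)
    have h4 := abs_nonneg (M.V' (ω (x + 1)).1 - M.V' (ω x).1)
    exact max_le (by simp only [restr, drift, Real.norm_eq_abs]; linarith)
      (by simp only [restr, drift, Real.norm_eq_abs]; linarith)
  · exact le_add_of_nonneg_left (hD' ω)

/-- Uniform in `n`, since all the sites have the same law. -/
lemma exists_integral_outerForce_sq_le : ∃ K : ℝ, ∀ n : ℕ,
    ∫ ω, M.outerForce n ω ^ 2 ∂M.gibbs ≤ K := by
  refine ⟨3 * (∫ y, y.2 ^ 2 ∂M.siteMeasure + ∫ y, M.V' y.1 ^ 2 ∂M.siteMeasure + M.V' 0 ^ 2),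
    fun n => ?_⟩
  have hV := M.measurable_V'
  have h1 : ∀ x, ∫ ω : Config, (ω x).2 ^ 2 ∂M.gibbs = ∫ y, y.2 ^ 2 ∂M.siteMeasure := fun x => by
    rw [← (M.measurePreserving_coord x).map_eq, integral_map (measurable_pi_apply x).aemeasurable
      (by fun_prop : Measurable fun y : ℝ × ℝ => y.2 ^ 2).aestronglyMeasurable]
  have h2 : ∀ x, ∫ ω : Config, M.V' (ω x).1 ^ 2 ∂M.gibbs = ∫ y, M.V' y.1 ^ 2 ∂M.siteMeasure :=
    fun x => by
    rw [← (M.measurePreserving_coord x).map_eq, integral_map (measurable_pi_apply x).aemeasurable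
      (by fun_prop : Measurable fun y : ℝ × ℝ => M.V' y.1 ^ 2).aestronglyMeasurable]
  have i1 := (M.memLp_p (-(n : ℤ) - 1)).integrable_sq
  have i2 := (M.memLp_V' (n + 1)).integrable_sq
  rw [← h1 (-(n : ℤ) - 1), ← h2 (n + 1)]
  calc _ ≤ ∫ ω : Config, 3 * ((ω (-(n : ℤ) - 1)).2 ^ 2 + M.V' (ω (n + 1)).1 ^ 2 + M.V' 0 ^ 2)
          ∂M.gibbs := by
        refine integral_mono_of_nonneg (ae_of_all _ fun ω => sq_nonneg _)
          (((i1.add i2).add (integrable_const _)).const_mul 3) (ae_of_all _ fun ω => ?_)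
        simp only [outerForce]
        rw [← sq_abs (ω (-(n : ℤ) - 1)).2, ← sq_abs (M.V' (ω (n + 1)).1), ← sq_abs (M.V' 0)]
        generalize |(ω (-(n : ℤ) - 1)).2| = a
        generalize |M.V' (ω (n + 1)).1| = b
        generalize |M.V' 0| = c
        nlinarith [sq_nonneg (a - b), sq_nonneg (a - c), sq_nonneg (b - c)]
    _ = _ := by
      have i12 : Integrable (fun ω : Config => (ω (-(n : ℤ) - 1)).2 ^ 2 + M.V' (ω (n + 1)).1 ^ 2)
        M.gibbs := i1.add i2
      rw [integral_const_mul, integral_add i12 (integrable_const _), integral_add i1 i2]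
      simp

end Chain

end

/-! ### Approximate solutions of the resolvent equation for large `z`. -/

noncomputable section

open Config

/-- The local function `g` is represented on all the large boxes by tame functions, with uniform
constants. -/
def IsUniformlyTame (g : Config → ℝ) : Prop :=
  ∃ a l m : ℝ, 0 ≤ a ∧ 0 ≤ l ∧ 0 ≤ m ∧ ∀ᶠ n : ℕ in atTop, ∃ G : (box n → ℝ × ℝ) → ℝ,
    IsTame (weightedNorm (box n)) a l m G ∧ Represents (box n) G g

namespace Chain

variable {M : Chain}

lemma dependsOn_generator {n : ℕ} {F : (box n → ℝ × ℝ) → ℝ} {f : Config → ℝ}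
    (h : Represents (box n) F f) (hF : IsC1Bounded F) :
    DependsOn (M.generator f) (box (n + 1) : Set ℤ) := by
  intro ω ω' hω
  have h0 : ∀ x ∈ box n, ∀ y, (y = x ∨ y = x - 1 ∨ y = x + 1) → ω y = ω' y := by
    intro x hx y hy
    apply hω
    rw [Finset.mem_coe, mem_box] at *
    push_cast
    omega
  have h1 : restr (box n) ω = restr (box n) ω' :=
    funext fun x => h0 x x.2 x (Or.inl rfl)
  have h2 : restr (box n) (M.drift ω) = restr (box n) (M.drift ω') := by
    funext x
    simp only [restr, drift]
    rw [h0 x x.2 x (Or.inl rfl), h0 x x.2 (x - 1) (by simp), h0 x x.2 (x + 1) (by simp)]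
  unfold generator
  rw [liouville_eq_fderiv h hF, liouville_eq_fderiv h hF, noise_eq_sum_boxFlip h,
    noise_eq_sum_boxFlip h, h1, h2]

/-- Approximate solutions of the resolvent equation in a box. -/
lemma exists_residual_le {B : ℝ} (hB0 : 0 ≤ B)
    (hB : ∀ r s, |M.V' (r + s) - M.V' r| ≤ B * |s|) {z : ℝ}
    (hz : 2 * (3 * (1 + B)) + (3 * (1 + B)) ^ 2 + 1 ≤ z) {a l m : ℝ} (ha : 0 ≤ a) (hl : 0 ≤ l)
    (hm : 0 ≤ m) {n : ℕ} {g : Config → ℝ} {G : (box n → ℝ × ℝ) → ℝ}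
    (hG : IsTame (weightedNorm (box n)) a l m G) (hg : Represents (box n) G g) {t : ℝ}
    (ht : 0 < t) : ∃ (f : Config → ℝ) (F : (box n → ℝ × ℝ) → ℝ) (A : Config → ℝ),
      Represents (box n) F f ∧ IsC1Bounded F ∧ MemLp A 2 M.gibbs ∧ ∫ ω, A ω ^ 2 ∂M.gibbs ≤ t ∧
      ∀ ω, |z * f ω - M.generator f ω - g ω| ≤
        t + A ω + l * (2 * t) + l * ((2 ^ n)⁻¹ * M.outerForce n ω) := by
  -- The order of the choices matters: the box and the precision `t` fix `Q`, `κ` and the constant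
  -- `m'`. Only then is `ε` taken small, depending on all of them. The Lipschitz constant `l` is
  -- affected by none of these choices.
  obtain ⟨Q, W, hQ, hW⟩ := M.exists_regularization hB0 hB ht
  obtain ⟨w, hw0, hw⟩ : ∃ w : ℝ, 0 ≤ w ∧ ∀ x ∈ box n, weight x ≤ w :=
    ⟨∑ x ∈ box n, weight x, Finset.sum_nonneg fun x _ => (weight_pos x).le, fun x hx =>
      Finset.single_le_sum (f := weight) (fun x _ => (weight_pos x).le) hx⟩
  obtain ⟨c₀, hc₀m, hc₀L, hc₀0, hc₀D, hc₀Z⟩ := M.exists_memLp_bound_drift n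
  set κ := 5 * Q * w with hκ
  have hκ0 : 0 ≤ κ := by positivity
  -- A bound for the weighted norm of the box drift: `c₀` for the true drift, plus its error `2 t +
  -- 2^{-n} outerForce ≤ 2 t + c₀`.
  set c : Config → ℝ := fun ω => 2 * c₀ ω + 2 * t with hc
  have hc0 : ∀ ω, 0 ≤ c ω := fun ω => by have := hc₀0 ω; simp only [hc]; positivity
  have hcL : MemLp c 2 M.gibbs := (hc₀L.const_mul 2).add (memLp_const _)
  have hcm : Measurable c := by fun_prop
  set m' := m + l * κ with hm'
  have hm'0 : 0 ≤ m' := by positivity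
  obtain ⟨ε, hε, hε1, hA⟩ := exists_integral_min_sq_le hcL hc0 hcm hm'0
    (by positivity : 0 ≤ 2 * l) ht
  set p := weightedNorm (box n) with hp
  set b := boxDrift (box n) W with hb
  have hpε : ∀ v, p (ε • v) = ε * p v := fun v => by
    rw [map_smul_eq_mul, Real.norm_of_nonneg hε.le]
  obtain ⟨u, hu, hres⟩ := hG.exists_approx_resolvent ha hl hm (C := 3 * (1 + B)) (κ := κ)
    (z := z) (ε := ε) (c := M.γ / 2) (by positivity) hκ0 hε hε1 (by have := M.γ_pos; positivity) hz
    (ψ := fun y => y + ε • b y)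
    (contDiff_id.add (f := id) (g := fun y => ε • b y)
      ((contDiff_boxDrift hW.contDiff).const_smul ε))
    (fun y v => by
      have e : y + v + ε • b (y + v) - (y + ε • b y) = v + ε • (b (y + v) - b y) := by
        rw [smul_sub]; abel
      rw [e]
      refine (map_add_le_add p _ _).trans ?_
      rw [hpε, add_mul, one_mul, mul_assoc]
      gcongr
      exact weightedNorm_boxDrift_sub_le hW hB0 y v)
    (fun y v w => by
      have e : y + v + w + ε • b (y + v + w) - (y + v + ε • b (y + v)) - (y + w + ε • b (y + w)) +
          (y + ε • b y) = ε • (b (y + v + w) - b (y + v) - b (y + w) + b y) := by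
        rw [smul_add, smul_sub, smul_sub]; abel
      rw [e, hpε, mul_assoc, mul_assoc]
      refine mul_le_mul_of_nonneg_left ?_ hε.le
      have := weightedNorm_boxDrift_sub₂_le hW hQ hw0 hw y v w
      rwa [mul_assoc (5 * Q * _)] at this)
    (box n) (boxFlip (box n)) (weightedNorm_boxFlip_le (box n)) ht
  have huC := hu.isC1Bounded hl weightedNorm_le_norm
  have hrep : Represents (box n) u fun ω => u (restr (box n) ω) := fun ω => rfl
  refine ⟨_, u, _, hrep, huC, ?_, hA, fun ω => ?_⟩
  · refine (hcL.const_mul (2 * l)).mono (by fun_prop) (ae_of_all _ fun ω => ?_)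
    have := hc0 ω
    have h2 : 0 ≤ ε * (m' * c ω ^ 2) := by positivity
    have h3 : 0 ≤ 2 * l * c ω := by positivity
    rw [Real.norm_of_nonneg (le_min h2 h3), Real.norm_of_nonneg h3]
    exact min_le_right _ _
  · set y := restr (box n) ω with hy
    have hgG : g ω = G y := hg ω
    have hdist := weightedNorm_boxDrift_sub_drift_le hW n ω
    have hZ0 := M.outerForce_nonneg n ω
    have h2n : (2 ^ n : ℝ)⁻¹ * M.outerForce n ω ≤ M.outerForce n ω :=
      mul_le_of_le_one_left hZ0 (inv_le_one_of_one_le₀ (one_le_pow₀ (by norm_num)))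
    have hbc : p (b y) ≤ c ω := by
      have e : b y = restr (box n) (M.drift ω) + (b y - restr (box n) (M.drift ω)) := by abel
      rw [e]
      refine (map_add_le_add p _ _).trans ?_
      have h1 := hc₀D ω
      have h2 := hc₀Z ω
      simp only [hc]
      linarith
    have hpb : 0 ≤ p (b y) := apply_nonneg _ _
    have h1 := hres y
    -- The jump against the derivative: the Taylor estimate where the drift is moderate, twice the
    -- Lipschitz bound elsewhere.
    have h2 : |ε⁻¹ * (u (y + ε • b y) - u y) - fderiv ℝ u y (b y)| ≤
        min (ε * (m' * c ω ^ 2)) (2 * l * c ω) := by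
      refine le_min ((hu.abs_slope_sub_fderiv_le hm'0 hε y (b y)).trans ?_) ?_
      · gcongr
      · have h3 := hu.lip y (ε • b y)
        have h4 := hu.abs_fderiv_le y (b y)
        have h5 : l * p (b y) ≤ l * c ω := mul_le_mul_of_nonneg_left hbc hl
        refine (abs_sub _ _).trans ?_
        rw [abs_mul, abs_of_pos (inv_pos.2 hε)]
        have h6 : ε⁻¹ * |u (y + ε • b y) - u y| ≤ l * p (b y) := by
          rw [inv_mul_le_iff₀ hε]
          rw [hpε] at h3
          linarith
        linarith
    have h3 : |fderiv ℝ u y (b y - restr (box n) (M.drift ω))| ≤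
        l * (2 * t) + l * ((2 ^ n)⁻¹ * M.outerForce n ω) := by
      refine (hu.abs_fderiv_le y _).trans ?_
      rw [← mul_add]
      exact mul_le_mul_of_nonneg_left hdist hl
    rw [map_sub] at h3
    unfold generator
    rw [liouville_eq_fderiv hrep huC, noise_eq_sum_boxFlip hrep, hgG]
    change |z * u y - (fderiv ℝ u y (restr (box n) (M.drift ω)) +
      M.γ * (1 / 2 * ∑ x ∈ box n, (u (boxFlip (box n) x y) - u y))) - G y| ≤ _
    rw [abs_le] at h1 h2 h3 ⊢
    constructor <;> linarith

variable (M) in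
/-- The range of `z - L` contains the uniformly tame functions in its closure, for large `z`. -/
lemma exists_norm_resolvent_sub_lt : ∃ z₀ : ℝ, ∀ z, z₀ ≤ z → ∀ g : M.LocalL2, IsUniformlyTame g →
    ∀ ρ : ℝ, 0 < ρ → ∃ (f : M.LocalL2) (hf : IsC01 f), ‖z • f - generatorL2 hf - g‖ < ρ := by
  obtain ⟨B, hB0, hB⟩ := M.exists_lipschitz_V'
  obtain ⟨K, hK⟩ := M.exists_integral_outerForce_sq_le
  refine ⟨2 * (3 * (1 + B)) + (3 * (1 + B)) ^ 2 + 1, fun z hz g ⟨a, l, m, ha, hl, hm,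
      hG⟩ ρ hρ => ?_⟩
  -- The edge error, of squared size `4^{-n}`, still vanishes after multiplication by the factor `4
  -- (n + 1) + 1`. The box has size `n + 1` because the generator reaches one site further than `f`.
  have hlim : Tendsto (fun n : ℕ => (4 * (n + 1 : ℕ) + 1 : ℝ) * (4 * (l ^ 2 * (((2 ^ n)⁻¹) ^ 2 *
      K))))
      atTop (𝓝 0) := by
    have h1 := tendsto_pow_const_mul_const_pow_of_abs_lt_one 1 (r := (1 / 4 : ℝ))
      (by norm_num [abs_of_pos])
    have h2 := tendsto_pow_const_mul_const_pow_of_abs_lt_one 0 (r := (1 / 4 : ℝ))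
      (by norm_num [abs_of_pos])
    have h3 := (h1.const_mul (16 * l ^ 2 * K)).add (h2.const_mul (20 * l ^ 2 * K))
    simp only [mul_zero, add_zero] at h3
    refine h3.congr fun n => ?_
    have e : ((1 / 4 : ℝ)) ^ n = ((2 ^ n)⁻¹) ^ 2 := by
      rw [← inv_pow, ← pow_mul, mul_comm n 2, pow_mul]; norm_num
    rw [e]
    push_cast
    ring
  obtain ⟨n, hn, G, hG, hg⟩ := ((hlim.eventually (gt_mem_nhds
    (by positivity : 0 < ρ ^ 2 / 2))).and hG).exists
  -- With `n` now fixed, the precision `t` can absorb all the remaining errors.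
  have hlim2 : Tendsto (fun t : ℝ => (4 * (n + 1 : ℕ) + 1 : ℝ) *
      (4 * (t ^ 2 + t + (l * (2 * t)) ^ 2))) (𝓝[>] 0) (𝓝 0) := by
    have : Continuous fun t : ℝ => (4 * (n + 1 : ℕ) + 1 : ℝ) *
      (4 * (t ^ 2 + t + (l * (2 * t)) ^ 2)) := by fun_prop
    have := (this.tendsto 0).mono_left (nhdsWithin_le_nhds (s := Set.Ioi 0))
    simpa using this
  obtain ⟨t, htρ, ht⟩ := ((hlim2.eventually (gt_mem_nhds
    (by positivity : 0 < ρ ^ 2 / 2))).and self_mem_nhdsWithin).exists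
  have ht : 0 < t := ht
  obtain ⟨f, F, A, hf, hF, hAL, hA, hres⟩ := exists_residual_le hB0 hB hz ha hl hm hG hg ht
  have hf01 : IsC01 f := ⟨_, F, hf, hF⟩
  let f' : M.LocalL2 := LocalL2.mk f hf01.isLocal hf01.measurable
    (memLp_two_bounded hf01.measurable hf01.bounded)
  have hf' : IsC01 f' := hf01
  refine ⟨f', hf', ?_⟩
  set d : M.LocalL2 := z • f' - generatorL2 hf' - g with hd
  have hdω : ∀ ω, d ω = z * f ω - M.generator f ω - g ω := fun ω => rfl
  have hbox : ∀ ω ω' : Config, (∀ x ∈ (box (n + 1) : Set ℤ), ω x = ω' x) →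
      ∀ x ∈ (box n : Set ℤ), ω x = ω' x := by
    intro ω ω' h x hx
    refine h x ?_
    rw [Finset.mem_coe, mem_box] at *
    push_cast
    omega
  have hdep : DependsOn d (box (n + 1) : Set ℤ) := by
    intro ω ω' hω
    rw [hdω, hdω, hf.dependsOn (hbox ω ω' hω), hg.dependsOn (hbox ω ω' hω),
      dependsOn_generator hf hF hω]
  have hZ : MemLp (M.outerForce n) 2 M.gibbs :=
    ((M.memLp_p _).abs.add (M.memLp_V' _).abs).add (memLp_const _)
  have i1 : Integrable (fun ω => A ω ^ 2) M.gibbs := hAL.integrable_sq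
  have i2 : Integrable (fun ω => l ^ 2 * (((2 ^ n)⁻¹) ^ 2 * M.outerForce n ω ^ 2)) M.gibbs :=
    (hZ.integrable_sq.const_mul _).const_mul _
  have i12 : Integrable (fun ω => A ω ^ 2 + l ^ 2 * (((2 ^ n)⁻¹) ^ 2 * M.outerForce n ω ^ 2))
    M.gibbs := i1.add i2
  have hint : ∫ ω, d ω ^ 2 ∂M.gibbs ≤
      4 * (t ^ 2 + t + (l * (2 * t)) ^ 2) + 4 * (l ^ 2 * (((2 ^ n)⁻¹) ^ 2 * K)) := by
    calc _ ≤ ∫ ω, (4 * (t ^ 2 + (l * (2 * t)) ^ 2) + 4 * (A ω ^ 2 +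
            l ^ 2 * (((2 ^ n)⁻¹) ^ 2 * M.outerForce n ω ^ 2))) ∂M.gibbs := by
          refine integral_mono d.memLp.integrable_sq
            ((integrable_const _).add (i12.const_mul 4)) fun ω => ?_
          have h1 := hres ω
          rw [← hdω] at h1
          have h2 := pow_le_pow_left₀ (abs_nonneg _) h1 2
          rw [sq_abs] at h2
          refine h2.trans ?_
          have h3 : l ^ 2 * (((2 ^ n : ℝ)⁻¹) ^ 2 * M.outerForce n ω ^ 2) =
            (l * ((2 ^ n)⁻¹ * M.outerForce n ω)) ^ 2 := by ring
          simp only [h3]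
          generalize l * ((2 ^ n)⁻¹ * M.outerForce n ω) = q
          generalize l * (2 * t) = r
          generalize A ω = s
          nlinarith [sq_nonneg (t - s), sq_nonneg (t - r), sq_nonneg (t - q), sq_nonneg (s - r),
            sq_nonneg (s - q), sq_nonneg (r - q)]
      _ = 4 * (t ^ 2 + (l * (2 * t)) ^ 2) + 4 * (∫ ω, A ω ^ 2 ∂M.gibbs +
            l ^ 2 * (((2 ^ n)⁻¹) ^ 2 * ∫ ω, M.outerForce n ω ^ 2 ∂M.gibbs)) := by
          rw [integral_add (integrable_const _) (i12.const_mul 4), integral_const,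
            integral_const_mul, integral_add i1 i2, integral_const_mul, integral_const_mul]
          simp
      _ ≤ _ := by
          have h1 : l ^ 2 * (((2 ^ n)⁻¹) ^ 2 * ∫ ω, M.outerForce n ω ^ 2 ∂M.gibbs) ≤
            l ^ 2 * (((2 ^ n)⁻¹) ^ 2 * K) := by
            gcongr
            exact hK n
          linarith
  refine lt_of_pow_lt_pow_left₀ 2 hρ.le ((M.norm_sq_le d hdep).trans_lt ?_)
  have hcard : ((Finset.image₂ (fun a b : ℤ => a - b) (box (n + 1)) (box (n + 1))).card : ℝ) ≤
      4 * (n + 1 : ℕ) + 1 := by exact_mod_cast card_image₂_box_le (n + 1)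
  have h0 : 0 ≤ ∫ ω, d ω ^ 2 ∂M.gibbs := integral_nonneg fun ω => sq_nonneg _
  calc _ ≤ (4 * (n + 1 : ℕ) + 1 : ℝ) * (4 * (t ^ 2 + t + (l * (2 * t)) ^ 2) +
        4 * (l ^ 2 * (((2 ^ n)⁻¹) ^ 2 * K))) := by gcongr
    _ < ρ ^ 2 := by rw [mul_add]; linarith

end Chain

end

/-! ### Density of tame functions, and of the range of `z - L`. -/

noncomputable section

open Config

section SmoothApproximation

variable {E : Type*} [NormedAddCommGroup E] [NormedSpace ℝ E]

/-- Smoothing at a scale `δ` of uniform continuity moves values by at most `ε` and enlarges the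
support by at most `δ`. -/
lemma HasCompactSupport.exists_contDiff_near [FiniteDimensional ℝ E] {f : E → ℝ} (hf :
    HasCompactSupport f)
    (hfc : Continuous f) {ε : ℝ} (hε : 0 < ε) :
    ∃ g : E → ℝ, ContDiff ℝ 2 g ∧ HasCompactSupport g ∧ ∀ x, |g x - f x| ≤ ε := by
  have := FiniteDimensional.proper ℝ E
  obtain ⟨δ, hδ, hfδ⟩ := Metric.uniformContinuous_iff.mp
    (hf.uniformContinuous_of_continuous hfc) ε hε
  obtain ⟨g, hg, hgf⟩ := hfc.exists_contDiff_dist_le_of_forall_mem_ball_dist_le hδ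
  refine ⟨g, contDiff_infty.1 hg 2, ?_, fun x => hgf x ε fun y hy => (hfδ hy).le⟩
  refine HasCompactSupport.intro (K := Metric.cthickening δ (tsupport f))
    (IsCompact.cthickening hf) fun x hx => ?_
  have h0 : ∀ y ∈ Metric.ball x δ, f y = 0 := by
    intro y hy
    by_contra h
    refine hx (Metric.mem_cthickening_of_dist_le x y δ _ (subset_tsupport f h) ?_)
    rw [dist_comm]
    exact (Metric.mem_ball.1 hy).le
  have hx0 := h0 x (Metric.mem_ball_self hδ)
  have h1 := hgf x 0 fun y hy => by rw [h0 y hy, hx0, dist_self]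
  rw [hx0] at h1
  simpa using h1

lemma exists_norm_fderiv_le_of_hasCompactSupport {F : Type*} [NormedAddCommGroup F]
    [NormedSpace ℝ F] {f : E → F} (hf : HasCompactSupport f) (hfc : ContDiff ℝ 1 f) :
    ∃ C, 0 ≤ C ∧ ∀ y v, ‖f (y + v) - f y‖ ≤ C * ‖v‖ := by
  obtain ⟨C, hC⟩ := hfc.lipschitzWith_of_hasCompactSupport hf (by norm_num)
  refine ⟨C, C.2, fun y v => ?_⟩
  have := hC.dist_le_mul (y + v) y
  simpa [dist_eq_norm] using this

/-- The mean value inequality applied twice: the derivative of `x ↦ f (x + v) - f x` is an increment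
of `fderiv ℝ f`, which is Lipschitz. -/
lemma exists_second_difference_le {f : E → ℝ} (hf : HasCompactSupport f) (hfc : ContDiff ℝ 2 f) :
    ∃ C, 0 ≤ C ∧ ∀ y v w, |f (y + v + w) - f (y + v) - f (y + w) + f y| ≤ C * ‖v‖ * ‖w‖ := by
  have h2 : ContDiff ℝ (1 + 1) f := by simpa [one_add_one_eq_two] using hfc
  have hd := hfc.differentiable (by norm_num)
  obtain ⟨C, hC0, hC⟩ := exists_norm_fderiv_le_of_hasCompactSupport (hf.fderiv ℝ)
    (hfc.fderiv_right (m := 1) (by norm_num))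
  refine ⟨C, hC0, fun y v w => ?_⟩
  have h := Convex.norm_image_sub_le_of_norm_hasFDerivWithin_le (f := fun x => f (x + v) - f x)
    (s := Set.univ) (C := C * ‖v‖) (x := y) (y := y + w)
    (f' := fun x => fderiv ℝ f (x + v) - fderiv ℝ f x)
    (fun x _ => (((hasFDerivAt_comp_add_right v).2 (hd (x + v)).hasFDerivAt).sub
      (hd x).hasFDerivAt).hasFDerivWithinAt)
    (fun x _ => hC x v) convex_univ trivial trivial
  have e : f (y + v + w) - f (y + v) - f (y + w) + f y =
      f (y + w + v) - f (y + w) - (f (y + v) - f y) := by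
    rw [add_right_comm y v w]; ring
  rw [e]
  simpa using h

end SmoothApproximation

namespace Config

/-- Smooth functions of finitely many coordinates with compact support are uniformly tame. -/
lemma isUniformlyTame_of_hasCompactSupport {Λ : Finset ℤ} {F : (Λ → ℝ × ℝ) → ℝ}
    (hF : HasCompactSupport F) (hFc : ContDiff ℝ 2 F) {g : Config → ℝ} (hg : Represents Λ F g) :
    IsUniformlyTame g := by
  obtain ⟨a, ha⟩ := hF.exists_bound_of_continuous hFc.continuous
  obtain ⟨l, hl0, hl⟩ := exists_norm_fderiv_le_of_hasCompactSupport hF (hFc.of_le (by norm_num))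
  obtain ⟨m, hm0, hm⟩ := exists_second_difference_le hF hFc
  obtain ⟨w, hw0, hw⟩ : ∃ w : ℝ, 0 ≤ w ∧ ∀ x ∈ Λ, weight x ≤ w :=
    ⟨∑ x ∈ Λ, weight x, Finset.sum_nonneg fun x _ => (weight_pos x).le, fun x hx =>
      Finset.single_le_sum (f := weight) (fun x _ => (weight_pos x).le) hx⟩
  -- The weights are bounded by `w` on the fixed support `Λ`, so passing to the weighted norm costs
  -- one factor `w` per increment, whatever the size of the box.
  refine ⟨a, l * w, m * w ^ 2, (norm_nonneg _).trans (ha 0), by positivity, by positivity, ?_⟩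
  filter_upwards [eventually_ge_atTop (Λ.sup Int.natAbs)] with n hn
  have hΛ : ∀ x ∈ Λ, x ∈ box n := fun x hx => by
    have := (Finset.le_sup (f := Int.natAbs) hx).trans hn
    rw [mem_box]
    omega
  let A : (box n → ℝ × ℝ) →L[ℝ] (Λ → ℝ × ℝ) :=
    ContinuousLinearMap.pi fun x : Λ => ContinuousLinearMap.proj (⟨x, hΛ x x.2⟩ : box n)
  have hA : ∀ v, ‖A v‖ ≤ w * weightedNorm (box n) v := fun v => by
    have hp := apply_nonneg (weightedNorm (box n)) v
    refine (pi_norm_le_iff_of_nonneg (by positivity)).2 fun x => ?_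
    refine (norm_apply_le v ⟨x, hΛ x x.2⟩).trans ?_
    rw [mul_comm]
    exact mul_le_mul_of_nonneg_right (hw x x.2) hp
  refine ⟨fun y => F (A y), ⟨(hFc.of_le (by norm_num)).comp A.contDiff, fun y => ha _,
    fun y v => ?_, fun y v w' => ?_⟩, fun ω => hg ω⟩
  · rw [map_add]
    refine (hl (A y) (A v)).trans ?_
    rw [mul_assoc]
    exact mul_le_mul_of_nonneg_left (hA v) hl0
  · simp only [map_add]
    refine (hm (A y) (A v) (A w')).trans ?_
    have h1 := hA v
    have h2 := hA w'
    have hp := apply_nonneg (weightedNorm (box n)) v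
    calc m * ‖A v‖ * ‖A w'‖ ≤ m * (w * weightedNorm (box n) v) * (w * weightedNorm (box n) w') := by
          gcongr
      _ = _ := by ring

end Config

namespace Chain

variable {M : Chain}

lemma exists_eq_comp_restr {f : Config → ℝ} {Λ : Finset ℤ} (hf : DependsOn f (Λ : Set ℤ))
    (hfm : Measurable f) : ∃ F : (Λ → ℝ × ℝ) → ℝ, Measurable F ∧ Represents Λ F f := by
  classical
  refine ⟨fun y => f (fun i => if hi : i ∈ Λ then y ⟨i, hi⟩ else 0), ?_, ?_⟩
  · refine hfm.comp (measurable_pi_lambda _ fun i => ?_)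
    by_cases hi : i ∈ Λ
    · simp only [hi, dite_true]; fun_prop
    · simp only [hi, dite_false]; fun_prop
  · intro ω
    refine hf fun i hi => ?_
    have hi' : i ∈ Λ := hi
    simp [hi']

/-- On a fixed window the norm of `ℍ` is controlled by that of `L²`. It is enough to approximate in
`L²` of the law of the window, by continuous compactly supported functions and then by smooth ones.
-/
lemma exists_uniformlyTame_near (f : M.LocalL2) {ρ : ℝ} (hρ : 0 < ρ) :
    ∃ g : M.LocalL2, IsUniformlyTame g ∧ ‖g - f‖ < ρ := by
  obtain ⟨Λ, hΛ⟩ := f.isLocal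
  obtain ⟨F, hFm, hF⟩ := exists_eq_comp_restr hΛ f.measurable
  have hrm : Measurable (restr Λ) := by unfold restr; fun_prop
  set ν := M.gibbs.map (restr Λ) with hν
  have hνp : IsProbabilityMeasure ν := Measure.isProbabilityMeasure_map hrm.aemeasurable
  have hmp : MeasurePreserving (restr Λ) M.gibbs ν := ⟨hrm, rfl⟩
  have hfF : f.fn = F ∘ restr Λ := funext hF
  have hFL : MemLp F 2 ν := by
    rw [memLp_map_measure_iff hFm.aestronglyMeasurable hrm.aemeasurable, ← hfF]
    exact f.memLp
  set N : ℝ := ((Finset.image₂ (fun a b : ℤ => a - b) Λ Λ).card : ℝ) with hN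
  have hN0 : 0 ≤ N := Nat.cast_nonneg _
  -- `N` is the constant of `norm_sq_le` on the window. Each of the two approximations has squared
  -- `L²` error at most `t`, doubled when they are added.
  obtain ⟨t, ht0, ht⟩ : ∃ t : ℝ, 0 < t ∧ N * (2 * t + 2 * t) < ρ ^ 2 := by
    refine ⟨ρ ^ 2 / (4 * (N + 1)), by positivity, ?_⟩
    have : N * (2 * (ρ ^ 2 / (4 * (N + 1))) + 2 * (ρ ^ 2 / (4 * (N + 1)))) =
        ρ ^ 2 * (N / (N + 1)) := by field_simp; ring
    rw [this]
    refine mul_lt_of_lt_one_right (by positivity) ?_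
    rw [div_lt_one (by positivity)]
    linarith
  obtain ⟨G₁, hG₁s, hG₁, hG₁c, hG₁L⟩ := MemLp.exists_hasCompactSupport_integral_rpow_sub_le
    (p := 2) (by norm_num) (by simpa using hFL) ht0
  obtain ⟨G, hGc, hGs, hG⟩ := hG₁s.exists_contDiff_near hG₁c (Real.sqrt_pos.2 ht0)
  have hGm := hGc.continuous.measurable
  obtain ⟨C, hC⟩ := hGs.exists_bound_of_continuous hGc.continuous
  have hgm : Measurable fun ω => G (restr Λ ω) := hGm.comp hrm
  have hrep : Represents Λ G fun ω => G (restr Λ ω) := fun ω => rfl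
  let g : M.LocalL2 := LocalL2.mk (fun ω => G (restr Λ ω)) ⟨Λ, hrep.dependsOn⟩ hgm
    (memLp_two_bounded hgm ⟨C, fun ω => hC _⟩)
  refine ⟨g, isUniformlyTame_of_hasCompactSupport hGs hGc hrep, ?_⟩
  have hd : ∀ ω, (g - f : M.LocalL2) ω = G (restr Λ ω) - F (restr Λ ω) := fun ω => by
    rw [LocalL2.sub_apply, hF ω]
    rfl
  have hdep : DependsOn (g - f : M.LocalL2) (Λ : Set ℤ) := by
    intro ω ω' h
    have e : restr Λ ω = restr Λ ω' := funext fun x => h x x.2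
    rw [hd, hd, e]
  have hI : Integrable (fun y => (F y - G₁ y) ^ 2) ν := by
    have hG₁L' : MemLp G₁ 2 ν := by simpa using hG₁L
    exact (hFL.sub hG₁L').integrable_sq
  have hint : ∫ ω, (g - f : M.LocalL2) ω ^ 2 ∂M.gibbs ≤ 2 * t + 2 * t := by
    simp only [hd]
    have e : ∫ ω, (G (restr Λ ω) - F (restr Λ ω)) ^ 2 ∂M.gibbs = ∫ y, (G y - F y) ^ 2 ∂ν :=
      (integral_map hrm.aemeasurable ((hGm.sub hFm).pow_const 2).aestronglyMeasurable).symm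
    rw [e]
    have h1 : ∫ y, (F y - G₁ y) ^ 2 ∂ν ≤ t := by simpa using hG₁
    calc _ ≤ ∫ y, (2 * (F y - G₁ y) ^ 2 + 2 * t) ∂ν := by
          refine integral_mono_of_nonneg (ae_of_all _ fun y => sq_nonneg _)
            ((hI.const_mul 2).add (integrable_const _)) (ae_of_all _ fun y => ?_)
          have h2 := pow_le_pow_left₀ (abs_nonneg _) (hG y) 2
          rw [sq_abs, Real.sq_sqrt ht0.le] at h2
          simp only
          nlinarith [sq_nonneg ((G y - G₁ y) + (F y - G₁ y))]
      _ = 2 * ∫ y, (F y - G₁ y) ^ 2 ∂ν + 2 * t := by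
          rw [integral_add (hI.const_mul 2) (integrable_const _), integral_const_mul]
          simp
      _ ≤ _ := by linarith
  refine lt_of_pow_lt_pow_left₀ 2 hρ.le ((M.norm_sq_le _ hdep).trans_lt (lt_of_le_of_lt ?_ ht))
  exact mul_le_mul_of_nonneg_left hint hN0

variable (M) in
/-- The range of `z - L` is dense for large `z`. -/
theorem exists_dense_range : ∃ z₀ : ℝ, ∀ z, z₀ ≤ z →
    Dense {u | ∃ w ∈ M.generatorSubmodule, z • w.1 - w.2 = u} := by
  obtain ⟨z₀, h⟩ := M.exists_norm_resolvent_sub_lt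
  refine ⟨z₀, fun z hz => ?_⟩
  rw [Metric.dense_iff]
  intro u ε hε
  obtain ⟨v, hv, f, rfl⟩ := Metric.dense_iff.1
    (UniformSpace.Completion.denseRange_coe (α := M.LocalL2)) u (ε / 3) (by positivity)
  obtain ⟨g, hg, hgf⟩ := exists_uniformlyTame_near f (by positivity : 0 < ε / 3)
  obtain ⟨k, hk, hkg⟩ := h z hz g hg (ε / 3) (by positivity)
  refine ⟨((z • k - generatorL2 hk : M.LocalL2) : M.H), ?_, _,
    mem_generatorGraph_iff.2 ⟨k, hk, rfl⟩, ?_⟩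
  · rw [Metric.mem_ball] at hv ⊢
    have h1 : dist ((z • k - generatorL2 hk : M.LocalL2) : M.H) (g : M.H) < ε / 3 := by
      rw [UniformSpace.Completion.dist_eq, dist_eq_norm]; exact hkg
    have h2 : dist (g : M.H) (f : M.H) < ε / 3 := by
      rw [UniformSpace.Completion.dist_eq, dist_eq_norm]; exact hgf
    have h3 := dist_triangle ((z • k - generatorL2 hk : M.LocalL2) : M.H) (g : M.H) (f : M.H)
    have h4 := dist_triangle ((z • k - generatorL2 hk : M.LocalL2) : M.H) (f : M.H) u
    linarith
  · rw [UniformSpace.Completion.coe_sub, UniformSpace.Completion.coe_smul]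

end Chain

end

/-! ### The momentum as an eigenvector, and the explicit coefficients. -/

noncomputable section

open Config

namespace Chain

variable {M : Chain}

lemma integral_shiftL (x : ℤ) (f : M.LocalL2) :
    ∫ ω, shiftL M x f ω ∂M.gibbs = ∫ ω, f ω ∂M.gibbs :=
  integral_shift x f.measurable

/-- The form sums over all translates, so a shift of one argument only reindexes the sum. -/
lemma semiInner_shiftL (f g : M.LocalL2) : M.semiInner (shiftL M 1 f) g = M.semiInner f g := by
  unfold semiInner
  rw [← (Equiv.subRight (1 : ℤ)).tsum_eq (M.corr f g)]
  refine tsum_congr fun x => ?_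
  rw [corr_eq, corr_eq, l2Form_shiftL, integral_shiftL]
  rfl

/-- Gradients vanish in `ℍ`. -/
lemma coe_shiftL_sub (f : M.LocalL2) : ((shiftL M 1 f - f : M.LocalL2) : M.H) = 0 := by
  have h : ∀ g : M.LocalL2, inner ℝ (shiftL M 1 f - f : M.LocalL2) g = 0 := fun g => by
    rw [inner_sub_left, inner_eq_semiInner, inner_eq_semiInner, semiInner_shiftL, sub_self]
  have h1 := h (shiftL M 1 f - f)
  rw [real_inner_self_eq_norm_sq] at h1
  rw [← norm_eq_zero, UniformSpace.Completion.norm_coe]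
  exact pow_eq_zero_iff two_ne_zero |>.1 h1

/-- All the functions live on one window, so dominated convergence in `L²` implies convergence in
`ℍ`. -/
lemma tendsto_coe_of_dominated {F : ℕ → M.LocalL2} {f : M.LocalL2} {Λ : Finset ℤ}
    (hF : ∀ n, DependsOn (F n) (Λ : Set ℤ)) (hf : DependsOn f (Λ : Set ℤ)) {b : Config → ℝ}
    (hb : MemLp b 2 M.gibbs) (hFb : ∀ n ω, |F n ω - f ω| ≤ |b ω|)
    (hlim : ∀ ω, Tendsto (fun n => F n ω) atTop (𝓝 (f ω))) :
    Tendsto (fun n => (F n : M.H)) atTop (𝓝 (f : M.H)) := by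
  have hdep : ∀ n, DependsOn (F n - f : M.LocalL2) (Λ : Set ℤ) := fun n ω ω' h => by
    rw [LocalL2.sub_apply, LocalL2.sub_apply, hF n h, hf h]
  have h1 : Tendsto (fun n => ∫ ω, (F n - f : M.LocalL2) ω ^ 2 ∂M.gibbs) atTop
      (𝓝 (∫ _ : Config, (0 : ℝ) ∂M.gibbs)) := by
    refine tendsto_integral_of_dominated_convergence (fun ω => b ω ^ 2)
      (fun n => ((F n - f : M.LocalL2).measurable.pow_const 2).aestronglyMeasurable)
      hb.integrable_sq (fun n => ae_of_all _ fun ω => ?_) (ae_of_all _ fun ω => ?_)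
    · rw [Real.norm_of_nonneg (sq_nonneg _)]
      exact sq_le_sq.2 (hFb n ω)
    · have := ((hlim ω).sub_const (f ω)).pow 2
      simpa [LocalL2.sub_apply] using this
  have h2 := h1.const_mul ((Finset.image₂ (fun a b : ℤ => a - b) Λ Λ).card : ℝ)
  rw [integral_zero, mul_zero] at h2
  have h3 : Tendsto (fun n => ‖F n - f‖ ^ 2) atTop (𝓝 0) :=
    squeeze_zero (fun n => sq_nonneg _) (fun n => M.norm_sq_le _ (hdep n)) h2
  rw [tendsto_iff_norm_sub_tendsto_zero]
  have h4 := (Real.continuous_sqrt.tendsto 0).comp h3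
  rw [Real.sqrt_zero] at h4
  refine h4.congr fun n => ?_
  rw [Function.comp_apply, Real.sqrt_sq (norm_nonneg _), ← UniformSpace.Completion.coe_sub,
    UniformSpace.Completion.norm_coe]

/-- The bounded function `c sin (p_0 / c)`. -/
def sinMomentum (c : ℝ) (ω : Config) : ℝ := c * Real.sin ((ω 0).2 / c)

lemma isC01_sinMomentum {c : ℝ} (hc : 0 < c) : IsC01 (sinMomentum c) := by
  have hd : ∀ s : ℝ, HasDerivAt (fun s => c * Real.sin (s / c)) (Real.cos (s / c)) s := fun s => by
    have := (((hasDerivAt_id s).div_const c).sin).const_mul c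
    refine this.congr_deriv ?_
    simp only [id]
    field_simp
  have h : IsC1Bounded fun s : ℝ => c * Real.sin (s / c) := by
    refine ⟨by fun_prop, ⟨c, fun s => ?_⟩, 1, fun s => ?_⟩
    · rw [abs_mul, abs_of_pos hc]
      exact mul_le_of_le_one_right hc.le (Real.abs_sin_le_one _)
    · rw [← norm_deriv_eq_norm_fderiv, (hd s).deriv]
      exact Real.abs_cos_le_one _
  let A : (({0} : Finset ℤ) → ℝ × ℝ) →L[ℝ] ℝ := (ContinuousLinearMap.snd ℝ ℝ ℝ).comp
    (ContinuousLinearMap.proj (⟨0, by simp⟩ : ({0} : Finset ℤ)))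
  have hA := h.comp_clm A
  exact ⟨{0}, fun y => c * Real.sin (A y / c), fun ω => rfl, hA⟩

lemma dependsOn_sinMomentum (c : ℝ) : DependsOn (sinMomentum c) (({0} : Finset ℤ) : Set ℤ) := by
  intro ω ω' h
  simp [sinMomentum, h 0 (by simp)]

/-- The momentum is unbounded, hence not in `C_0^1`. This truncation is odd in `p_0`, so the noise
acts on it exactly as on `p_0`, by multiplication by `-1`. -/
lemma generator_sinMomentum {c : ℝ} (hc : 0 < c) (ω : Config) : M.generator (sinMomentum c) ω =
    (M.V' (ω 1).1 - M.V' (ω 0).1) * Real.cos ((ω 0).2 / c) - M.γ * sinMomentum c ω := by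
  have hd : HasDerivAt (fun s => c * Real.sin (s / c)) (Real.cos ((ω 0).2 / c)) (ω 0).2 := by
    have := (((hasDerivAt_id (ω 0).2).div_const c).sin).const_mul c
    refine this.congr_deriv ?_
    simp only [id]
    field_simp
  have h1 : partialP 0 (sinMomentum c) ω = Real.cos ((ω 0).2 / c) := by
    simp only [partialP, sinMomentum, Function.update_self]
    exact hd.deriv
  have h2 : partialR 0 (sinMomentum c) ω = 0 := by
    simp only [partialR, sinMomentum, Function.update_self, deriv_const]
  unfold generator
  rw [liouville_eq_sum (dependsOn_sinMomentum c) subset_rfl,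
    noise_eq_sum (dependsOn_sinMomentum c) subset_rfl, Finset.sum_singleton, Finset.sum_singleton,
    h1, h2]
  have h3 : sinMomentum c (flipOn {0} ω) = -sinMomentum c ω := by
    simp only [sinMomentum, flipOn_apply_of_mem (Set.mem_singleton (0 : ℤ)), neg_div, Real.sin_neg,
      mul_neg]
  rw [h3]
  simp only [zero_add]
  ring

lemma tendsto_sinMomentum (s : ℝ) :
    Tendsto (fun n : ℕ => ((n : ℝ) + 1) * Real.sin (s / (n + 1))) atTop (𝓝 s) := by
  have h0 : Tendsto (fun n : ℕ => s / ((n : ℝ) + 1)) atTop (𝓝 0) := by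
    have := (tendsto_one_div_add_atTop_nhds_zero_nat (𝕜 := ℝ)).const_mul s
    simpa [div_eq_mul_inv] using this
  have h1 : Tendsto (fun n : ℕ => s * Real.sinc (s / ((n : ℝ) + 1))) atTop (𝓝 (s * 1)) := by
    refine Tendsto.const_mul s ?_
    have := (Real.continuous_sinc.tendsto 0).comp h0
    rwa [Real.sinc_zero] at this
  rw [mul_one] at h1
  refine h1.congr fun n => ?_
  have hn : (n : ℝ) + 1 ≠ 0 := by positivity
  rcases eq_or_ne s 0 with rfl | hs
  · simp
  · rw [Real.sinc_of_ne_zero (div_ne_zero hs hn)]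
    field_simp

lemma abs_mul_sin_div_le {c : ℝ} (hc : 0 < c) (s : ℝ) : |c * Real.sin (s / c)| ≤ |s| := by
  rw [abs_mul, abs_of_pos hc]
  have := mul_le_mul_of_nonneg_left (Real.abs_sin_le_abs (x := s / c)) hc.le
  rwa [abs_div, abs_of_pos hc, mul_div_cancel₀ _ hc.ne'] at this

variable (M) in
/-- The function `V'(r_0)`. -/
def force : M.LocalL2 :=
  LocalL2.mk (fun ω => M.V' (ω 0).1) ⟨{0}, fun ω ω' h => by simp [h 0 (by simp)]⟩
    (by have := M.measurable_V'; fun_prop) (M.memLp_V' 0)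

/-- The momentum is an eigenvector of the generator in `ℍ`. -/
lemma p₀_mem_closure : (M.p₀, -M.γ • M.p₀) ∈ closure M.generatorGraph := by
  have hc : ∀ n : ℕ, (0 : ℝ) < n + 1 := fun n => by positivity
  let F : ℕ → M.LocalL2 := fun n => LocalL2.mk (sinMomentum (n + 1)) ⟨_, dependsOn_sinMomentum _⟩
    (isC01_sinMomentum (hc n)).measurable (memLp_two_bounded (isC01_sinMomentum (hc n)).measurable
      (isC01_sinMomentum (hc n)).bounded)
  have hF : ∀ n, IsC01 (F n) := fun n => isC01_sinMomentum (hc n)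
  have hFω : ∀ n ω, F n ω = ((n : ℝ) + 1) * Real.sin ((ω 0).2 / (n + 1)) := fun _ _ => rfl
  have hmem : ∀ n, ((F n : M.H), (generatorL2 (hF n) : M.H)) ∈ M.generatorGraph := fun n =>
    mem_generatorGraph_iff.2 ⟨F n, hF n, rfl⟩
  have hL : ∀ n ω, generatorL2 (hF n) ω =
      (M.V' (ω 1).1 - M.V' (ω 0).1) * Real.cos ((ω 0).2 / (n + 1)) - M.γ * F n ω := fun n ω =>
    generator_sinMomentum (hc n) ω
  have hmω : ∀ ω, M.momentum ω = (ω 0).2 := fun _ => rfl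
  set D : M.LocalL2 := shiftL M 1 M.force - M.force with hD
  have hDω : ∀ ω, D ω = M.V' (ω 1).1 - M.V' (ω 0).1 := fun ω => rfl
  have h1 : Tendsto (fun n => (F n : M.H)) atTop (𝓝 M.p₀) := by
    refine tendsto_coe_of_dominated (Λ := {0}) (fun n => dependsOn_sinMomentum _)
      (fun ω ω' h => by rw [hmω, hmω, h 0 (by simp)]) ((M.memLp_p 0).const_mul 2) (fun n ω => ?_)
      fun ω => tendsto_sinMomentum (ω 0).2
    have := abs_mul_sin_div_le (hc n) (ω 0).2
    rw [hFω, hmω, abs_mul, abs_two]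
    exact (abs_sub _ _).trans (by linarith)
  -- As the truncation is removed the cosine tends to `1`, so the images converge to `V'(r_1) -
  -- V'(r_0) - γ p_0`.
  have h2 : Tendsto (fun n => (generatorL2 (hF n) : M.H)) atTop
      (𝓝 ((D - M.γ • M.momentum : M.LocalL2) : M.H)) := by
    have hb : MemLp (fun ω => 2 * |D ω| + M.γ * (2 * |(ω 0).2|)) 2 M.gibbs :=
      (D.memLp.abs.const_mul 2).add (((M.memLp_p 0).abs.const_mul 2).const_mul M.γ)
    have hlω : ∀ ω, (D - M.γ • M.momentum : M.LocalL2) ω =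
      M.V' (ω 1).1 - M.V' (ω 0).1 - M.γ * (ω 0).2 := fun _ => rfl
    refine tendsto_coe_of_dominated (Λ := {0, 1}) (fun n ω ω' h => ?_) (fun ω ω' h => ?_) hb
      (fun n ω => ?_) fun ω => ?_
    · rw [hL, hL, hFω, hFω, h 0 (by simp), h 1 (by simp)]
    · rw [hlω, hlω, h 0 (by simp), h 1 (by simp)]
    · have hγ := M.γ_pos
      have h3 := abs_mul_sin_div_le (hc n) (ω 0).2
      have h4 := Real.abs_cos_le_one ((ω 0).2 / (n + 1))
      rw [hL, hlω, hDω, hFω]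
      set d := M.V' (ω 1).1 - M.V' (ω 0).1
      have e : d * Real.cos ((ω 0).2 / (n + 1)) -
          M.γ * ((n + 1) * Real.sin ((ω 0).2 / (n + 1))) - (d - M.γ * (ω 0).2) =
          (d * Real.cos ((ω 0).2 / (n + 1)) - d) -
          M.γ * ((n + 1) * Real.sin ((ω 0).2 / (n + 1)) - (ω 0).2) := by ring
      have h5 : |d * Real.cos ((ω 0).2 / (n + 1))| ≤ |d| := by
        rw [abs_mul]
        exact mul_le_of_le_one_right (abs_nonneg _) h4
      have h6 := abs_sub (d * Real.cos ((ω 0).2 / (n + 1))) d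
      have h7 := abs_sub ((n + 1) * Real.sin ((ω 0).2 / (n + 1))) (ω 0).2
      have h8 : M.γ * |(n + 1) * Real.sin ((ω 0).2 / (n + 1)) - (ω 0).2| ≤
          M.γ * (2 * |(ω 0).2|) := by gcongr; linarith
      rw [e]
      refine (abs_sub _ _).trans (le_trans ?_ (le_abs_self _))
      rw [abs_mul, abs_of_pos hγ]
      linarith
    · simp only [hL, hlω]
      refine Tendsto.sub ?_ ((tendsto_sinMomentum (ω 0).2).const_mul M.γ)
      have h0 : Tendsto (fun n : ℕ => (ω 0).2 / ((n : ℝ) + 1)) atTop (𝓝 0) := by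
        have := (tendsto_one_div_add_atTop_nhds_zero_nat (𝕜 := ℝ)).const_mul (ω 0).2
        simpa [div_eq_mul_inv] using this
      have := ((Real.continuous_cos.tendsto 0).comp h0).const_mul (M.V' (ω 1).1 - M.V' (ω 0).1)
      simpa using this
  -- The force difference is a gradient, so it is zero in `ℍ` and only `-γ p_0` remains.
  have h3 : ((D - M.γ • M.momentum : M.LocalL2) : M.H) = -M.γ • M.p₀ := by
    rw [UniformSpace.Completion.coe_sub, hD, coe_shiftL_sub, UniformSpace.Completion.coe_smul,
      zero_sub, neg_smul]
    rfl
  rw [h3] at h2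
  exact mem_closure_of_tendsto (h1.prodMk_nhds h2) (Eventually.of_forall hmem)

lemma resolvent_p₀ {z : ℝ} (hz : 0 < z) {R : M.H →L[ℝ] M.H} (hR : M.IsResolvent z R) :
    R M.p₀ = (z + M.γ)⁻¹ • M.p₀ := by
  rw [hR]
  have h : (M.p₀, -M.γ • M.p₀) ∈ M.generatorSubmodule.topologicalClosure := p₀_mem_closure
  have h1 := M.generatorSubmodule.topologicalClosure.smul_mem (z + M.γ)⁻¹ h
  have hzγ : z + M.γ ≠ 0 := (add_pos hz M.γ_pos).ne'
  have e : z • (z + M.γ)⁻¹ • M.p₀ - M.p₀ = (z + M.γ)⁻¹ • -M.γ • M.p₀ := by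
    rw [smul_smul, smul_smul]
    nth_rewrite 2 [← one_smul ℝ M.p₀]
    rw [← sub_smul]
    congr 1
    field_simp
    ring
  rw [e]
  exact h1

/-- Integration by parts in `p` against `G = p`. -/
lemma integral_site_p_sq : ∫ y, y.2 ^ 2 ∂M.siteMeasure = M.T := by
  have hp : Integrable (fun y : ℝ × ℝ => y.2) M.siteMeasure :=
    M.memLp_site_p.integrable (by norm_num)
  have hf : ∀ y : ℝ × ℝ, fderiv ℝ (fun y : ℝ × ℝ => y.2) y (0, 1) = 1 := fun y => by
    rw [fderiv_snd]; rfl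
  have h := M.integral_site_mul_fderiv (φ := fun _ => 1) (G := fun y => y.2) (v := (0, 1))
    (by fun_prop) (fun y => by simp) (by fun_prop)
    (by simp only [hf]; exact integrable_const _)
    (by
      refine (M.memLp_site_p.integrable_sq.const_mul M.T⁻¹).congr (ae_of_all _ fun y => ?_)
      simp only; ring)
    (by simpa using hp)
  simp only [hf] at h
  have e : ∀ y : ℝ × ℝ, 1 * ((M.V' y.1 - M.τ) / M.T * 0 + y.2 / M.T * 1) * y.2 =
    M.T⁻¹ * y.2 ^ 2 := fun y => by ring
  simp only [e] at h
  rw [integral_const_mul M.T⁻¹] at h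
  simp only [mul_one, integral_const, probReal_univ, smul_eq_mul] at h
  have := M.T_pos.ne'
  field_simp at h
  exact h.symm

/-- Integration by parts in `r` against a constant: `τ` is the mean of the force. -/
lemma integral_site_V'_sub : ∫ y, (M.V' y.1 - M.τ) ∂M.siteMeasure = 0 := by
  have hV : Integrable (fun y : ℝ × ℝ => M.V' y.1 - M.τ) M.siteMeasure :=
    (M.memLp_site_V'.integrable (by norm_num)).sub (integrable_const _)
  have h := M.integral_site_mul_fderiv (φ := fun _ => 1) (G := fun _ => 1) (v := (1, 0))
    (by fun_prop) (fun y => by simp) (by fun_prop) (by simp)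
    (by
      refine (hV.const_mul M.T⁻¹).congr (ae_of_all _ fun y => ?_)
      simp only; ring)
    (by simp)
  have e : ∀ y : ℝ × ℝ, (1 : ℝ) * ((M.V' y.1 - M.τ) / M.T * 1 + y.2 / M.T * 0) * 1 =
    M.T⁻¹ * (M.V' y.1 - M.τ) := fun y => by ring
  simp only [e] at h
  rw [integral_const_mul M.T⁻¹] at h
  simp only [fderiv_fun_const, Pi.zero_apply, zero_apply, mul_zero,
    integral_zero] at h
  exact (mul_eq_zero.1 h.symm).resolve_left (inv_ne_zero M.T_pos.ne')

lemma integral_eq_zero_of_flip {f : Config → ℝ} (s : Set ℤ) (h : ∀ ω, f (flipOn s ω) = -f ω) :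
    ∫ ω, f ω ∂M.gibbs = 0 := by
  have h1 := integral_flipOn (M := M) s f
  simp only [h, integral_neg] at h1
  linarith

lemma integral_momentum : ∫ ω, M.momentum ω ∂M.gibbs = 0 :=
  integral_eq_zero_of_flip Set.univ fun ω => by
    change (flipOn Set.univ ω 0).2 = -(ω 0).2
    rw [flipOn_apply_of_mem (Set.mem_univ _)]

lemma inner_p₀_p₀ : inner ℝ M.p₀ M.p₀ = M.T := by
  have hdep : DependsOn M.momentum (({0} : Finset ℤ) : Set ℤ) := fun ω ω' h => by
    change (ω 0).2 = (ω' 0).2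
    rw [h 0 (by simp)]
  unfold p₀
  rw [UniformSpace.Completion.inner_coe, inner_eq_semiInner, semiInner, tsum_eq_single 0]
  · rw [corr_eq, integral_momentum, mul_zero, sub_zero, ← integral_site_p_sq, l2Form_apply,
      ← (M.measurePreserving_coord 0).map_eq, integral_map (measurable_pi_apply 0).aemeasurable
      (by fun_prop : Measurable fun y : ℝ × ℝ => y.2 ^ 2).aestronglyMeasurable]
    refine integral_congr_ae (ae_of_all _ fun ω => ?_)
    change (ω 0).2 * (ω (0 + 0)).2 = (ω 0).2 ^ 2
    rw [add_zero, sq]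
  · intro x hx
    exact corr_eq_zero M.momentum.measurable M.momentum.measurable hdep hdep (by simpa using hx)

variable (M) in
/-- The heat current `-p_0 (V'(r_1) - τ)` as a local square integrable function. -/
def heatL2 : M.LocalL2 := M.energyCurrent + M.τ • M.momentum

lemma heatL2_apply (ω : Config) : M.heatL2 ω = -(ω 0).2 * (M.V' (ω 1).1 - M.τ) := by
  change -(ω 0).2 * M.V' (ω 1).1 + M.τ * (ω 0).2 = _
  ring

/-- For `x = 0` the factor `V'(r_1) - τ` is centred and independent of `p_0²`. For `x ≠ 0` the
integrand is odd in `p_0`. Adding `τ p_0` to the energy current is what achieves the centring. -/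
lemma inner_heatCurrent_p₀ : inner ℝ M.heatCurrent M.p₀ = 0 := by
  change inner ℝ (M.heatL2 : M.H) (M.momentum : M.H) = 0
  rw [UniformSpace.Completion.inner_coe, inner_eq_semiInner, semiInner]
  refine (tsum_congr fun x => ?_).trans tsum_zero
  have hI := integrable_mul_shift M.heatL2 M.momentum x
  rw [corr_eq, integral_momentum, mul_zero, sub_zero, l2Form_apply]
  have e : ∀ ω, M.heatL2 ω * shiftL M x M.momentum ω =
      -(ω 0).2 * (M.V' (ω 1).1 - M.τ) * (ω (0 + x)).2 := fun ω => by
    rw [heatL2_apply]; rfl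
  have hI' : Integrable (fun ω => M.heatL2 ω * shiftL M x M.momentum ω) M.gibbs := hI
  rcases eq_or_ne x 0 with rfl | hx
  · rw [integral_update M 1 hI']
    refine (integral_congr_ae (ae_of_all _ fun ω => ?_)).trans (integral_zero _ _)
    have h01 : (0 : ℤ) ≠ 1 := by norm_num
    simp only [e, add_zero, Function.update_self, Function.update_of_ne h01]
    have e2 : ∀ y : ℝ × ℝ, -(ω 0).2 * (M.V' y.1 - M.τ) * (ω 0).2 =
      -((ω 0).2 ^ 2) * (M.V' y.1 - M.τ) := fun y => by ring
    simp only [e2]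
    rw [integral_const_mul, integral_site_V'_sub, mul_zero]
  · refine integral_eq_zero_of_flip {0} fun ω => ?_
    have h1 : (flipOn {0} ω 1).1 = (ω 1).1 := by
      rw [flipOn_apply_of_notMem (by simp)]
    have h2 : flipOn {0} ω (0 + x) = ω (0 + x) := flipOn_apply_of_notMem (by simpa using hx) ω
    rw [e, e, h1, h2, flipOn_apply_of_mem (by simp)]
    ring

lemma p₀_mem_antisymm : M.p₀ ∈ M.antisymm :=
  subset_closure ⟨M.momentum, fun _ => rfl, rfl⟩

lemma heatCurrent_mem_antisymm : M.heatCurrent ∈ M.antisymm :=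
  subset_closure ⟨M.heatL2, fun ω => by
    rw [heatL2_apply, heatL2_apply]
    simp only [reverse]
    ring, rfl⟩

end Chain

end

/-- Existence of the Green-Kubo formula for the one-dimensional anharmonic chain with velocity-flip
noise. The resolvents `(z - L)⁻¹`, `z > 0`, exist as bounded operators of `ℍ` (they are unique by
`Chain.IsResolvent`), and `𝓝[>] 0` is the filter of `z → 0`, `z > 0`. -/
theorem mainTheorem1 (M : Chain) :
    ∃ R : ℝ → (M.H →L[ℝ] M.H),
      (∀ z : ℝ, 0 < z → M.IsResolvent z (R z)) ∧
      (∃ σ : M.H → M.H → ℝ, ∀ f ∈ M.antisymm, ∀ g ∈ M.antisymm,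
        Tendsto (fun z : ℝ => inner ℝ f (R z g)) (𝓝[>] 0) (𝓝 (σ f g)) ∧ σ f g = σ g f) ∧
      ∃ κe κer κr κre : ℝ,
        Tendsto (fun z : ℝ => (M.T ^ 2)⁻¹ * inner ℝ M.heatCurrent (R z M.heatCurrent))
          (𝓝[>] 0) (𝓝 κe) ∧
        Tendsto (fun z : ℝ => M.T⁻¹ * inner ℝ M.p₀ (R z M.heatCurrent)) (𝓝[>] 0) (𝓝 κer) ∧
        Tendsto (fun z : ℝ => M.T⁻¹ * inner ℝ M.p₀ (R z M.p₀)) (𝓝[>] 0) (𝓝 κr) ∧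
        Tendsto (fun z : ℝ => (M.T ^ 2)⁻¹ * inner ℝ M.heatCurrent (R z M.p₀))
          (𝓝[>] 0) (𝓝 κre) ∧
        κr = M.γ⁻¹ ∧ κer = κre ∧ κre = 0 := by
  have hex : ∀ z : ℝ, 0 < z → ∃ R : M.H →L[ℝ] M.H, M.IsResolvent z R := fun z hz =>
    exists_graphResolvent M.generatorSubmodule (fun w hw => (M.generatorSubmodule_gap w hw).trans
        (by
      have := M.γ_pos
      have := sq_nonneg ‖w.1 - M.reversal w.1‖
      nlinarith)) M.exists_dense_range hz
  choose R' hR' using hex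
  let R : ℝ → (M.H →L[ℝ] M.H) := fun z => if h : 0 < z then R' z h else 0
  have hR : ∀ z : ℝ, 0 < z → M.IsResolvent z (R z) := fun z hz => by
    simp only [R, dif_pos hz]
    exact hR' z hz
  have hrev := inner_reversal_of_mem_closure (M.generatorSubmodule_reversal)
  obtain ⟨σ, hσ⟩ := exists_tendsto_inner_resolvent_bilin (c := M.γ / 4)
    (by have := M.γ_pos; positivity) M.norm_reversal M.inner_reversal hrev
    (inner_le_of_mem_closure M.generatorSubmodule_gap) hR
  have hp : M.reversal M.p₀ = -M.p₀ := M.reversal_of_mem_antisymm M.p₀_mem_antisymm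
  have hh : M.reversal M.heatCurrent = -M.heatCurrent :=
    M.reversal_of_mem_antisymm M.heatCurrent_mem_antisymm
  refine ⟨R, hR, ⟨σ, fun f hf g hg => hσ f g (M.reversal_of_mem_antisymm hf)
    (M.reversal_of_mem_antisymm hg)⟩, (M.T ^ 2)⁻¹ * σ M.heatCurrent M.heatCurrent, 0, M.γ⁻¹, 0,
    (hσ _ _ hh hh).1.const_mul _, ?_, ?_, ?_, rfl, rfl, rfl⟩
  · refine tendsto_const_nhds.congr' ?_
    filter_upwards [self_mem_nhdsWithin] with z hz
    -- Reversibility moves the resolvent from the heat current to `p_0`, where it is the scalar `(z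
    -- + γ)⁻¹`. The coefficient thus vanishes for every `z > 0`, by orthogonality.
    have h := inner_resolvent_reversal hrev (hR z hz) M.p₀ M.heatCurrent
    rw [Chain.resolvent_p₀ hz (hR z hz), map_smul, hp, inner_smul_left, inner_neg_left,
        inner_neg_left,
      real_inner_comm M.heatCurrent M.p₀, Chain.inner_heatCurrent_p₀, neg_zero, mul_zero] at h
    rw [neg_eq_zero.1 h.symm, mul_zero]
  · have hlim : Tendsto (fun z : ℝ => (z + M.γ)⁻¹) (𝓝[>] 0) (𝓝 M.γ⁻¹) := by
      have h : ContinuousAt (fun z : ℝ => (z + M.γ)⁻¹) 0 :=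
        (continuousAt_id.add continuousAt_const).inv₀ (by simpa using M.γ_pos.ne')
      have h' := h.tendsto.mono_left (nhdsWithin_le_nhds (s := Set.Ioi 0))
      rwa [zero_add] at h'
    refine hlim.congr' ?_
    filter_upwards [self_mem_nhdsWithin] with z hz
    rw [Chain.resolvent_p₀ hz (hR z hz), inner_smul_right, Chain.inner_p₀_p₀, mul_comm _ M.T,
      inv_mul_cancel_left₀ M.T_pos.ne']
  · refine tendsto_const_nhds.congr' ?_
    filter_upwards [self_mem_nhdsWithin] with z hz
    rw [Chain.resolvent_p₀ hz (hR z hz), inner_smul_right, Chain.inner_heatCurrent_p₀, mul_zero,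
        mul_zero]
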